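/- **Ordinals and operators.** Let $\Omega=\aleph_1$ and let $\varphi$ be the binary Veblen function. By recursion on $\alpha$, let $B^\Omega(\alpha)$ be the closure of $\{0,\Omega\}$ under $+$, $\varphi$ and $\xi\mapsto\psi_\Omega(\xi)$ for $\xi<\alpha$, and let $\psi_\Omega(\alpha)=\min\{\rho<\Omega:\rho\notin B^\Omega(\alpha)\}$. Let $\varepsilon_{\Omega+1}$ be the least $\eta>\Omega$ with $\omega^\eta=\eta$. All ordinals below are taken from $ON:=B^\Omega(\varepsilon_{\Omega+1})$. An *operator* is a map $\mathcal H:P(ON)\to P(ON)$ that is monotone, inclusive ($X\subseteq\mathcal H(X)$) and idempotent, with $0,\Omega\in\mathcal H(X)$, and such that for $\alpha$ with Cantor normal form $\omega^{\alpha_1}+\dots+\omega^{\alpha_n}$ one has $\alpha\in\mathcal H(X)$ iff $\alpha_1,\dots,\alpha_n\in\mathcal H(X)$, for all $X$. Write $\mathcal H[\bar\beta](X)=\mathcal H(X\cup\{\bar\beta\})$, and $\alpha\in\mathcal H$ for $\alpha\in\mathcal H(\emptyset)$. **The theory $\mathbf{IKP}(\mathcal E)$.** Formulas are built from atoms $a\in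 b$ by $\neg,\wedge,\vee,\to$, unbounded quantifiers $\forall x,\exists x$, bounded quantifiers $(\forall x\in a),(\exists x\in a)$ and primitive exponentiation-bounded quantifiers $(\forall x\in{}^ab),(\exists x\in{}^ab)$. Here $a=b$ abbreviates $(\forall x\in a)(x\in b)\wedge(\forall x\in b)(x\in a)$, and $\mathrm{fun}(x,a,b)$ is the usual bounded formula saying that $x$ is a function from $a$ to $b$. A formula is $\Delta_0^{\mathcal E}$ if it has no unbounded quantifier. Sequents $\Gamma\Rightarrow\Delta$ consist of finite sets of formulas with $|\Delta|\le 1$. The axioms are, for every $\Gamma$: * $\Gamma,A\Rightarrow A$ for $A\in\Delta_0^{\mathcal E}$; * $\Gamma\Rightarrow a=b\wedge B(a)\to B(b)$ for $B\in\Delta_0^{\mathcal E}$; * $\Gamma\Rightarrow\exists x(a\in x\wedge b\in x)$; * $\Gamma\Rightarrow\exists x(\forall y\in a)(\forall z\in y)(z\in x)$; * $\Gamma\Rightarrow\exists x[(\exists y\in x)\,y\in x\wedge(\forall y\in x)(\exists z\in x)\,y\in z]$; * $\Gamma\Rightarrow\exists x[(\forall y\in x)(y\in a\wedge A(y))\wedge(\forall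 y\in a)(A(y)\to y\in x)]$ for $A\in\Delta_0^{\mathcal E}$; * $\Gamma\Rightarrow(\forall x\in a)\exists y\,B(x,y)\to\exists z(\forall x\in a)(\exists y\in z)B(x,y)$ for $B\in\Delta_0^{\mathcal E}$; * $\Gamma\Rightarrow\forall u[(\forall x\in u)G(x)\to G(u)]\to\forall u\,G(u)$ for every formula $G$; * $\Gamma\Rightarrow\exists z(\forall x\in{}^ab)(x\in z)$. The rules are Cut, the left and right rules of intuitionistic logic for the connectives (including: from $\Gamma\Rightarrow$ infer $\Gamma\Rightarrow A$) and for $\forall,\exists$, and the corresponding rules for $(\forall x\in b)F(x)$, $(\exists x\in b)F(x)$, $(\forall x\in{}^ab)F(x)$, $(\exists x\in{}^ab)F(x)$ with minor formula $c\in b\to F(c)$, $c\in b\wedge F(c)$, $\mathrm{fun}(c,a,b)\to F(c)$, $\mathrm{fun}(c,a,b)\wedge F(c)$ respectively; the variable $c$ may not occur in the conclusion of a right rule for a universal quantifier or of a left rule for an existential quantifier. **The system $\mathbf{IRS}_\Omega^{\mathbb E}$.** The terms are $\mathbb E_\alpha$ and $a_i^\alpha$ ($\alpha<\Omega$, $i<\omega$),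 and $[x\in t\mid F(x,\bar s)]$ for $F\in\Delta_0^{\mathcal E}$ and terms $t,\bar s$. Its formulas are $A(\bar s)$ with $A(\bar a)$ a formula of $\mathbf{IKP}(\mathcal E)$ and $\bar s$ terms. The classes $\Sigma^{\mathcal E}$, $\Pi^{\mathcal E}$ are the smallest that contain the $\Delta_0^{\mathcal E}$-formulas, are closed under $\wedge,\vee$, all bounded quantifiers, and $\exists x$ (for $\Sigma^{\mathcal E}$) resp. $\forall x$ (for $\Pi^{\mathcal E}$), and contain $\neg C$ and $C\to A$ whenever $A$ is in the class and $C$ in the other one. The $\bar\beta$-rank of $A(\bar s)$, where $\bar\beta<\Omega$ is attached to $\bar a$ and $0$ to bound variables, is defined by: $\|s\in t\|=\max(\beta_s,\beta_t)$; $\|A\wedge B\|=\|A\vee B\|=\|A\to B\|=\max(\|A\|,\|B\|)+1$; $\|\neg A\|=\|A\|+1$; and $\max(\beta_t,\|F\|+2)$, $\max(\beta_s+\omega,\beta_t+\omega,\|F\|+2)$, $\max(\Omega,\|F\|+2)$ for a quantifier over $x\in t$, over $x\in{}^st$, and an unbounded one. The axioms are, for all $\Gamma$, terms, and ordinals $<\Omega$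 as indicated: * $\Gamma,A\Rightarrow A$ and $\Gamma,\bar s=\bar t,A(\bar s)\Rightarrow A(\bar t)$ for $A\in\Delta_0^{\mathcal E}$; $\ \Gamma\Rightarrow t=t$; * $\Gamma\Rightarrow\mathbb E_\beta\in\mathbb E_\alpha$ and $\Gamma\Rightarrow a_i^\beta\in\mathbb E_\alpha$ for $\beta<\alpha$; * $\Gamma,t\in\mathbb E_\alpha,s\in t\Rightarrow s\in\mathbb E_\alpha$ and $\Gamma,t\in\mathbb E_{\alpha+1},s\in t\Rightarrow s\in\mathbb E_\alpha$; * $\Gamma,s\in t,F(s,\bar p)\Rightarrow s\in[x\in t\mid F(x,\bar p)]$ and $\Gamma,s\in[x\in t\mid F(x,\bar p)]\Rightarrow s\in t\wedge F(s,\bar p)$; * $\Gamma,s\in\mathbb E_\alpha,t\in\mathbb E_\beta,\mathrm{fun}(p,s,t)\Rightarrow p\in\mathbb E_\gamma$ for $\gamma\ge\max(\alpha,\beta)+2$; * $\Gamma,t\in\mathbb E_\beta,\bar p\in\mathbb E_{\bar\alpha}\Rightarrow[x\in t\mid F(x,\bar p)]\in\mathbb E_\gamma$ for $\gamma\ge\max(\beta,\bar\alpha)$.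 The relation $\mathcal H\vdash^\alpha_\rho\Gamma\Rightarrow\Delta$ (with $|\Delta|\le1$) is defined by recursion on $\alpha$. It always requires $\alpha\in\mathcal H$, and it holds for axioms and for conclusions of the following rules. Here $\vdash^{<\alpha}$ stands for $\vdash^{\alpha'}_\rho$ with some $\alpha'<\alpha$, the same $\alpha'$ for all instances of a premise that is required for all terms and, in propositional rules, for all premises; the operator of a premise is $\mathcal H$ unless another one is named; $\beta,\gamma,\delta<\Omega$. * The propositional rules of $\mathbf{IKP}(\mathcal E)$, with premises $\vdash^{<\alpha}$. * ($\mathbb E$-Lim) $\Gamma,s\in\mathbb E_\gamma\Rightarrow\Delta$, if $\gamma\in\mathcal H$ is $0$ or a limit and $\mathcal H[\delta]\vdash^{<\alpha}\Gamma,s\in\mathbb E_\delta\Rightarrow\Delta$ for all $\delta<\gamma$. * $\Gamma,(\forall x\in t)A(x)\Rightarrow\Delta$, if $\vdash^{<\alpha}\Gamma,s\in t\to A(s)\Rightarrow\Delta$; respectively $\Gamma\Rightarrow(\exists x\in t)A(x)$, if $\vdash^{<\alpha}\Gamma\Rightarrow s\in t\wedge A(s)$; in both cases with $\vdash^{<\alpha}\Gamma\Rightarrow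 t\in\mathbb E_\beta$, $\vdash^{<\alpha}\Gamma\Rightarrow s\in\mathbb E_\gamma$, $\beta,\gamma\in\mathcal H$, $\gamma<\alpha$, $\gamma\le\beta$. * $\Gamma\Rightarrow(\forall x\in t)A(x)$, if $\vdash^{<\alpha}\Gamma\Rightarrow s\in t\to A(s)$ for all terms $s$; respectively $\Gamma,(\exists x\in t)A(x)\Rightarrow\Delta$, if $\vdash^{<\alpha}\Gamma,s\in t\wedge A(s)\Rightarrow\Delta$ for all $s$; in both cases with $\vdash^{<\alpha}\Gamma\Rightarrow t\in\mathbb E_\beta$, $\beta\in\mathcal H$, $\beta<\alpha$. * $\Gamma,(\forall x\in{}^st)A(x)\Rightarrow\Delta$, if $\vdash^{<\alpha}\Gamma,\mathrm{fun}(p,s,t)\to A(p)\Rightarrow\Delta$; respectively $\Gamma\Rightarrow(\exists x\in{}^st)A(x)$, if $\vdash^{<\alpha}\Gamma\Rightarrow\mathrm{fun}(p,s,t)\wedge A(p)$; in both cases with $\vdash^{<\alpha}\Gamma\Rightarrow s\in\mathbb E_\beta$, $\vdash^{<\alpha}\Gamma\Rightarrow t\in\mathbb E_\gamma$, $\vdash^{<\alpha}\Gamma\Rightarrow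 p\in\mathbb E_\delta$, $\beta,\gamma,\delta\in\mathcal H$, $\delta<\alpha$, $\delta\le\max(\beta,\gamma)+2$. * $\Gamma\Rightarrow(\forall x\in{}^st)A(x)$, if $\vdash^{<\alpha}\Gamma\Rightarrow\mathrm{fun}(p,s,t)\to A(p)$ for all terms $p$; respectively $\Gamma,(\exists x\in{}^st)A(x)\Rightarrow\Delta$, if $\vdash^{<\alpha}\Gamma,\mathrm{fun}(p,s,t)\wedge A(p)\Rightarrow\Delta$ for all $p$; in both cases with $\vdash^{<\alpha}\Gamma\Rightarrow s\in\mathbb E_\beta$, $\vdash^{<\alpha}\Gamma\Rightarrow t\in\mathbb E_\gamma$, $\beta,\gamma\in\mathcal H$, $\max(\beta,\gamma)+2\le\alpha$. * $\Gamma,\forall xF(x)\Rightarrow\Delta$, if $\vdash^{\alpha_0}_\rho\Gamma,F(s)\Rightarrow\Delta$; respectively $\Gamma\Rightarrow\exists xF(x)$, if $\vdash^{\alpha_0}_\rho\Gamma\Rightarrow F(s)$; in both cases with $\vdash^{\alpha_1}_\rho\Gamma\Rightarrow s\in\mathbb E_\beta$, $\alpha_0+3,\alpha_1+3<\alpha$,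 $\alpha>\beta\in\mathcal H$. * $\Gamma\Rightarrow\forall xF(x)$, if $\mathcal H[\beta]\vdash^{\alpha_\beta}_\rho\Gamma,s\in\mathbb E_\beta\Rightarrow F(s)$ for all $s$ and all $\beta<\Omega$; respectively $\Gamma,\exists xF(x)\Rightarrow\Delta$, if $\mathcal H[\beta]\vdash^{\alpha_\beta}_\rho\Gamma,s\in\mathbb E_\beta,F(s)\Rightarrow\Delta$ for all $s$ and all $\beta<\Omega$; in both cases with $\beta<\alpha_\beta+3<\alpha$. * ($\Sigma^{\mathcal E}$-Ref) $\Gamma\Rightarrow\exists z\,A^z$, if $\vdash^{\alpha_0}_\rho\Gamma\Rightarrow A$ with $A\in\Sigma^{\mathcal E}$, $\alpha_0+1<\alpha$, $\Omega<\alpha$, where $A^z$ is $A$ with its unbounded quantifiers restricted to $z$. * (Cut) $\Gamma\Rightarrow\Delta$, if $\vdash^{<\alpha}\Gamma,A(\bar s)\Rightarrow\Delta$, $\vdash^{<\alpha}\Gamma\Rightarrow A(\bar s)$, $\vdash^{<\alpha}\Gamma\Rightarrow s_i\in\mathbb E_{\beta_i}$ for all $i$ (with one $\alpha'$ for all $i$),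 $\|A(\bar s)\|_{\bar\beta}<\rho$ and $\bar\beta\in\mathcal H$. **Theorem.** Suppose $\mathbf{IKP}(\mathcal E)\vdash\Gamma[\bar a]\Rightarrow\Delta[\bar a]$. Then there is $k<\omega$ such that for every finite list $\bar a$ of variables that contains all free variables of $\Gamma\Rightarrow\Delta$, all $\mathbf{IRS}_\Omega^{\mathbb E}$ terms $\bar s$, all $\bar\beta<\Omega$ and every operator $\mathcal H$, $$\mathcal H[\bar\beta]\ \vdash^{\,\Omega\cdot\omega^k}_{\,\Omega+k}\ s_1\in\mathbb E_{\beta_1},\dots,s_n\in\mathbb E_{\beta_n},\ \Gamma[\bar s]\Rightarrow\Delta[\bar s].$$ -/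

import Mathlib

universe u v

namespace IKPE

open Ordinal

/-! ### Ordinals -/

/-- The "big" ordinal `Ω`, taken to be the first uncountable ordinal. -/
noncomputable def Om : Ordinal.{0} := ω_ 1

/-- Closure of `{0, Ω}` under `+`, the binary Veblen function and `ξ ↦ ps ξ` for `ξ < α`. -/
inductive BClosure (α : Ordinal.{0}) (ps : ∀ ξ : Ordinal.{0}, ξ < α → Ordinal.{0}) :
    Ordinal.{0} → Prop
  | zero : BClosure α ps 0
  | big : BClosure α ps Om
  | add {ξ η : Ordinal.{0}} : BClosure α ps ξ → BClosure α ps η → BClosure α ps (ξ + η)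
  | phi {ξ η : Ordinal.{0}} : BClosure α ps ξ → BClosure α ps η → BClosure α ps (veblen ξ η)
  | psi {ξ : Ordinal.{0}} (h : ξ < α) : BClosure α ps ξ → BClosure α ps (ps ξ h)

/-- The collapsing function `ψ_Ω(α) = min {ρ < Ω : ρ ∉ B^Ω(α)}`. -/
noncomputable def psi (α : Ordinal.{0}) : Ordinal.{0} :=
  sInf {ρ | ρ < Om ∧ ¬ BClosure α (fun ξ _ => psi ξ) ρ}
termination_by α

/-- The set `B^Ω(α)`. -/
def BSet (α : Ordinal.{0}) : Set Ordinal.{0} := {x | BClosure α (fun ξ _ => psi ξ) x}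

/-- `ε_{Ω+1}`, the least `η > Ω` with `ω ^ η = η`. -/
noncomputable def epsOm : Ordinal.{0} := sInf {η | Om < η ∧ ω ^ η = η}

/-- The ordinals of the representation system: the set `B^Ω(ε_{Ω+1})`. All ordinals that occur in
the infinitary system and in operators are taken from this set. -/
def ON : Set Ordinal.{0} := BSet epsOm

/-- The ordinals `< Ω` of the representation system. -/
abbrev Idx : Type 1 := {α : Ordinal.{0} // α ∈ ON ∧ α < Om}

/-- Operators `H : P(ON) → P(ON)`. In `cnf`, the list `l` holds the exponents of a Cantor normal
form `ω ^ α₁ + ⋯ + ω ^ αₙ`, `α₁ ≥ ⋯ ≥ αₙ`. -/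
structure IsOperator (H : Set Ordinal.{0} → Set Ordinal.{0}) : Prop where
  maps : ∀ X, X ⊆ ON → H X ⊆ ON
  mono : ∀ X Y, X ⊆ Y → Y ⊆ ON → H X ⊆ H Y
  incl : ∀ X, X ⊆ ON → X ⊆ H X
  idem : ∀ X, X ⊆ ON → H (H X) = H X
  zero_mem : ∀ X, X ⊆ ON → (0 : Ordinal.{0}) ∈ H X
  big_mem : ∀ X, X ⊆ ON → Om ∈ H X
  cnf : ∀ X, X ⊆ ON → ∀ l : List Ordinal.{0}, l.Pairwise (fun a b => b ≤ a) →
    ((l.map (fun a => ω ^ a)).sum ∈ H X ↔ ∀ a ∈ l, a ∈ H X)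

/-- `H[Y](X) = H(X ∪ Y)`. -/
def ctl (H : Set Ordinal.{0} → Set Ordinal.{0}) (Y : Set Ordinal.{0}) :
    Set Ordinal.{0} → Set Ordinal.{0} :=
  fun X => H (X ∪ Y)

/-! ### Formulas

Formulas are built over a type `T` of names for sets: free variables for the finitary theory, terms
for the infinitary system. Bound variables are well-scoped de Bruijn indices: in the scope of a
quantifier the index `0` is the variable bound by it, and the others are raised by one. -/

/-- What may stand beside `∈` or as a bound of a quantifier, with `n` bound variables in scope: a
name, or one of the bound variables (there is none if `n = 0`). -/
inductive Tm (T : Type u) : ℕ → Type u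
  | con {n : ℕ} (t : T) : Tm T n
  | bv {n : ℕ} (i : Fin (n + 1)) : Tm T (n + 1)

/-- The bound variable `i`, for any number of variables in scope. -/
def Tm.var {T : Type u} : {n : ℕ} → Fin n → Tm T n
  | 0, i => i.elim0
  | _ + 1, i => .bv i

/-- `Fml T b n`: formulas with `n` bound variables in scope. Unbounded quantifiers are available
only for `b = true`, so `Fml T true n` is the type of all formulas and `Fml T false n` that of the
`Δ₀^𝓔`-formulas. `eall s t A` and `eex s t A` are the exponentiation bounded quantifiers
`(∀ x ∈ ˢt) A` and `(∃ x ∈ ˢt) A`. -/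
inductive Fml (T : Type u) (b : Bool) : ℕ → Type u
  | mem {n : ℕ} (s t : Tm T n) : Fml T b n
  | neg {n : ℕ} (A : Fml T b n) : Fml T b n
  | and {n : ℕ} (A B : Fml T b n) : Fml T b n
  | or {n : ℕ} (A B : Fml T b n) : Fml T b n
  | imp {n : ℕ} (A B : Fml T b n) : Fml T b n
  | ball {n : ℕ} (t : Tm T n) (A : Fml T b (n + 1)) : Fml T b n
  | bex {n : ℕ} (t : Tm T n) (A : Fml T b (n + 1)) : Fml T b n
  | eall {n : ℕ} (s t : Tm T n) (A : Fml T b (n + 1)) : Fml T b n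
  | eex {n : ℕ} (s t : Tm T n) (A : Fml T b (n + 1)) : Fml T b n
  | all {n : ℕ} (h : b = true) (A : Fml T b (n + 1)) : Fml T b n
  | ex {n : ℕ} (h : b = true) (A : Fml T b (n + 1)) : Fml T b n

noncomputable instance {T : Type u} {b : Bool} {n : ℕ} : DecidableEq (Fml T b n) :=
  Classical.decEq _

/-- Case distinction between names and bound variables. -/
def Tm.elim {T : Type u} {R : Type v} : {n : ℕ} → (T → R) → (Fin n → R) → Tm T n → R
  | _, f, _, .con t => f t
  | _, _, g, .bv i => g i

/-- Raises the bound variables by one. -/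
def Tm.sh {T : Type u} {n : ℕ} : Tm T n → Tm T (n + 1)
  | .con t => .con t
  | .bv i => .bv i.succ

/-- A substitution carried under a quantifier. -/
def Tm.up {T : Type u} {T' : Type v} {n m : ℕ} (e : Tm T n → Tm T' m) :
    Tm T (n + 1) → Tm T' (m + 1)
  | .con t => (e (.con t)).sh
  | .bv i => Fin.cases (.bv 0) (fun j => (e (.var j)).sh) i

/-- Simultaneous substitution for names and bound variables. -/
def Fml.sub {T : Type u} {T' : Type v} {b : Bool} :
    {n m : ℕ} → (Tm T n → Tm T' m) → Fml T b n → Fml T' b m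
  | _, _, e, .mem s t => .mem (e s) (e t)
  | _, _, e, .neg A => .neg (A.sub e)
  | _, _, e, .and A B => .and (A.sub e) (B.sub e)
  | _, _, e, .or A B => .or (A.sub e) (B.sub e)
  | _, _, e, .imp A B => .imp (A.sub e) (B.sub e)
  | _, _, e, .ball t A => .ball (e t) (A.sub (Tm.up e))
  | _, _, e, .bex t A => .bex (e t) (A.sub (Tm.up e))
  | _, _, e, .eall s t A => .eall (e s) (e t) (A.sub (Tm.up e))
  | _, _, e, .eex s t A => .eex (e s) (e t) (A.sub (Tm.up e))
  | _, _, e, .all h A => .all h (A.sub (Tm.up e))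
  | _, _, e, .ex h A => .ex h (A.sub (Tm.up e))

/-- Replaces every name `t` by `f t`: passes from `A(a₁, …, aₙ)` to `A(s₁, …, sₙ)`. -/
def Fml.map {T : Type u} {T' : Type v} {b : Bool} {n : ℕ} (f : T → T') (A : Fml T b n) :
    Fml T' b n :=
  A.sub (Tm.elim (fun t => .con (f t)) Tm.var)

/-- Replaces the bound variable `i` by the name `s i`. -/
def Fml.inst {T : Type u} {b : Bool} {n : ℕ} (A : Fml T b n) (s : Fin n → T) : Fml T b 0 :=
  A.sub (Tm.elim Tm.con fun i => .con (s i))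

/-- Renames bound variables. -/
def Fml.ren {T : Type u} {b : Bool} {n m : ℕ} (A : Fml T b n) (f : Fin n → Fin m) : Fml T b m :=
  A.sub (Tm.elim Tm.con fun i => .var (f i))

/-- A `Δ₀^𝓔`-formula as a formula. -/
def Fml.lift {T : Type u} : {n : ℕ} → Fml T false n → Fml T true n
  | _, .mem s t => .mem s t
  | _, .neg A => .neg A.lift
  | _, .and A B => .and A.lift B.lift
  | _, .or A B => .or A.lift B.lift
  | _, .imp A B => .imp A.lift B.lift
  | _, .ball t A => .ball t A.lift
  | _, .bex t A => .bex t A.lift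
  | _, .eall s t A => .eall s t A.lift
  | _, .eex s t A => .eex s t A.lift

/-- `A^z`: every unbounded quantifier is restricted to `z`. -/
def Fml.rel {T : Type u} {b : Bool} : {n : ℕ} → Tm T n → Fml T b n → Fml T b n
  | _, _, .mem s t => .mem s t
  | _, z, .neg A => .neg (A.rel z)
  | _, z, .and A B => .and (A.rel z) (B.rel z)
  | _, z, .or A B => .or (A.rel z) (B.rel z)
  | _, z, .imp A B => .imp (A.rel z) (B.rel z)
  | _, z, .ball t A => .ball t (A.rel z.sh)
  | _, z, .bex t A => .bex t (A.rel z.sh)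
  | _, z, .eall s t A => .eall s t (A.rel z.sh)
  | _, z, .eex s t A => .eex s t (A.rel z.sh)
  | _, z, .all _ A => .ball z (A.rel z.sh)
  | _, z, .ex _ A => .bex z (A.rel z.sh)

/-- The names that occur. -/
def Tm.names {T : Type u} {n : ℕ} : Tm T n → Set T
  | .con t => {t}
  | .bv _ => ∅

/-- The names that occur in a formula; for formulas of the finitary theory, its free variables. -/
def Fml.names {T : Type u} {b : Bool} : {n : ℕ} → Fml T b n → Set T
  | _, .mem s t => s.names ∪ t.names
  | _, .neg A => A.names
  | _, .and A B => A.names ∪ B.names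
  | _, .or A B => A.names ∪ B.names
  | _, .imp A B => A.names ∪ B.names
  | _, .ball t A => t.names ∪ A.names
  | _, .bex t A => t.names ∪ A.names
  | _, .eall s t A => s.names ∪ t.names ∪ A.names
  | _, .eex s t A => s.names ∪ t.names ∪ A.names
  | _, .all _ A => A.names
  | _, .ex _ A => A.names

/-- `s = t`, that is `(∀ x ∈ s) x ∈ t ∧ (∀ x ∈ t) x ∈ s`. -/
def Fml.eq {T : Type u} {b : Bool} {n : ℕ} (s t : Tm T n) : Fml T b n :=
  .and (.ball s (.mem (.bv 0) t.sh)) (.ball t (.mem (.bv 0) s.sh))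

/-- `w = {y, z}`. -/
def Fml.upair {T : Type u} {b : Bool} {n : ℕ} (w y z : Tm T n) : Fml T b n :=
  .and (.and (.mem y w) (.mem z w)) (.ball w (.or (.eq (.bv 0) y.sh) (.eq (.bv 0) z.sh)))

/-- `w = (y, z) = {{y, z}, {y}}`. -/
def Fml.opair {T : Type u} {b : Bool} {n : ℕ} (w y z : Tm T n) : Fml T b n :=
  .and
    (.and (.bex w (.upair (.bv 0) y.sh z.sh)) (.bex w (.upair (.bv 0) y.sh y.sh)))
    (.ball w (.or (.upair (.bv 0) y.sh z.sh) (.upair (.bv 0) y.sh y.sh)))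

/-- `(y, z) ∈ x`. -/
def Fml.pairMem {T : Type u} {b : Bool} {n : ℕ} (y z x : Tm T n) : Fml T b n :=
  .bex x (.opair (.bv 0) y.sh z.sh)

/-- `fun(x, s, t)`: `x` is a function from `s` to `t`. -/
def Fml.fn {T : Type u} {b : Bool} {n : ℕ} (x s t : Tm T n) : Fml T b n :=
  .and
    (.and
      (.ball x (.bex s.sh (.bex t.sh.sh (.opair (.bv 2) (.bv 1) (.bv 0)))))
      (.ball s (.bex t.sh (.pairMem (.bv 1) (.bv 0) x.sh.sh))))
    (.ball s (.ball t.sh (.ball t.sh.sh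
      (.imp
        (.and (.pairMem (.bv 2) (.bv 1) x.sh.sh.sh) (.pairMem (.bv 2) (.bv 0) x.sh.sh.sh))
        (.eq (.bv 1) (.bv 0))))))

/-! ### The sequent calculus for `IKP(𝓔)`

The free variables `a₀, a₁, …` are the natural numbers. A sequent has a finite set of formulas on
the left and at most one formula on the right. -/

/-- The eigenvariable condition: `c` does not occur in the sequent. -/
def Fresh (c : ℕ) (Γ : Finset (Fml ℕ true 0)) (Δ : Option (Fml ℕ true 0)) : Prop :=
  (∀ A ∈ Γ, c ∉ A.names) ∧ ∀ A ∈ Δ, c ∉ A.names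

/-- `IKP(𝓔) ⊢ Γ ⇒ Δ`. -/
inductive Prov : Finset (Fml ℕ true 0) → Option (Fml ℕ true 0) → Prop
  | logical (Γ : Finset (Fml ℕ true 0)) (A : Fml ℕ false 0) :
      Prov (insert A.lift Γ) (some A.lift)
  | extensionality (Γ : Finset (Fml ℕ true 0)) (a b : ℕ) (B : Fml ℕ false 1) :
      Prov Γ (some (.imp (.and (.eq (.con a) (.con b)) (B.lift.inst ![a])) (B.lift.inst ![b])))
  | pair (Γ : Finset (Fml ℕ true 0)) (a b : ℕ) :
      Prov Γ (some (.ex rfl (.and (.mem (.con a) (.bv 0)) (.mem (.con b) (.bv 0)))))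
  | union (Γ : Finset (Fml ℕ true 0)) (a : ℕ) :
      Prov Γ (some (.ex rfl (.ball (.con a) (.ball (.bv 0) (.mem (.bv 0) (.bv 2))))))
  | infinity (Γ : Finset (Fml ℕ true 0)) :
      Prov Γ (some (.ex rfl (.and
        (.bex (.bv 0) (.mem (.bv 0) (.bv 1)))
        (.ball (.bv 0) (.bex (.bv 1) (.mem (.bv 1) (.bv 0)))))))
  | separation (Γ : Finset (Fml ℕ true 0)) (a : ℕ) (A : Fml ℕ false 1) :
      Prov Γ (some (.ex rfl (.and
        (.ball (.bv 0) (.and (.mem (.bv 0) (.con a)) (A.lift.ren ![0])))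
        (.ball (.con a) (.imp (A.lift.ren ![0]) (.mem (.bv 0) (.bv 1)))))))
  -- in `B`, the index `0` stands for `x` and the index `1` for `y`
  | collection (Γ : Finset (Fml ℕ true 0)) (a : ℕ) (B : Fml ℕ false 2) :
      Prov Γ (some (.imp
        (.ball (.con a) (.ex rfl (B.lift.ren ![1, 0])))
        (.ex rfl (.ball (.con a) (.bex (.bv 1) (B.lift.ren ![1, 0]))))))
  | setInduction (Γ : Finset (Fml ℕ true 0)) (G : Fml ℕ true 1) :
      Prov Γ (some (.imp
        (.all rfl (.imp (.ball (.bv 0) (G.ren ![0])) G))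
        (.all rfl G)))
  | exponentiation (Γ : Finset (Fml ℕ true 0)) (a b : ℕ) :
      Prov Γ (some (.ex rfl (.eall (.con a) (.con b) (.mem (.bv 0) (.bv 1)))))
  | andL₁ {Γ : Finset (Fml ℕ true 0)} {Δ : Option (Fml ℕ true 0)} {A B : Fml ℕ true 0} :
      Prov (insert A Γ) Δ → Prov (insert (.and A B) Γ) Δ
  | andL₂ {Γ : Finset (Fml ℕ true 0)} {Δ : Option (Fml ℕ true 0)} {A B : Fml ℕ true 0} :
      Prov (insert B Γ) Δ → Prov (insert (.and A B) Γ) Δ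
  | andR {Γ : Finset (Fml ℕ true 0)} {A B : Fml ℕ true 0} :
      Prov Γ (some A) → Prov Γ (some B) → Prov Γ (some (.and A B))
  | orL {Γ : Finset (Fml ℕ true 0)} {Δ : Option (Fml ℕ true 0)} {A B : Fml ℕ true 0} :
      Prov (insert A Γ) Δ → Prov (insert B Γ) Δ → Prov (insert (.or A B) Γ) Δ
  | orR₁ {Γ : Finset (Fml ℕ true 0)} {A B : Fml ℕ true 0} :
      Prov Γ (some A) → Prov Γ (some (.or A B))
  | orR₂ {Γ : Finset (Fml ℕ true 0)} {A B : Fml ℕ true 0} :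
      Prov Γ (some B) → Prov Γ (some (.or A B))
  | negL {Γ : Finset (Fml ℕ true 0)} {A : Fml ℕ true 0} :
      Prov Γ (some A) → Prov (insert (.neg A) Γ) none
  | negR {Γ : Finset (Fml ℕ true 0)} {A : Fml ℕ true 0} :
      Prov (insert A Γ) none → Prov Γ (some (.neg A))
  | bot {Γ : Finset (Fml ℕ true 0)} {A : Fml ℕ true 0} :
      Prov Γ none → Prov Γ (some A)
  | impL {Γ : Finset (Fml ℕ true 0)} {Δ : Option (Fml ℕ true 0)} {A B : Fml ℕ true 0} :
      Prov (insert B Γ) Δ → Prov Γ (some A) → Prov (insert (.imp A B) Γ) Δ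
  | impR {Γ : Finset (Fml ℕ true 0)} {A B : Fml ℕ true 0} :
      Prov (insert A Γ) (some B) → Prov Γ (some (.imp A B))
  | bexL {Γ : Finset (Fml ℕ true 0)} {Δ : Option (Fml ℕ true 0)} {F : Fml ℕ true 1} {a b : ℕ} :
      Fresh a (insert (.bex (.con b) F) Γ) Δ →
      Prov (insert (.and (.mem (.con a) (.con b)) (F.inst ![a])) Γ) Δ →
      Prov (insert (.bex (.con b) F) Γ) Δ
  | bexR {Γ : Finset (Fml ℕ true 0)} {F : Fml ℕ true 1} {a b : ℕ} :
      Prov Γ (some (.and (.mem (.con a) (.con b)) (F.inst ![a]))) →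
      Prov Γ (some (.bex (.con b) F))
  | ballL {Γ : Finset (Fml ℕ true 0)} {Δ : Option (Fml ℕ true 0)} {F : Fml ℕ true 1} {a b : ℕ} :
      Prov (insert (.imp (.mem (.con a) (.con b)) (F.inst ![a])) Γ) Δ →
      Prov (insert (.ball (.con b) F) Γ) Δ
  | ballR {Γ : Finset (Fml ℕ true 0)} {F : Fml ℕ true 1} {a b : ℕ} :
      Fresh a Γ (some (.ball (.con b) F)) →
      Prov Γ (some (.imp (.mem (.con a) (.con b)) (F.inst ![a]))) →
      Prov Γ (some (.ball (.con b) F))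
  | exL {Γ : Finset (Fml ℕ true 0)} {Δ : Option (Fml ℕ true 0)} {F : Fml ℕ true 1} {a : ℕ} :
      Fresh a (insert (.ex rfl F) Γ) Δ →
      Prov (insert (F.inst ![a]) Γ) Δ → Prov (insert (.ex rfl F) Γ) Δ
  | exR {Γ : Finset (Fml ℕ true 0)} {F : Fml ℕ true 1} {a : ℕ} :
      Prov Γ (some (F.inst ![a])) → Prov Γ (some (.ex rfl F))
  | allL {Γ : Finset (Fml ℕ true 0)} {Δ : Option (Fml ℕ true 0)} {F : Fml ℕ true 1} {a : ℕ} :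
      Prov (insert (F.inst ![a]) Γ) Δ → Prov (insert (.all rfl F) Γ) Δ
  | allR {Γ : Finset (Fml ℕ true 0)} {F : Fml ℕ true 1} {a : ℕ} :
      Fresh a Γ (some (.all rfl F)) →
      Prov Γ (some (F.inst ![a])) → Prov Γ (some (.all rfl F))
  | eexL {Γ : Finset (Fml ℕ true 0)} {Δ : Option (Fml ℕ true 0)} {F : Fml ℕ true 1}
      {c a b : ℕ} :
      Fresh c (insert (.eex (.con a) (.con b) F) Γ) Δ →
      Prov (insert (.and (.fn (.con c) (.con a) (.con b)) (F.inst ![c])) Γ) Δ →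
      Prov (insert (.eex (.con a) (.con b) F) Γ) Δ
  | eexR {Γ : Finset (Fml ℕ true 0)} {F : Fml ℕ true 1} {c a b : ℕ} :
      Prov Γ (some (.and (.fn (.con c) (.con a) (.con b)) (F.inst ![c]))) →
      Prov Γ (some (.eex (.con a) (.con b) F))
  | eallL {Γ : Finset (Fml ℕ true 0)} {Δ : Option (Fml ℕ true 0)} {F : Fml ℕ true 1}
      {c a b : ℕ} :
      Prov (insert (.imp (.fn (.con c) (.con a) (.con b)) (F.inst ![c])) Γ) Δ →
      Prov (insert (.eall (.con a) (.con b) F) Γ) Δ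
  | eallR {Γ : Finset (Fml ℕ true 0)} {F : Fml ℕ true 1} {c a b : ℕ} :
      Fresh c Γ (some (.eall (.con a) (.con b) F)) →
      Prov Γ (some (.imp (.fn (.con c) (.con a) (.con b)) (F.inst ![c]))) →
      Prov Γ (some (.eall (.con a) (.con b) F))
  | cut {Γ : Finset (Fml ℕ true 0)} {Δ : Option (Fml ℕ true 0)} {A : Fml ℕ true 0} :
      Prov Γ (some A) → Prov (insert A Γ) Δ → Prov Γ Δ

/-! ### The infinitary system `IRS_Ω^𝔼` -/

/-- Terms: `𝔼_α`, the free variables `a_i^α`, and `[x ∈ t | F(x, s̄)]` for `F` in `Δ₀^𝓔`, where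
the index `0` of `F` stands for `x`. -/
inductive Term : Type 1
  | E (α : Idx) : Term
  | fvar (α : Idx) (i : ℕ) : Term
  | sep (t : Term) (F : Fml Term false 1) : Term

/-- The formula `s ∈ 𝔼_α`. -/
def inE (s : Term) (α : Idx) : Fml Term true 0 := .mem (.con s) (.con (.E α))

/-- The pair of classes `Σ^𝓔` (`p = true`) and `Π^𝓔` (`p = false`), simultaneously the smallest
ones with the stated closure properties. -/
inductive SigmaPi : Bool → {n : ℕ} → Fml Term true n → Prop
  | delta {p : Bool} {n : ℕ} (A : Fml Term false n) : SigmaPi p A.lift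
  | and {p : Bool} {n : ℕ} {A B : Fml Term true n} :
      SigmaPi p A → SigmaPi p B → SigmaPi p (.and A B)
  | or {p : Bool} {n : ℕ} {A B : Fml Term true n} :
      SigmaPi p A → SigmaPi p B → SigmaPi p (.or A B)
  | ball {p : Bool} {n : ℕ} {t : Tm Term n} {A : Fml Term true (n + 1)} :
      SigmaPi p A → SigmaPi p (.ball t A)
  | bex {p : Bool} {n : ℕ} {t : Tm Term n} {A : Fml Term true (n + 1)} :
      SigmaPi p A → SigmaPi p (.bex t A)
  | eall {p : Bool} {n : ℕ} {s t : Tm Term n} {A : Fml Term true (n + 1)} :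
      SigmaPi p A → SigmaPi p (.eall s t A)
  | eex {p : Bool} {n : ℕ} {s t : Tm Term n} {A : Fml Term true (n + 1)} :
      SigmaPi p A → SigmaPi p (.eex s t A)
  | ex {n : ℕ} {A : Fml Term true (n + 1)} : SigmaPi true A → SigmaPi true (.ex rfl A)
  | all {n : ℕ} {A : Fml Term true (n + 1)} : SigmaPi false A → SigmaPi false (.all rfl A)
  | neg {p : Bool} {n : ℕ} {C : Fml Term true n} : SigmaPi (!p) C → SigmaPi p (.neg C)
  | imp {p : Bool} {n : ℕ} {C A : Fml Term true n} :
      SigmaPi (!p) C → SigmaPi p A → SigmaPi p (.imp C A)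

/-- The ordinal attached to a name; bound variables count as `0`. -/
noncomputable def Tm.rank {T : Type u} {n : ℕ} (β : T → Ordinal.{0}) : Tm T n → Ordinal.{0}
  | .con t => β t
  | .bv _ => 0

/-- The `β̄`-rank `‖A(s̄)‖_β̄`. It depends on `A(ā)` and `β̄` only. -/
noncomputable def Fml.rank {T : Type u} {b : Bool} (β : T → Ordinal.{0}) :
    {n : ℕ} → Fml T b n → Ordinal.{0}
  | _, .mem s t => max (s.rank β) (t.rank β)
  | _, .neg A => A.rank β + 1
  | _, .and A B => max (A.rank β) (B.rank β) + 1
  | _, .or A B => max (A.rank β) (B.rank β) + 1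
  | _, .imp A B => max (A.rank β) (B.rank β) + 1
  | _, .ball t A => max (t.rank β) (A.rank β + 2)
  | _, .bex t A => max (t.rank β) (A.rank β + 2)
  | _, .eall s t A => max (max (s.rank β + ω) (t.rank β + ω)) (A.rank β + 2)
  | _, .eex s t A => max (max (s.rank β + ω) (t.rank β + ω)) (A.rank β + 2)
  | _, .all _ A => max Om (A.rank β + 2)
  | _, .ex _ A => max Om (A.rank β + 2)

/-- The axioms of the infinitary system. -/
inductive Ax : Finset (Fml Term true 0) → Option (Fml Term true 0) → Prop
  | e1 (Γ : Finset (Fml Term true 0)) (A : Fml Term false 0) :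
      Ax (insert A.lift Γ) (some A.lift)
  | e2 (Γ : Finset (Fml Term true 0)) (t : Term) : Ax Γ (some (.eq (.con t) (.con t)))
  | e3 (Γ : Finset (Fml Term true 0)) {n : ℕ} (B : Fml Term false n) (s t : Fin n → Term) :
      Ax (insert (B.lift.inst s) (Finset.univ.image (fun i => .eq (.con (s i)) (.con (t i))) ∪ Γ))
        (some (B.lift.inst t))
  | e4 (Γ : Finset (Fml Term true 0)) {α β : Idx} (h : β < α) : Ax Γ (some (inE (.E β) α))
  | e5 (Γ : Finset (Fml Term true 0)) {α β : Idx} (i : ℕ) (h : β < α) :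
      Ax Γ (some (inE (.fvar β i) α))
  | e6 (Γ : Finset (Fml Term true 0)) (α : Idx) (s t : Term) :
      Ax (insert (inE t α) (insert (.mem (.con s) (.con t)) Γ)) (some (inE s α))
  | e7 (Γ : Finset (Fml Term true 0)) {α α' : Idx} (h : α'.1 = α.1 + 1) (s t : Term) :
      Ax (insert (inE t α') (insert (.mem (.con s) (.con t)) Γ)) (some (inE s α))
  | e8 (Γ : Finset (Fml Term true 0)) (s t : Term) (F : Fml Term false 1) :
      Ax (insert (.mem (.con s) (.con t)) (insert (F.lift.inst ![s]) Γ))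
        (some (.mem (.con s) (.con (.sep t F))))
  | e9 (Γ : Finset (Fml Term true 0)) (s t : Term) (F : Fml Term false 1) :
      Ax (insert (.mem (.con s) (.con (.sep t F))) Γ)
        (some (.and (.mem (.con s) (.con t)) (F.lift.inst ![s])))
  | e10 (Γ : Finset (Fml Term true 0)) {α β γ : Idx} (h : max α.1 β.1 + 2 ≤ γ.1)
      (p s t : Term) :
      Ax (insert (inE s α) (insert (inE t β) (insert (.fn (.con p) (.con s) (.con t)) Γ)))
        (some (inE p γ))
  | e11 (Γ : Finset (Fml Term true 0)) {n : ℕ} (F : Fml (Fin n) false 1) (t : Term)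
      (p : Fin n → Term) {β γ : Idx} {α : Fin n → Idx} (hβ : β ≤ γ) (hα : ∀ i, α i ≤ γ) :
      Ax (insert (inE t β) (Finset.univ.image (fun i => inE (p i) (α i)) ∪ Γ))
        (some (inE (.sep t (F.map p)) γ))

/-- Operator controlled derivability: `Der ρ H α Γ Δ` is `H ⊢^α_ρ Γ ⇒ Δ`. In `eLim`, "`γ` is a
limit" means that `γ` is not a successor, so that `γ = 0` gives `s ∈ 𝔼_0, Γ ⇒ Δ` without
premises. -/
inductive Der (ρ : Ordinal.{0}) : (Set Ordinal.{0} → Set Ordinal.{0}) → Ordinal.{0} →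
    Finset (Fml Term true 0) → Option (Fml Term true 0) → Prop
  | ax {H α Γ Δ} (hα : α ∈ H ∅) : Ax Γ Δ → Der ρ H α Γ Δ
  | eLim {H α Γ Δ} (hα : α ∈ H ∅) {s : Term} {γ : Idx} (α' : Idx → Ordinal.{0})
      (hlim : Order.IsSuccPrelimit γ.1) (hγ : γ.1 ∈ H ∅) (hα' : ∀ δ < γ, α' δ < α) :
      (∀ δ : Idx, δ < γ → Der ρ (ctl H {δ.1}) (α' δ) (insert (inE s δ) Γ) Δ) →
      Der ρ H α (insert (inE s γ) Γ) Δ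
  | ballL {H α Γ Δ} (hα : α ∈ H ∅) {F : Fml Term true 1} {s t : Term} {α₀ α₁ α₂ : Ordinal.{0}}
      {β γ : Idx} (h₀ : α₀ < α) (h₁ : α₁ < α) (h₂ : α₂ < α) (hβ : β.1 ∈ H ∅) (hγ : γ.1 ∈ H ∅)
      (hγα : γ.1 < α) (hγβ : γ ≤ β) :
      Der ρ H α₀ (insert (.imp (.mem (.con s) (.con t)) (F.inst ![s])) Γ) Δ →
      Der ρ H α₁ Γ (some (inE t β)) →
      Der ρ H α₂ Γ (some (inE s γ)) →
      Der ρ H α (insert (.ball (.con t) F) Γ) Δ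
  | ballR {H α Γ} (hα : α ∈ H ∅) {F : Fml Term true 1} {t : Term} {α₀ α₁ : Ordinal.{0}}
      {β : Idx} (h₀ : α₀ < α) (h₁ : α₁ < α) (hβ : β.1 ∈ H ∅) (hβα : β.1 < α) :
      (∀ s : Term, Der ρ H α₀ Γ (some (.imp (.mem (.con s) (.con t)) (F.inst ![s])))) →
      Der ρ H α₁ Γ (some (inE t β)) →
      Der ρ H α Γ (some (.ball (.con t) F))
  | bexL {H α Γ Δ} (hα : α ∈ H ∅) {F : Fml Term true 1} {t : Term} {α₀ α₁ : Ordinal.{0}}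
      {β : Idx} (h₀ : α₀ < α) (h₁ : α₁ < α) (hβ : β.1 ∈ H ∅) (hβα : β.1 < α) :
      (∀ s : Term, Der ρ H α₀ (insert (.and (.mem (.con s) (.con t)) (F.inst ![s])) Γ) Δ) →
      Der ρ H α₁ Γ (some (inE t β)) →
      Der ρ H α (insert (.bex (.con t) F) Γ) Δ
  | bexR {H α Γ} (hα : α ∈ H ∅) {F : Fml Term true 1} {s t : Term} {α₀ α₁ α₂ : Ordinal.{0}}
      {β γ : Idx} (h₀ : α₀ < α) (h₁ : α₁ < α) (h₂ : α₂ < α) (hβ : β.1 ∈ H ∅) (hγ : γ.1 ∈ H ∅)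
      (hγα : γ.1 < α) (hγβ : γ ≤ β) :
      Der ρ H α₀ Γ (some (.and (.mem (.con s) (.con t)) (F.inst ![s]))) →
      Der ρ H α₁ Γ (some (inE t β)) →
      Der ρ H α₂ Γ (some (inE s γ)) →
      Der ρ H α Γ (some (.bex (.con t) F))
  | eallL {H α Γ Δ} (hα : α ∈ H ∅) {F : Fml Term true 1} {p s t : Term}
      {α₀ α₁ α₂ α₃ : Ordinal.{0}} {β γ δ : Idx} (h₀ : α₀ < α) (h₁ : α₁ < α) (h₂ : α₂ < α)
      (h₃ : α₃ < α) (hβ : β.1 ∈ H ∅) (hγ : γ.1 ∈ H ∅) (hδ : δ.1 ∈ H ∅)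
      (hδα : δ.1 < α) (hδm : δ.1 ≤ max β.1 γ.1 + 2) :
      Der ρ H α₀ (insert (.imp (.fn (.con p) (.con s) (.con t)) (F.inst ![p])) Γ) Δ →
      Der ρ H α₁ Γ (some (inE s β)) →
      Der ρ H α₂ Γ (some (inE t γ)) →
      Der ρ H α₃ Γ (some (inE p δ)) →
      Der ρ H α (insert (.eall (.con s) (.con t) F) Γ) Δ
  | eallR {H α Γ} (hα : α ∈ H ∅) {F : Fml Term true 1} {s t : Term} {α₀ α₁ α₂ : Ordinal.{0}}
      {β γ : Idx} (h₀ : α₀ < α) (h₁ : α₁ < α) (h₂ : α₂ < α) (hβ : β.1 ∈ H ∅) (hγ : γ.1 ∈ H ∅)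
      (hm : max β.1 γ.1 + 2 ≤ α) :
      (∀ p : Term, Der ρ H α₀ Γ
        (some (.imp (.fn (.con p) (.con s) (.con t)) (F.inst ![p])))) →
      Der ρ H α₁ Γ (some (inE s β)) →
      Der ρ H α₂ Γ (some (inE t γ)) →
      Der ρ H α Γ (some (.eall (.con s) (.con t) F))
  | eexL {H α Γ Δ} (hα : α ∈ H ∅) {F : Fml Term true 1} {s t : Term} {α₀ α₁ α₂ : Ordinal.{0}}
      {β γ : Idx} (h₀ : α₀ < α) (h₁ : α₁ < α) (h₂ : α₂ < α) (hβ : β.1 ∈ H ∅) (hγ : γ.1 ∈ H ∅)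
      (hm : max β.1 γ.1 + 2 ≤ α) :
      (∀ p : Term, Der ρ H α₀
        (insert (.and (.fn (.con p) (.con s) (.con t)) (F.inst ![p])) Γ) Δ) →
      Der ρ H α₁ Γ (some (inE s β)) →
      Der ρ H α₂ Γ (some (inE t γ)) →
      Der ρ H α (insert (.eex (.con s) (.con t) F) Γ) Δ
  | eexR {H α Γ} (hα : α ∈ H ∅) {F : Fml Term true 1} {p s t : Term}
      {α₀ α₁ α₂ α₃ : Ordinal.{0}} {β γ δ : Idx} (h₀ : α₀ < α) (h₁ : α₁ < α) (h₂ : α₂ < α)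
      (h₃ : α₃ < α) (hβ : β.1 ∈ H ∅) (hγ : γ.1 ∈ H ∅) (hδ : δ.1 ∈ H ∅)
      (hδα : δ.1 < α) (hδm : δ.1 ≤ max β.1 γ.1 + 2) :
      Der ρ H α₀ Γ (some (.and (.fn (.con p) (.con s) (.con t)) (F.inst ![p]))) →
      Der ρ H α₁ Γ (some (inE s β)) →
      Der ρ H α₂ Γ (some (inE t γ)) →
      Der ρ H α₃ Γ (some (inE p δ)) →
      Der ρ H α Γ (some (.eex (.con s) (.con t) F))
  | allL {H α Γ Δ} (hα : α ∈ H ∅) {F : Fml Term true 1} {s : Term} {α₀ α₁ : Ordinal.{0}}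
      {β : Idx} (h₀ : α₀ + 3 < α) (h₁ : α₁ + 3 < α) (hβα : β.1 < α) (hβ : β.1 ∈ H ∅) :
      Der ρ H α₀ (insert (F.inst ![s]) Γ) Δ →
      Der ρ H α₁ Γ (some (inE s β)) →
      Der ρ H α (insert (.all rfl F) Γ) Δ
  | allR {H α Γ} (hα : α ∈ H ∅) {F : Fml Term true 1} (α' : Idx → Ordinal.{0})
      (hα' : ∀ β : Idx, β.1 < α' β + 3 ∧ α' β + 3 < α) :
      (∀ (β : Idx) (s : Term),
        Der ρ (ctl H {β.1}) (α' β) (insert (inE s β) Γ) (some (F.inst ![s]))) →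
      Der ρ H α Γ (some (.all rfl F))
  | exL {H α Γ Δ} (hα : α ∈ H ∅) {F : Fml Term true 1} (α' : Idx → Ordinal.{0})
      (hα' : ∀ β : Idx, β.1 < α' β + 3 ∧ α' β + 3 < α) :
      (∀ (β : Idx) (s : Term),
        Der ρ (ctl H {β.1}) (α' β) (insert (F.inst ![s]) (insert (inE s β) Γ)) Δ) →
      Der ρ H α (insert (.ex rfl F) Γ) Δ
  | exR {H α Γ} (hα : α ∈ H ∅) {F : Fml Term true 1} {s : Term} {α₀ α₁ : Ordinal.{0}}
      {β : Idx} (h₀ : α₀ + 3 < α) (h₁ : α₁ + 3 < α) (hβα : β.1 < α) (hβ : β.1 ∈ H ∅) :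
      Der ρ H α₀ Γ (some (F.inst ![s])) →
      Der ρ H α₁ Γ (some (inE s β)) →
      Der ρ H α Γ (some (.ex rfl F))
  | sigmaRef {H α Γ} (hα : α ∈ H ∅) {A : Fml Term true 0} {α₀ : Ordinal.{0}}
      (hA : SigmaPi true A) (h₀ : α₀ + 1 < α) (hΩ : Om < α) :
      Der ρ H α₀ Γ (some A) →
      Der ρ H α Γ (some (.ex rfl ((A.ren Fin.succ).rel (.bv 0))))
  | cut {H α Γ Δ} (hα : α ∈ H ∅) {n : ℕ} (A : Fml (Fin n) true 0) (s : Fin n → Term)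
      (β : Fin n → Idx) {α₀ α₁ α₂ : Ordinal.{0}} (h₀ : α₀ < α) (h₁ : α₁ < α) (h₂ : α₂ < α)
      (hρ : A.rank (fun i => (β i).1) < ρ) (hβ : ∀ i, (β i).1 ∈ H ∅) :
      Der ρ H α₀ (insert (A.map s) Γ) Δ →
      Der ρ H α₁ Γ (some (A.map s)) →
      (∀ i, Der ρ H α₂ Γ (some (inE (s i) (β i)))) →
      Der ρ H α Γ Δ
  | andL₁ {H α Γ Δ} (hα : α ∈ H ∅) {A B : Fml Term true 0} {α₀ : Ordinal.{0}} (h₀ : α₀ < α) :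
      Der ρ H α₀ (insert A Γ) Δ → Der ρ H α (insert (.and A B) Γ) Δ
  | andL₂ {H α Γ Δ} (hα : α ∈ H ∅) {A B : Fml Term true 0} {α₀ : Ordinal.{0}} (h₀ : α₀ < α) :
      Der ρ H α₀ (insert B Γ) Δ → Der ρ H α (insert (.and A B) Γ) Δ
  | andR {H α Γ} (hα : α ∈ H ∅) {A B : Fml Term true 0} {α₀ : Ordinal.{0}} (h₀ : α₀ < α) :
      Der ρ H α₀ Γ (some A) → Der ρ H α₀ Γ (some B) → Der ρ H α Γ (some (.and A B))
  | orL {H α Γ Δ} (hα : α ∈ H ∅) {A B : Fml Term true 0} {α₀ : Ordinal.{0}} (h₀ : α₀ < α) :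
      Der ρ H α₀ (insert A Γ) Δ → Der ρ H α₀ (insert B Γ) Δ →
      Der ρ H α (insert (.or A B) Γ) Δ
  | orR₁ {H α Γ} (hα : α ∈ H ∅) {A B : Fml Term true 0} {α₀ : Ordinal.{0}} (h₀ : α₀ < α) :
      Der ρ H α₀ Γ (some A) → Der ρ H α Γ (some (.or A B))
  | orR₂ {H α Γ} (hα : α ∈ H ∅) {A B : Fml Term true 0} {α₀ : Ordinal.{0}} (h₀ : α₀ < α) :
      Der ρ H α₀ Γ (some B) → Der ρ H α Γ (some (.or A B))
  | negL {H α Γ} (hα : α ∈ H ∅) {A : Fml Term true 0} {α₀ : Ordinal.{0}} (h₀ : α₀ < α) :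
      Der ρ H α₀ Γ (some A) → Der ρ H α (insert (.neg A) Γ) none
  | negR {H α Γ} (hα : α ∈ H ∅) {A : Fml Term true 0} {α₀ : Ordinal.{0}} (h₀ : α₀ < α) :
      Der ρ H α₀ (insert A Γ) none → Der ρ H α Γ (some (.neg A))
  | bot {H α Γ} (hα : α ∈ H ∅) {A : Fml Term true 0} {α₀ : Ordinal.{0}} (h₀ : α₀ < α) :
      Der ρ H α₀ Γ none → Der ρ H α Γ (some A)
  | impL {H α Γ Δ} (hα : α ∈ H ∅) {A B : Fml Term true 0} {α₀ : Ordinal.{0}} (h₀ : α₀ < α) :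
      Der ρ H α₀ (insert B Γ) Δ → Der ρ H α₀ Γ (some A) → Der ρ H α (insert (.imp A B) Γ) Δ
  | impR {H α Γ} (hα : α ∈ H ∅) {A B : Fml Term true 0} {α₀ : Ordinal.{0}} (h₀ : α₀ < α) :
      Der ρ H α₀ (insert A Γ) (some B) → Der ρ H α Γ (some (.imp A B))

end IKPE

-- The proof is an induction on the finite derivation, for a statement (`Good`) that fixes one
-- natural number `k` and then quantifies over all operators, assignments of terms to variables,
-- levels and contexts. The assignment is total: every variable, occurring or not, gets a term `s v`
-- and a level `β v`, and the context contains `s v ∈ 𝔼_{β v}`. Hence a premise with variables that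
-- are missing from the conclusion, as after a cut or an existential introduction, needs no special
-- treatment. For an eigenvariable the assignment is updated at that variable, and freshness keeps
-- all other formulas unchanged.
--
-- Heights are harmless because `Ω = ω ^ Ω`. The bound `Ω·ω^k = ω^(Ω+k)` is additively principal, so
-- `Ω·ω^k + n < Ω·ω^(k+1)` for finite `n`, and raising `k` by one pays for any finite number of
-- further inferences. The simulation can therefore be carried out at heights `X + n` over a fixed
-- base `X ≥ Ω` (`Base`, `DerN`), where every level below `Ω` automatically satisfies the side
-- conditions on heights. Cut ranks are controlled in the same way: under levels below `Ω` a formula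
-- has rank below `Ω + 2·size` (`Fml.rank_lt`).
--
-- The real content is in the levels. The quantifier rules ask for levels of the bounds and the
-- witnesses, while their premises for all terms come without a level for the new term. That level
-- is computed from the bound by an axiom and cut in: elements of a set in `𝔼_β` are in `𝔼_β`, and
-- functions between sets of levels `β` and `γ` have level `max β γ + 2`. With this, `A ⇒ A` is
-- derivable for every formula whose parameters have levels (`Base.identity`).
--
-- Among the axioms, Pair, Union, Infinity and Exponentiation are witnessed by a suitable `𝔼_γ`, and
-- Separation by a separation term. Collection is `Σ^𝓔`-reflection applied to the identity sequent
-- of its hypothesis. Set Induction is the one axiom with genuinely transfinite derivations: from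
-- progressiveness of `G`, an induction on `β` derives `t ∈ 𝔼_β ⇒ G(t)` at height `Ω + ω^(1+β)`
-- (`der_of_prog`), using `𝔼`-Lim at limits and the drop of level from a set to its elements at
-- successors.

universe w

namespace IKPE

open Ordinal

/-! ### Ordinal arithmetic and closure properties of operators -/

/-- The list of exponents of a Cantor normal form. -/
abbrev IsCNF (l : List Ordinal.{0}) : Prop := l.Pairwise (fun a b => b ≤ a)

/-- The ordinal with the given list of exponents. -/
noncomputable abbrev cnfSum (l : List Ordinal.{0}) : Ordinal.{0} := (l.map (fun a => ω ^ a)).sum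

/-- If the leading exponent is at most `c`, the list stays ordered; if it is larger, its power
absorbs `ω ^ c`. Either way no new exponent besides `c` appears, which is why the clause `cnf` of
operators implies closure under `+`. -/
theorem opow_add_cnfSum (c : Ordinal.{0}) {l : List Ordinal.{0}} (hl : IsCNF l) :
    IsCNF (c :: l) ∨ ω ^ c + cnfSum l = cnfSum l := by
  cases l with
  | nil => simp
  | cons h l =>
    rcases le_or_gt h c with hc | hc
    · left
      refine List.pairwise_cons.2 ⟨fun a ha => ?_, hl⟩
      rcases List.mem_cons.1 ha with rfl | ha
      · exact hc
      · exact ((List.pairwise_cons.1 hl).1 a ha).trans hc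
    · right
      simp only [cnfSum, List.map_cons, List.sum_cons]
      rw [← add_assoc, add_omega0_opow ((opow_lt_opow_iff_right one_lt_omega0).2 hc)]

theorem exists_cnf_opow_add (c : Ordinal.{0}) {x : Ordinal.{0}} (hx : ∃ l, IsCNF l ∧ cnfSum l = x) :
    ∃ l, IsCNF l ∧ cnfSum l = ω ^ c + x := by
  obtain ⟨l, hl, rfl⟩ := hx
  rcases opow_add_cnfSum c hl with h | h
  · exact ⟨c :: l, h, by simp [cnfSum]⟩
  · exact ⟨l, hl, h.symm⟩

theorem exists_cnf (x : Ordinal.{0}) : ∃ l, IsCNF l ∧ cnfSum l = x := by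
  induction x using Ordinal.CNF.rec (b := ω) with
  | H0 => exact ⟨[], by simp, by simp [cnfSum]⟩
  | H o _ ih =>
    obtain ⟨n, hn⟩ := lt_omega0.1 (div_opow_log_lt o one_lt_omega0)
    rw [← Ordinal.div_add_mod o (ω ^ log ω o), hn]
    generalize log ω o = c at ih
    clear hn
    induction n with
    | zero => simpa using ih
    | succ n hn =>
      -- The factor is turned into `1 + n`, so that the extra copy of `ω ^ c` stands on the left,
      -- where a power can be added to a normal form.
      rw [Nat.cast_add, Nat.cast_one, ← Nat.cast_one, ← Nat.cast_add, Nat.add_comm, Nat.cast_add,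
        Nat.cast_one, mul_one_add, add_assoc]
      exact exists_cnf_opow_add c hn

theorem Om_principal : IsPrincipal (· + ·) Om := isPrincipal_add_omega 1

theorem omega0_lt_Om : ω < Om := by
  have := (omega_strictMono (show (0 : Ordinal.{0}) < 1 from zero_lt_one))
  simpa only [Om, omega_zero] using this

theorem Om_pos : 0 < Om := omega0_pos.trans omega0_lt_Om

theorem add_lt_Om {a b : Ordinal.{0}} (ha : a < Om) (hb : b < Om) : a + b < Om :=
  Om_principal ha hb

theorem natCast_lt_Om (n : ℕ) : (n : Ordinal.{0}) < Om := (natCast_lt_omega0 n).trans omega0_lt_Om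

theorem opow_lt_Om {a : Ordinal.{0}} (ha : a < Om) : ω ^ a < Om :=
  isPrincipal_opow_omega 1 omega0_lt_Om ha

theorem Om_isSuccLimit : Order.IsSuccLimit Om := by
  rw [Om, ← Cardinal.ord_aleph]
  exact Cardinal.isSuccLimit_ord (Cardinal.aleph0_le_aleph 1)

theorem opow_Om : ω ^ Om = Om := by
  refine le_antisymm ?_ (right_le_opow _ one_lt_omega0)
  refine (opow_le_of_isSuccLimit omega0_ne_zero Om_isSuccLimit).2 fun b hb => (opow_lt_Om hb).le

/-- `Ω` is an epsilon number. As a power of `ω`, the bound of the theorem is additively principal,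
and it belongs to every operator. -/
theorem Om_mul_opow (k : ℕ) : Om * ω ^ (k : Ordinal.{0}) = ω ^ (Om + k) := by
  rw [opow_add, opow_Om]

/-- This gap accommodates the finitely many inferences of a successor step in the derivation of Set
Induction. -/
theorem opow_add_natCast_lt (a : Ordinal.{0}) (n : ℕ) : ω ^ (1 + a) + n < ω ^ (1 + (a + 1)) := by
  rw [← add_assoc]
  refine isPrincipal_add_omega0_opow _ ?_ ?_
  · exact (opow_lt_opow_iff_right one_lt_omega0).2 (lt_add_one _)
  · refine (natCast_lt_omega0 n).trans_le ?_
    conv_lhs => rw [← opow_one ω]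
    exact opow_le_opow_right omega0_pos (le_add_of_nonneg_of_le zero_le (by simp))

theorem lt_Om_add_opow {b : Ordinal.{0}} (hb : b < Om) : b < Om + ω ^ (1 + b) :=
  hb.trans_le le_self_add

theorem Om_add_opow_lt {b : Ordinal.{0}} (hb : b < Om) (n : ℕ) :
    Om + ω ^ (1 + b) + n < Om + Om := by
  rw [add_assoc]
  gcongr
  exact add_lt_Om (opow_lt_Om (add_lt_Om (by simpa using natCast_lt_Om 1) hb)) (natCast_lt_Om n)

/-- Additive principality makes one unit of `k` worth any finite number of inferences. -/
theorem Om_mul_opow_add_lt (k n : ℕ) :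
    Om * ω ^ (k : Ordinal.{0}) + n < Om * ω ^ ((k + 1 : ℕ) : Ordinal.{0}) := by
  rw [Om_mul_opow, Om_mul_opow]
  refine isPrincipal_add_omega0_opow _ ?_ ?_
  · exact (opow_lt_opow_iff_right one_lt_omega0).2 (by simp)
  · refine (natCast_lt_Om n).trans_le ?_
    conv_lhs => rw [← opow_Om]
    exact opow_le_opow_right omega0_pos le_self_add

theorem Om_add_Om_add_lt (n : ℕ) :
    Om + Om + n < Om * ω ^ ((1 : ℕ) : Ordinal.{0}) := by
  have h : Om < Om * ω ^ ((1 : ℕ) : Ordinal.{0}) := by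
    simpa using Om_mul_opow_add_lt 0 0
  rw [Om_mul_opow] at h ⊢
  refine isPrincipal_add_omega0_opow _ (isPrincipal_add_omega0_opow _ h h) ?_
  exact (natCast_lt_Om n).trans h

theorem Om_le_Om_mul_opow (k : ℕ) : Om ≤ Om * ω ^ (k : Ordinal.{0}) := by
  rw [Om_mul_opow]
  conv_lhs => rw [← opow_Om]
  exact opow_le_opow_right omega0_pos le_self_add

namespace IsOperator

variable {H : Set Ordinal.{0} → Set Ordinal.{0}}

theorem cnfSum_mem (hH : IsOperator H) {l : List Ordinal.{0}} (hl : IsCNF l) :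
    cnfSum l ∈ H ∅ ↔ ∀ a ∈ l, a ∈ H ∅ :=
  hH.cnf ∅ (Set.empty_subset _) l hl

theorem zero_mem' (hH : IsOperator H) : (0 : Ordinal.{0}) ∈ H ∅ :=
  hH.zero_mem ∅ (Set.empty_subset _)

theorem Om_mem (hH : IsOperator H) : Om ∈ H ∅ := hH.big_mem ∅ (Set.empty_subset _)

theorem opow_mem (hH : IsOperator H) {a : Ordinal.{0}} (ha : a ∈ H ∅) : ω ^ a ∈ H ∅ := by
  simpa [cnfSum, ha] using hH.cnfSum_mem (List.pairwise_singleton (fun a b => b ≤ a) a)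

theorem one_mem (hH : IsOperator H) : (1 : Ordinal.{0}) ∈ H ∅ := by
  simpa using hH.opow_mem hH.zero_mem'

theorem omega0_mem (hH : IsOperator H) : ω ∈ H ∅ := by
  simpa using hH.opow_mem hH.one_mem

theorem opow_add_mem (hH : IsOperator H) {c x : Ordinal.{0}} (hc : c ∈ H ∅) (hx : x ∈ H ∅) :
    ω ^ c + x ∈ H ∅ := by
  obtain ⟨l, hl, rfl⟩ := exists_cnf x
  rcases opow_add_cnfSum c hl with h | h
  · have := (hH.cnfSum_mem h).2 (by
      intro a ha
      rcases List.mem_cons.1 ha with rfl | ha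
      exacts [hc, (hH.cnfSum_mem hl).1 hx a ha])
    simpa [cnfSum] using this
  · rwa [h]

theorem add_mem (hH : IsOperator H) {a x : Ordinal.{0}} (ha : a ∈ H ∅) (hx : x ∈ H ∅) :
    a + x ∈ H ∅ := by
  obtain ⟨l, hl, rfl⟩ := exists_cnf a
  replace ha := (hH.cnfSum_mem hl).1 ha
  -- The order of the exponents is dropped. The powers are put in front of `x` one at a time, which
  -- needs only that each exponent is controlled.
  clear hl
  induction l with
  | nil => simpa [cnfSum] using hx
  | cons c l ih =>
    have := hH.opow_add_mem (ha c (by simp)) (ih fun a h => ha a (by simp [h]))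
    simpa [cnfSum, add_assoc] using this

theorem natCast_mem (hH : IsOperator H) (n : ℕ) : (n : Ordinal.{0}) ∈ H ∅ := by
  induction n with
  | zero => simpa using hH.zero_mem'
  | succ n ih => simpa using hH.add_mem ih hH.one_mem

/-- Adding one appends the exponent `0` to the normal form, so the exponents of `a` are among those
of `a + 1`. Set Induction needs this to control the predecessor of a controlled level. -/
theorem mem_of_add_one_mem (hH : IsOperator H) {a : Ordinal.{0}} (ha : a + 1 ∈ H ∅) : a ∈ H ∅ := by
  obtain ⟨l, hl, rfl⟩ := exists_cnf a
  have h : IsCNF (l ++ [0]) := by simp [IsCNF, List.pairwise_append, hl]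
  rw [hH.cnfSum_mem hl]
  intro b hb
  exact (hH.cnfSum_mem h).1 (by simpa [cnfSum] using ha) b (by simp [hb])

theorem Om_mul_opow_mem (hH : IsOperator H) (k : ℕ) : Om * ω ^ (k : Ordinal.{0}) ∈ H ∅ := by
  rw [Om_mul_opow]
  exact hH.opow_mem (hH.add_mem hH.Om_mem (hH.natCast_mem k))

/-- Only idempotence is not a mere instance of the same property of `H`: since `Y` already lies in
`H (X ∪ Y)`, adjoining it again changes nothing. -/
theorem ctl (hH : IsOperator H) {Y : Set Ordinal.{0}} (hY : Y ⊆ ON) : IsOperator (ctl H Y) where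
  maps X hX := hH.maps _ (Set.union_subset hX hY)
  mono X Z hXZ hZ := hH.mono _ _ (Set.union_subset_union_left _ hXZ) (Set.union_subset hZ hY)
  incl X hX := Set.subset_union_left.trans (hH.incl _ (Set.union_subset hX hY))
  idem X hX := by
    have h := Set.union_subset hX hY
    have hYH : Y ⊆ H (X ∪ Y) := Set.subset_union_right.trans (hH.incl _ h)
    simp only [IKPE.ctl]
    rw [Set.union_eq_self_of_subset_right hYH, hH.idem _ h]
  zero_mem X hX := hH.zero_mem _ (Set.union_subset hX hY)
  big_mem X hX := hH.big_mem _ (Set.union_subset hX hY)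
  cnf X hX := hH.cnf _ (Set.union_subset hX hY)

theorem mem_ctl (hH : IsOperator H) {Y : Set Ordinal.{0}} (hY : Y ⊆ ON) : Y ⊆ IKPE.ctl H Y ∅ :=
  Set.subset_union_right.trans (hH.incl _ (Set.union_subset (Set.empty_subset _) hY))

theorem subset_ctl (hH : IsOperator H) {Y : Set Ordinal.{0}} (hY : Y ⊆ ON) :
    ∀ X ⊆ ON, H X ⊆ IKPE.ctl H Y X :=
  fun _ hX => hH.mono _ _ Set.subset_union_left (Set.union_subset hX hY)

/-- An ordinal below `Ω` controlled by an operator. -/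
def idx (hH : IsOperator H) (a : Ordinal.{0}) (ha : a ∈ H ∅) (h : a < Om) : Idx :=
  ⟨a, hH.maps ∅ (Set.empty_subset _) ha, h⟩

end IsOperator

theorem Idx.singleton_subset (β : Idx) : {β.1} ⊆ ON := Set.singleton_subset_iff.2 β.2.1

/-! ### Substitution -/

section Substitution

variable {T : Type u} {T' : Type v} {T'' : Type w} {b : Bool} {n m k : ℕ}

@[simp] theorem Tm.elim_con {R : Type v} (f : T → R) (g : Fin n → R) (t : T) :
    Tm.elim f g (.con t) = f t := by
  cases n <;> rfl

@[simp] theorem Tm.elim_bv {R : Type v} (f : T → R) (g : Fin (n + 1) → R) (i : Fin (n + 1)) :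
    Tm.elim f g (.bv i) = g i := rfl

@[simp] theorem Tm.elim_var {R : Type v} (f : T → R) (g : Fin n → R) (i : Fin n) :
    Tm.elim f g (.var i) = g i := by
  cases n with
  | zero => exact i.elim0
  | succ n => rfl

@[simp] theorem Tm.var_succ (i : Fin (n + 1)) : (Tm.var i : Tm T (n + 1)) = .bv i := rfl

@[simp] theorem Tm.sh_con (t : T) : (Tm.con t : Tm T n).sh = .con t := by cases n <;> rfl

@[simp] theorem Tm.sh_bv (i : Fin (n + 1)) : (Tm.bv i : Tm T (n + 1)).sh = .bv i.succ := rfl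

@[simp] theorem Tm.sh_var (i : Fin n) : (Tm.var i : Tm T n).sh = .bv i.succ := by
  cases n with
  | zero => exact i.elim0
  | succ n => rfl

@[simp] theorem Tm.up_con (e : Tm T n → Tm T' m) (t : T) :
    Tm.up e (.con t) = (e (.con t)).sh := rfl

@[simp] theorem Tm.up_bv_zero (e : Tm T n → Tm T' m) : Tm.up e (.bv 0) = .bv 0 := rfl

@[simp] theorem Tm.up_bv_succ (e : Tm T n → Tm T' m) (i : Fin n) :
    Tm.up e (.bv i.succ) = (e (.var i)).sh := rfl

@[simp] theorem Tm.up_sh (e : Tm T n → Tm T' m) (x : Tm T n) : Tm.up e x.sh = (e x).sh := by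
  cases x with
  | con t => simp
  | bv i => rfl

theorem Tm.up_comp (e : Tm T n → Tm T' m) (e' : Tm T' m → Tm T'' k) :
    Tm.up e' ∘ Tm.up e = Tm.up (e' ∘ e) := by
  funext x
  cases x with
  | con t => simp
  | bv i => cases i using Fin.cases <;> simp

theorem Tm.up_id : Tm.up (id : Tm T n → Tm T n) = id := by
  funext x
  cases x with
  | con t => simp
  | bv i => cases i using Fin.cases <;> simp

/-- `map`, `inst` and `ren` are all instances of `sub`. Each commutation between them thus reduces
to comparing two substitutions on names and on bound variables. -/
theorem Fml.sub_sub (A : Fml T b n) {m k : ℕ} (e : Tm T n → Tm T' m) (e' : Tm T' m → Tm T'' k) :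
    (A.sub e).sub e' = A.sub (e' ∘ e) := by
  induction A generalizing m k with
  | mem s t => rfl
  | neg A ih => simp only [Fml.sub, ih]
  | and A B ihA ihB => simp only [Fml.sub, ihA, ihB]
  | or A B ihA ihB => simp only [Fml.sub, ihA, ihB]
  | imp A B ihA ihB => simp only [Fml.sub, ihA, ihB]
  | ball t A ih => simp only [Fml.sub, ih, Tm.up_comp, Function.comp_apply]
  | bex t A ih => simp only [Fml.sub, ih, Tm.up_comp, Function.comp_apply]
  | eall s t A ih => simp only [Fml.sub, ih, Tm.up_comp, Function.comp_apply]
  | eex s t A ih => simp only [Fml.sub, ih, Tm.up_comp, Function.comp_apply]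
  | all h A ih => simp only [Fml.sub, ih, Tm.up_comp]
  | ex h A ih => simp only [Fml.sub, ih, Tm.up_comp]

theorem Fml.sub_id (A : Fml T b n) : A.sub id = A := by
  induction A with
  | mem s t => rfl
  | neg A ih => simp only [Fml.sub, ih]
  | and A B ihA ihB => simp only [Fml.sub, ihA, ihB]
  | or A B ihA ihB => simp only [Fml.sub, ihA, ihB]
  | imp A B ihA ihB => simp only [Fml.sub, ihA, ihB]
  | ball t A ih => simp only [Fml.sub, Tm.up_id, ih, id]
  | bex t A ih => simp only [Fml.sub, Tm.up_id, ih, id]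
  | eall s t A ih => simp only [Fml.sub, Tm.up_id, ih, id]
  | eex s t A ih => simp only [Fml.sub, Tm.up_id, ih, id]
  | all h A ih => simp only [Fml.sub, Tm.up_id, ih]
  | ex h A ih => simp only [Fml.sub, Tm.up_id, ih]

/-- Two substitutions agree on a set of names and on the bound variables. -/
def Agree (N : Set T) (e e' : Tm T n → Tm T' m) : Prop :=
  (∀ t ∈ N, e (.con t) = e' (.con t)) ∧ ∀ i, e (.var i) = e' (.var i)

theorem Agree.apply {N : Set T} {e e' : Tm T n → Tm T' m} (h : Agree N e e') {x : Tm T n}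
    (hx : x.names ⊆ N) : e x = e' x := by
  cases x with
  | con t => exact h.1 t (hx rfl)
  | bv i => exact h.2 i

theorem Agree.up {N : Set T} {e e' : Tm T n → Tm T' m} (h : Agree N e e') :
    Agree N (Tm.up e) (Tm.up e') := by
  refine ⟨fun t ht => by simp [h.1 t ht], fun i => ?_⟩
  cases i using Fin.cases with
  | zero => simp
  | succ i => simp [h.2 i]

/-- This is what makes the eigenvariable condition effective: reassigning a variable that does not
occur leaves the instance unchanged. -/
theorem Fml.sub_congr (A : Fml T b n) {m : ℕ} {N : Set T} {e e' : Tm T n → Tm T' m}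
    (hN : A.names ⊆ N) (h : Agree N e e') : A.sub e = A.sub e' := by
  induction A generalizing m with
  | mem s t =>
    simp only [Fml.names, Set.union_subset_iff] at hN
    simp only [Fml.sub, h.apply hN.1, h.apply hN.2]
  | neg A ih => simp only [Fml.sub, ih hN h]
  | and A B ihA ihB =>
    simp only [Fml.names, Set.union_subset_iff] at hN
    simp only [Fml.sub, ihA hN.1 h, ihB hN.2 h]
  | or A B ihA ihB =>
    simp only [Fml.names, Set.union_subset_iff] at hN
    simp only [Fml.sub, ihA hN.1 h, ihB hN.2 h]
  | imp A B ihA ihB =>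
    simp only [Fml.names, Set.union_subset_iff] at hN
    simp only [Fml.sub, ihA hN.1 h, ihB hN.2 h]
  | ball t A ih =>
    simp only [Fml.names, Set.union_subset_iff] at hN
    simp only [Fml.sub, h.apply hN.1, ih hN.2 h.up]
  | bex t A ih =>
    simp only [Fml.names, Set.union_subset_iff] at hN
    simp only [Fml.sub, h.apply hN.1, ih hN.2 h.up]
  | eall s t A ih =>
    simp only [Fml.names, Set.union_subset_iff] at hN
    simp only [Fml.sub, h.apply hN.1.1, h.apply hN.1.2, ih hN.2 h.up]
  | eex s t A ih =>
    simp only [Fml.names, Set.union_subset_iff] at hN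
    simp only [Fml.sub, h.apply hN.1.1, h.apply hN.1.2, ih hN.2 h.up]
  | all _ A ih => simp only [Fml.sub, ih hN h.up]
  | ex _ A ih => simp only [Fml.sub, ih hN h.up]

/-- All names of the substituted terms lie in `N`. -/
def Into (N : Set T') (M : Set T) (e : Tm T n → Tm T' m) : Prop :=
  (∀ t ∈ M, (e (.con t)).names ⊆ N) ∧ ∀ i, (e (.var i)).names ⊆ N

@[simp] theorem Tm.names_sh (x : Tm T n) : x.sh.names = x.names := by cases x <;> rfl

theorem Into.apply {N : Set T'} {M : Set T} {e : Tm T n → Tm T' m} (h : Into N M e) {x : Tm T n}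
    (hx : x.names ⊆ M) : (e x).names ⊆ N := by
  cases x with
  | con t => exact h.1 t (hx rfl)
  | bv i => exact h.2 i

theorem Into.up {N : Set T'} {M : Set T} {e : Tm T n → Tm T' m} (h : Into N M e) :
    Into N M (Tm.up e) := by
  refine ⟨fun t ht => by simpa using h.1 t ht, fun i => ?_⟩
  cases i using Fin.cases with
  | zero => simp [Tm.names]
  | succ i => simpa using h.2 i

theorem Fml.names_sub (A : Fml T b n) {m : ℕ} {N : Set T'} {M : Set T} {e : Tm T n → Tm T' m}
    (hM : A.names ⊆ M) (h : Into N M e) : (A.sub e).names ⊆ N := by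
  induction A generalizing m with
  | mem s t =>
    simp only [Fml.names, Set.union_subset_iff, Fml.sub] at hM ⊢
    exact ⟨h.apply hM.1, h.apply hM.2⟩
  | neg A ih => exact ih hM h
  | and A B ihA ihB =>
    simp only [Fml.names, Set.union_subset_iff, Fml.sub] at hM ⊢
    exact ⟨ihA hM.1 h, ihB hM.2 h⟩
  | or A B ihA ihB =>
    simp only [Fml.names, Set.union_subset_iff, Fml.sub] at hM ⊢
    exact ⟨ihA hM.1 h, ihB hM.2 h⟩
  | imp A B ihA ihB =>
    simp only [Fml.names, Set.union_subset_iff, Fml.sub] at hM ⊢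
    exact ⟨ihA hM.1 h, ihB hM.2 h⟩
  | ball t A ih =>
    simp only [Fml.names, Set.union_subset_iff, Fml.sub] at hM ⊢
    exact ⟨h.apply hM.1, ih hM.2 h.up⟩
  | bex t A ih =>
    simp only [Fml.names, Set.union_subset_iff, Fml.sub] at hM ⊢
    exact ⟨h.apply hM.1, ih hM.2 h.up⟩
  | eall s t A ih =>
    simp only [Fml.names, Set.union_subset_iff, Fml.sub] at hM ⊢
    exact ⟨⟨h.apply hM.1.1, h.apply hM.1.2⟩, ih hM.2 h.up⟩
  | eex s t A ih =>
    simp only [Fml.names, Set.union_subset_iff, Fml.sub] at hM ⊢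
    exact ⟨⟨h.apply hM.1.1, h.apply hM.1.2⟩, ih hM.2 h.up⟩
  | all _ A ih => exact ih hM h.up
  | ex _ A ih => exact ih hM h.up

/-! ### Size and rank of formulas -/

/-- The number of connectives and quantifiers. -/
def Fml.size {T : Type u} {b : Bool} : {n : ℕ} → Fml T b n → ℕ
  | _, .mem _ _ => 1
  | _, .neg A => A.size + 1
  | _, .and A B => A.size + B.size + 1
  | _, .or A B => A.size + B.size + 1
  | _, .imp A B => A.size + B.size + 1
  | _, .ball _ A => A.size + 1
  | _, .bex _ A => A.size + 1
  | _, .eall _ _ A => A.size + 1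
  | _, .eex _ _ A => A.size + 1
  | _, .all _ A => A.size + 1
  | _, .ex _ A => A.size + 1

@[simp] theorem Fml.size_sub (A : Fml T b n) {m : ℕ} (e : Tm T n → Tm T' m) :
    (A.sub e).size = A.size := by
  induction A generalizing m with
  | mem s t => rfl
  | and A B ihA ihB => simp only [Fml.sub, Fml.size, ihA, ihB]
  | or A B ihA ihB => simp only [Fml.sub, Fml.size, ihA, ihB]
  | imp A B ihA ihB => simp only [Fml.sub, Fml.size, ihA, ihB]
  | _ => simp only [Fml.sub, Fml.size, *]

@[simp] theorem Fml.size_map (A : Fml T b n) (f : T → T') : (A.map f).size = A.size :=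
  A.size_sub _

@[simp] theorem Fml.size_inst (A : Fml T b n) (s : Fin n → T) : (A.inst s).size = A.size :=
  A.size_sub _

/-- Ordinals attached to names stay below `Ω`, even after adding `ω`. Apart from the value `Ω`
itself at unbounded quantifiers, every logical symbol contributes at most `2`. -/
theorem Fml.rank_lt (A : Fml T b n) {β : T → Ordinal.{0}} (hβ : ∀ t, β t < Om) :
    A.rank β < Om + ((2 * A.size : ℕ) : Ordinal.{0}) := by
  have hTm : ∀ {n : ℕ} (s : Tm T n), s.rank β < Om := by
    intro n s
    cases s with
    | con t => exact hβ t
    | bv i => exact Om_pos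
  have hle : ∀ k : ℕ, Om ≤ Om + ((k : ℕ) : Ordinal.{0}) := fun k => le_self_add
  have hadd : ∀ {x : Ordinal.{0}} {k : ℕ} (j : ℕ), x < Om + (k : Ordinal.{0}) →
      x + (j : Ordinal.{0}) < Om + ((k + j : ℕ) : Ordinal.{0}) := by
    intro x k j hx
    rw [Nat.cast_add, ← add_assoc]
    induction j with
    | zero => simpa using hx
    | succ j ih =>
      rw [Nat.cast_succ, ← add_assoc, ← add_assoc]
      simpa only [← Order.succ_eq_add_one, Order.succ_lt_succ_iff] using ih
  have hmono : ∀ {x : Ordinal.{0}} {k j : ℕ}, x < Om + (k : Ordinal.{0}) → k ≤ j →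
      x < Om + (j : Ordinal.{0}) := fun h hj => h.trans_le (by gcongr)
  have hOm : ∀ {x : Ordinal.{0}} (k : ℕ), x < Om → x < Om + (k : Ordinal.{0}) :=
    fun k hx => hx.trans_le (hle k)
  have hω : ∀ {x : Ordinal.{0}}, x < Om → x + ω < Om := fun h => add_lt_Om h omega0_lt_Om
  have hpos : ∀ k : ℕ, Om < Om + ((k + 1 : ℕ) : Ordinal.{0}) := fun k =>
    lt_add_of_pos_right _ (by exact_mod_cast k.succ_pos)
  induction A with
  | mem s t => exact max_lt (hOm _ (hTm s)) (hOm _ (hTm t))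
  | neg A ih =>
    simpa [Fml.rank] using hmono (hadd 1 ih) (show _ ≤ 2 * A.neg.size by simp only [Fml.size]; omega)
  | and A B ihA ihB =>
    simpa [Fml.rank] using hmono (hadd 1 (max_lt (hmono ihA (Nat.le_max_left _ _))
      (hmono ihB (Nat.le_max_right _ _)))) (show _ ≤ 2 * (A.and B).size by
        simp only [Fml.size]; omega)
  | or A B ihA ihB =>
    simpa [Fml.rank] using hmono (hadd 1 (max_lt (hmono ihA (Nat.le_max_left _ _))
      (hmono ihB (Nat.le_max_right _ _)))) (show _ ≤ 2 * (A.or B).size by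
        simp only [Fml.size]; omega)
  | imp A B ihA ihB =>
    simpa [Fml.rank] using hmono (hadd 1 (max_lt (hmono ihA (Nat.le_max_left _ _))
      (hmono ihB (Nat.le_max_right _ _)))) (show _ ≤ 2 * (A.imp B).size by
        simp only [Fml.size]; omega)
  | ball t A ih =>
    exact max_lt (hOm _ (hTm t)) (by simpa [Fml.size, Nat.mul_add] using hadd 2 ih)
  | bex t A ih =>
    exact max_lt (hOm _ (hTm t)) (by simpa [Fml.size, Nat.mul_add] using hadd 2 ih)
  | eall s t A ih =>
    exact max_lt (max_lt (hOm _ (hω (hTm s))) (hOm _ (hω (hTm t))))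
      (by simpa [Fml.size, Nat.mul_add] using hadd 2 ih)
  | eex s t A ih =>
    exact max_lt (max_lt (hOm _ (hω (hTm s))) (hOm _ (hω (hTm t))))
      (by simpa [Fml.size, Nat.mul_add] using hadd 2 ih)
  | all _ A ih =>
    exact max_lt (hpos _) (by simpa [Fml.size, Nat.mul_add] using hadd 2 ih)
  | ex _ A ih =>
    exact max_lt (hpos _) (by simpa [Fml.size, Nat.mul_add] using hadd 2 ih)

theorem Fml.lift_sub : {n : ℕ} → (A : Fml T false n) → {m : ℕ} → (e : Tm T n → Tm T' m) →
    (A.sub e).lift = A.lift.sub e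
  | _, .mem _ _, _, _ => rfl
  | _, .neg A, _, e => congrArg Fml.neg (A.lift_sub e)
  | _, .and A B, _, e => congrArg₂ Fml.and (A.lift_sub e) (B.lift_sub e)
  | _, .or A B, _, e => congrArg₂ Fml.or (A.lift_sub e) (B.lift_sub e)
  | _, .imp A B, _, e => congrArg₂ Fml.imp (A.lift_sub e) (B.lift_sub e)
  | _, .ball _ A, _, e => congrArg (Fml.ball _) (A.lift_sub (Tm.up e))
  | _, .bex _ A, _, e => congrArg (Fml.bex _) (A.lift_sub (Tm.up e))
  | _, .eall _ _ A, _, e => congrArg (Fml.eall _ _) (A.lift_sub (Tm.up e))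
  | _, .eex _ _ A, _, e => congrArg (Fml.eex _ _) (A.lift_sub (Tm.up e))

theorem Fml.rel_lift : {n : ℕ} → (A : Fml T false n) → (z : Tm T n) → A.lift.rel z = A.lift
  | _, .mem _ _, _ => rfl
  | _, .neg A, z => congrArg Fml.neg (A.rel_lift z)
  | _, .and A B, z => congrArg₂ Fml.and (A.rel_lift z) (B.rel_lift z)
  | _, .or A B, z => congrArg₂ Fml.or (A.rel_lift z) (B.rel_lift z)
  | _, .imp A B, z => congrArg₂ Fml.imp (A.rel_lift z) (B.rel_lift z)
  | _, .ball _ A, z => congrArg (Fml.ball _) (A.rel_lift z.sh)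
  | _, .bex _ A, z => congrArg (Fml.bex _) (A.rel_lift z.sh)
  | _, .eall _ _ A, z => congrArg (Fml.eall _ _) (A.rel_lift z.sh)
  | _, .eex _ _ A, z => congrArg (Fml.eex _ _) (A.rel_lift z.sh)

theorem Tm.ext_on {e e' : Tm T n → Tm T' m} (h : ∀ t, e (.con t) = e' (.con t))
    (h' : ∀ i, e (.var i) = e' (.var i)) : e = e' := by
  funext x
  cases x with
  | con t => exact h t
  | bv i => exact h' i

theorem Fml.sub_eq_sub (A : Fml T b n) {e e' : Tm T n → Tm T' m}
    (h : ∀ t, e (.con t) = e' (.con t)) (h' : ∀ i, e (.var i) = e' (.var i)) :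
    A.sub e = A.sub e' := by
  rw [Tm.ext_on h h']

/-! ### Substituting names for names -/

/-- The substitution of names by names. -/
abbrev Tm.mapping (f : T → T') : Tm T n → Tm T' n := Tm.elim (fun t => .con (f t)) Tm.var

theorem Tm.up_mapping (f : T → T') :
    Tm.up (Tm.mapping f : Tm T n → Tm T' n) = Tm.mapping f := by
  refine Tm.ext_on (fun t => by simp) fun i => ?_
  cases i using Fin.cases <;> simp

section map

variable (f : T → T')

theorem Fml.map_mem (s t : Tm T n) :
    (Fml.mem s t : Fml T b n).map f = .mem (Tm.mapping f s) (Tm.mapping f t) := rfl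

@[simp] theorem Fml.map_mem_con (s t : T) :
    (Fml.mem (.con s) (.con t) : Fml T b n).map f = .mem (.con (f s)) (.con (f t)) := by
  simp [Fml.map_mem]

@[simp] theorem Fml.map_and (A B : Fml T b n) : (A.and B).map f = (A.map f).and (B.map f) := rfl

@[simp] theorem Fml.map_imp (A B : Fml T b n) : (A.imp B).map f = (A.map f).imp (B.map f) := rfl

@[simp] theorem Fml.map_ball (t : T) (A : Fml T b (n + 1)) :
    (Fml.ball (.con t) A).map f = .ball (.con (f t)) (A.map f) := by
  simp [Fml.map, Fml.sub, Tm.up_mapping]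

@[simp] theorem Fml.map_ball_bv (i : Fin (n + 1)) (A : Fml T b (n + 1 + 1)) :
    (Fml.ball (.bv i) A).map f = .ball (.bv i) (A.map f) := by
  simp [Fml.map, Fml.sub, Tm.up_mapping]

@[simp] theorem Fml.map_bex (t : T) (A : Fml T b (n + 1)) :
    (Fml.bex (.con t) A).map f = .bex (.con (f t)) (A.map f) := by
  simp [Fml.map, Fml.sub, Tm.up_mapping]

@[simp] theorem Fml.map_bex_bv (i : Fin (n + 1)) (A : Fml T b (n + 1 + 1)) :
    (Fml.bex (.bv i) A).map f = .bex (.bv i) (A.map f) := by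
  simp [Fml.map, Fml.sub, Tm.up_mapping]

@[simp] theorem Fml.map_eall (s t : T) (A : Fml T b (n + 1)) :
    (Fml.eall (.con s) (.con t) A).map f = .eall (.con (f s)) (.con (f t)) (A.map f) := by
  simp [Fml.map, Fml.sub, Tm.up_mapping]

@[simp] theorem Fml.map_eex (s t : T) (A : Fml T b (n + 1)) :
    (Fml.eex (.con s) (.con t) A).map f = .eex (.con (f s)) (.con (f t)) (A.map f) := by
  simp [Fml.map, Fml.sub, Tm.up_mapping]

@[simp] theorem Fml.map_all (h : b = true) (A : Fml T b (n + 1)) :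
    (Fml.all h A).map f = .all h (A.map f) := by
  simp [Fml.map, Fml.sub, Tm.up_mapping]

@[simp] theorem Fml.map_ex (h : b = true) (A : Fml T b (n + 1)) :
    (Fml.ex h A).map f = .ex h (A.map f) := by
  simp [Fml.map, Fml.sub, Tm.up_mapping]

theorem Fml.map_eq_con (s t : T) :
    (Fml.eq (.con s) (.con t) : Fml T b 0).map f = .eq (.con (f s)) (.con (f t)) := rfl

theorem Fml.map_fn_con (x s t : T) :
    (Fml.fn (.con x) (.con s) (.con t) : Fml T b 0).map f =
      .fn (.con (f x)) (.con (f s)) (.con (f t)) := rfl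

theorem Fml.map_map (g : T' → T'') (A : Fml T b n) : (A.map f).map g = A.map (g ∘ f) := by
  rw [Fml.map, Fml.map, Fml.sub_sub]
  exact A.sub_eq_sub (fun t => by simp) fun i => by simp

@[simp] theorem Fml.map_inst (A : Fml T b n) (v : Fin n → T) :
    (A.inst v).map f = (A.map f).inst (f ∘ v) := by
  simp only [Fml.map, Fml.inst, Fml.sub_sub]
  exact A.sub_eq_sub (fun t => by simp) fun i => by simp

theorem Fml.map_inst_one (A : Fml T b 1) (a : T) : (A.inst ![a]).map f = (A.map f).inst ![f a] := by
  rw [Fml.map_inst]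
  congr 1
  funext i
  simp

theorem Fml.map_ren (A : Fml T b n) (g : Fin n → Fin m) : (A.ren g).map f = (A.map f).ren g := by
  simp only [Fml.map, Fml.ren, Fml.sub_sub]
  exact A.sub_eq_sub (fun t => by simp) fun i => by simp

end map

theorem Fml.map_lift (f : T → T') (A : Fml T false n) : A.lift.map f = (A.map f).lift :=
  (A.lift_sub _).symm

theorem Fml.ren_lift (A : Fml T false n) (g : Fin n → Fin m) : A.lift.ren g = (A.ren g).lift :=
  (A.lift_sub _).symm

theorem Fml.map_congr {f g : T → T'} (A : Fml T b n) (h : ∀ t ∈ A.names, f t = g t) :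
    A.map f = A.map g :=
  A.sub_congr subset_rfl ⟨fun t ht => by simp [h t ht], fun i => by simp⟩

theorem Fml.map_id (A : Fml T b n) : A.map id = A := by
  conv_rhs => rw [← A.sub_id]
  exact A.sub_eq_sub (fun t => by simp) fun i => by simp

theorem Fml.names_inst (A : Fml T b 1) (t : T) : (A.inst ![t]).names ⊆ insert t A.names := by
  refine A.names_sub subset_rfl ⟨fun s hs => ?_, fun i => ?_⟩
  · simpa [Tm.names] using Or.inr hs
  · simp [Tm.names]

theorem Fml.names_map (f : T → T') (A : Fml T b n) : (A.map f).names ⊆ f '' A.names := by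
  refine A.names_sub subset_rfl ⟨fun s hs => ?_, fun i => ?_⟩
  · simpa [Tm.names] using ⟨s, hs, rfl⟩
  · cases n with
    | zero => exact i.elim0
    | succ n => simp [Tm.names]

theorem Tm.names_finite (s : Tm T n) : s.names.Finite := by
  cases s with
  | con t => exact Set.finite_singleton t
  | bv i => exact Set.finite_empty

theorem Fml.names_finite (A : Fml T b n) : A.names.Finite := by
  induction A with
  | mem s t => exact s.names_finite.union t.names_finite
  | and A B ihA ihB => exact ihA.union ihB
  | or A B ihA ihB => exact ihA.union ihB
  | imp A B ihA ihB => exact ihA.union ihB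
  | ball t A ih => exact t.names_finite.union ih
  | bex t A ih => exact t.names_finite.union ih
  | eall s t A ih => exact (s.names_finite.union t.names_finite).union ih
  | eex s t A ih => exact (s.names_finite.union t.names_finite).union ih
  | _ => assumption

/-- The renaming places `G` under one more outer variable, which does not occur in it. Substituting
a name for that variable only undoes the weakening. -/
theorem Fml.ren_zero_sub (G : Fml T b 1) (t : T) :
    (G.ren ![0] : Fml T b 2).sub (Tm.up (Tm.elim Tm.con fun _ => Tm.con t)) = G := by
  conv_rhs => rw [← G.sub_id]
  rw [Fml.ren, Fml.sub_sub]
  refine G.sub_eq_sub (fun t => by simp) fun i => ?_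
  fin_cases i
  rfl

/-- The cut rule and the level axiom for separation terms display the parameters of a formula as a
finite tuple. A bound on the free variables provides such a presentation. -/
theorem Fml.exists_fin (A : Fml ℕ b n) :
    ∃ (m : ℕ) (A' : Fml (Fin m) b n) (v : Fin m → ℕ), A = A'.map v ∧ A'.size = A.size := by
  obtain ⟨N, hN⟩ := A.names_finite.bddAbove
  refine ⟨N + 1, A.map fun i => Fin.ofNat (N + 1) i, Fin.val, ?_, A.size_map _⟩
  rw [Fml.map_map]
  conv_lhs => rw [← A.map_id]
  refine A.map_congr fun t ht => ?_
  have := hN ht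
  simp [Nat.mod_eq_of_lt (show t < N + 1 by omega)]

end Substitution

/-! ### Structural properties of the infinitary system -/

abbrev Ctx := Finset (Fml Term true 0)

theorem Ax.mono {Γ Γ' : Ctx} {Δ : Option (Fml Term true 0)} (h : Ax Γ Δ) (hΓ : Γ ⊆ Γ') :
    Ax Γ' Δ := by
  cases h with
  | e1 Γ A =>
    rw [← Finset.union_eq_right.2 hΓ, Finset.insert_union]
    exact .e1 _ A
  | e2 _ t => exact .e2 _ t
  | e3 Γ B s t =>
    rw [← Finset.union_eq_right.2 hΓ, Finset.insert_union, Finset.union_assoc]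
    exact .e3 _ B s t
  | e4 _ h => exact .e4 _ h
  | e5 _ i h => exact .e5 _ i h
  | e6 Γ α s t =>
    rw [← Finset.union_eq_right.2 hΓ, Finset.insert_union, Finset.insert_union]
    exact .e6 _ α s t
  | e7 Γ h s t =>
    rw [← Finset.union_eq_right.2 hΓ, Finset.insert_union, Finset.insert_union]
    exact .e7 _ h s t
  | e8 Γ s t F =>
    rw [← Finset.union_eq_right.2 hΓ, Finset.insert_union, Finset.insert_union]
    exact .e8 _ s t F
  | e9 Γ s t F =>
    rw [← Finset.union_eq_right.2 hΓ, Finset.insert_union]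
    exact .e9 _ s t F
  | e10 Γ h p s t =>
    rw [← Finset.union_eq_right.2 hΓ, Finset.insert_union, Finset.insert_union,
      Finset.insert_union]
    exact .e10 _ h p s t
  | e11 Γ F t p hβ hα =>
    rw [← Finset.union_eq_right.2 hΓ, Finset.insert_union, Finset.union_assoc]
    exact .e11 _ F t p hβ hα

theorem Der.mem {ρ : Ordinal.{0}} {H : Set Ordinal.{0} → Set Ordinal.{0}} {α : Ordinal.{0}}
    {Γ : Ctx} {Δ : Option (Fml Term true 0)} (h : Der ρ H α Γ Δ) : α ∈ H ∅ := by
  cases h <;> assumption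

/-- Pointwise inclusion of operators. -/
def OpLe (H H' : Set Ordinal.{0} → Set Ordinal.{0}) : Prop := ∀ X ⊆ ON, H X ⊆ H' X

theorem OpLe.mem {H H' : Set Ordinal.{0} → Set Ordinal.{0}} (h : OpLe H H') {x : Ordinal.{0}}
    (hx : x ∈ H ∅) : x ∈ H' ∅ := h ∅ (Set.empty_subset _) hx

theorem OpLe.ctl {H H' : Set Ordinal.{0} → Set Ordinal.{0}} (h : OpLe H H') (β : Idx) :
    OpLe (ctl H {β.1}) (ctl H' {β.1}) :=
  fun _ hX => h _ (Set.union_subset hX β.singleton_subset)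

/-- Only the last inference changes its height. The premises keep theirs, which are controlled by
`H` and hence by `H'`. The new height is not controlled by monotonicity, so this is a hypothesis. -/
theorem Der.mono {ρ ρ' : Ordinal.{0}} {H H' : Set Ordinal.{0} → Set Ordinal.{0}}
    {α α' : Ordinal.{0}} {Γ Γ' : Ctx} {Δ : Option (Fml Term true 0)} (hρ : ρ ≤ ρ')
    (h : Der ρ H α Γ Δ) (hH : OpLe H H') (hΓ : Γ ⊆ Γ') (hα : α ≤ α') (hm : α' ∈ H' ∅) :
    Der ρ' H' α' Γ' Δ := by
  -- The principal formula of a left rule already lies in `Γ'`, so `Γ'` itself can serve as the side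
  -- context: antecedents are sets, and contraction is built in.
  have key : ∀ {A : Fml Term true 0} {Γ Γ' : Ctx}, insert A Γ ⊆ Γ' →
      insert A Γ' = Γ' ∧ Γ ⊆ Γ' := fun h =>
    ⟨Finset.insert_eq_of_mem (h (Finset.mem_insert_self _ _)),
      (Finset.subset_insert _ _).trans h⟩
  have ins : ∀ (A : Fml Term true 0) {Γ Γ' : Ctx}, Γ ⊆ Γ' → insert A Γ ⊆ insert A Γ' :=
    fun A _ _ h => Finset.insert_subset_insert A h
  induction h generalizing H' α' Γ' with
  | ax _ h => exact .ax hm (h.mono hΓ)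
  | eLim _ f hlim hγ hf h ih =>
    obtain ⟨e, hΓ⟩ := key hΓ
    rw [← e]
    exact .eLim hm f hlim (hH.mem hγ) (fun δ hδ => (hf δ hδ).trans_le hα) fun δ hδ =>
      ih δ hδ (hH.ctl δ) (ins _ hΓ) le_rfl ((hH.ctl δ).mem (h δ hδ).mem)
  | ballL _ h₀ h₁ h₂ hβ hγ hγα hγβ d₀ d₁ d₂ i₀ i₁ i₂ =>
    obtain ⟨e, hΓ⟩ := key hΓ
    rw [← e]
    exact .ballL hm (h₀.trans_le hα) (h₁.trans_le hα) (h₂.trans_le hα) (hH.mem hβ) (hH.mem hγ)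
      (hγα.trans_le hα) hγβ (i₀ hH (ins _ hΓ) le_rfl (hH.mem d₀.mem))
      (i₁ hH hΓ le_rfl (hH.mem d₁.mem)) (i₂ hH hΓ le_rfl (hH.mem d₂.mem))
  | ballR _ h₀ h₁ hβ hβα d₀ d₁ i₀ i₁ =>
    exact .ballR hm (h₀.trans_le hα) (h₁.trans_le hα) (hH.mem hβ) (hβα.trans_le hα)
      (fun s => i₀ s hH hΓ le_rfl (hH.mem (d₀ s).mem)) (i₁ hH hΓ le_rfl (hH.mem d₁.mem))
  | bexL _ h₀ h₁ hβ hβα d₀ d₁ i₀ i₁ =>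
    obtain ⟨e, hΓ⟩ := key hΓ
    rw [← e]
    exact .bexL hm (h₀.trans_le hα) (h₁.trans_le hα) (hH.mem hβ) (hβα.trans_le hα)
      (fun s => i₀ s hH (ins _ hΓ) le_rfl (hH.mem (d₀ s).mem))
      (i₁ hH hΓ le_rfl (hH.mem d₁.mem))
  | bexR _ h₀ h₁ h₂ hβ hγ hγα hγβ d₀ d₁ d₂ i₀ i₁ i₂ =>
    exact .bexR hm (h₀.trans_le hα) (h₁.trans_le hα) (h₂.trans_le hα) (hH.mem hβ) (hH.mem hγ)
      (hγα.trans_le hα) hγβ (i₀ hH hΓ le_rfl (hH.mem d₀.mem))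
      (i₁ hH hΓ le_rfl (hH.mem d₁.mem)) (i₂ hH hΓ le_rfl (hH.mem d₂.mem))
  | eallL _ h₀ h₁ h₂ h₃ hβ hγ hδ hδα hδm d₀ d₁ d₂ d₃ i₀ i₁ i₂ i₃ =>
    obtain ⟨e, hΓ⟩ := key hΓ
    rw [← e]
    exact .eallL hm (h₀.trans_le hα) (h₁.trans_le hα) (h₂.trans_le hα) (h₃.trans_le hα)
      (hH.mem hβ) (hH.mem hγ) (hH.mem hδ) (hδα.trans_le hα) hδm
      (i₀ hH (ins _ hΓ) le_rfl (hH.mem d₀.mem))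
      (i₁ hH hΓ le_rfl (hH.mem d₁.mem)) (i₂ hH hΓ le_rfl (hH.mem d₂.mem))
      (i₃ hH hΓ le_rfl (hH.mem d₃.mem))
  | eallR _ h₀ h₁ h₂ hβ hγ hmx d₀ d₁ d₂ i₀ i₁ i₂ =>
    exact .eallR hm (h₀.trans_le hα) (h₁.trans_le hα) (h₂.trans_le hα)
      (hH.mem hβ) (hH.mem hγ) (hmx.trans hα)
      (fun p => i₀ p hH hΓ le_rfl (hH.mem (d₀ p).mem))
      (i₁ hH hΓ le_rfl (hH.mem d₁.mem)) (i₂ hH hΓ le_rfl (hH.mem d₂.mem))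
  | eexL _ h₀ h₁ h₂ hβ hγ hmx d₀ d₁ d₂ i₀ i₁ i₂ =>
    obtain ⟨e, hΓ⟩ := key hΓ
    rw [← e]
    exact .eexL hm (h₀.trans_le hα) (h₁.trans_le hα) (h₂.trans_le hα)
      (hH.mem hβ) (hH.mem hγ) (hmx.trans hα)
      (fun p => i₀ p hH (ins _ hΓ) le_rfl (hH.mem (d₀ p).mem))
      (i₁ hH hΓ le_rfl (hH.mem d₁.mem)) (i₂ hH hΓ le_rfl (hH.mem d₂.mem))
  | eexR _ h₀ h₁ h₂ h₃ hβ hγ hδ hδα hδm d₀ d₁ d₂ d₃ i₀ i₁ i₂ i₃ =>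
    exact .eexR hm (h₀.trans_le hα) (h₁.trans_le hα) (h₂.trans_le hα) (h₃.trans_le hα)
      (hH.mem hβ) (hH.mem hγ) (hH.mem hδ) (hδα.trans_le hα) hδm
      (i₀ hH hΓ le_rfl (hH.mem d₀.mem))
      (i₁ hH hΓ le_rfl (hH.mem d₁.mem)) (i₂ hH hΓ le_rfl (hH.mem d₂.mem))
      (i₃ hH hΓ le_rfl (hH.mem d₃.mem))
  | allL _ h₀ h₁ hβα hβ d₀ d₁ i₀ i₁ =>
    obtain ⟨e, hΓ⟩ := key hΓ
    rw [← e]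
    exact .allL hm (h₀.trans_le hα) (h₁.trans_le hα) (hβα.trans_le hα) (hH.mem hβ)
      (i₀ hH (ins _ hΓ) le_rfl (hH.mem d₀.mem)) (i₁ hH hΓ le_rfl (hH.mem d₁.mem))
  | allR _ f hf d i =>
    exact .allR hm f (fun β => ⟨(hf β).1, (hf β).2.trans_le hα⟩) fun β s =>
      i β s (hH.ctl β) (ins _ hΓ) le_rfl ((hH.ctl β).mem (d β s).mem)
  | exL _ f hf d i =>
    obtain ⟨e, hΓ⟩ := key hΓ
    rw [← e]
    exact .exL hm f (fun β => ⟨(hf β).1, (hf β).2.trans_le hα⟩) fun β s =>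
      i β s (hH.ctl β) (ins _ (ins _ hΓ)) le_rfl ((hH.ctl β).mem (d β s).mem)
  | exR _ h₀ h₁ hβα hβ d₀ d₁ i₀ i₁ =>
    exact .exR hm (h₀.trans_le hα) (h₁.trans_le hα) (hβα.trans_le hα) (hH.mem hβ)
      (i₀ hH hΓ le_rfl (hH.mem d₀.mem)) (i₁ hH hΓ le_rfl (hH.mem d₁.mem))
  | sigmaRef _ hA h₀ hΩ d i =>
    exact .sigmaRef hm hA (h₀.trans_le hα) (hΩ.trans_le hα) (i hH hΓ le_rfl (hH.mem d.mem))
  | cut _ A s β h₀ h₁ h₂ hr hβ d₀ d₁ d₂ i₀ i₁ i₂ =>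
    exact .cut hm A s β (h₀.trans_le hα) (h₁.trans_le hα) (h₂.trans_le hα) (hr.trans_le hρ)
      (fun j => hH.mem (hβ j)) (i₀ hH (ins _ hΓ) le_rfl (hH.mem d₀.mem))
      (i₁ hH hΓ le_rfl (hH.mem d₁.mem)) (fun j => i₂ j hH hΓ le_rfl (hH.mem (d₂ j).mem))
  | andL₁ _ h₀ d i =>
    obtain ⟨e, hΓ⟩ := key hΓ
    rw [← e]
    exact .andL₁ hm (h₀.trans_le hα) (i hH (ins _ hΓ) le_rfl (hH.mem d.mem))
  | andL₂ _ h₀ d i =>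
    obtain ⟨e, hΓ⟩ := key hΓ
    rw [← e]
    exact .andL₂ hm (h₀.trans_le hα) (i hH (ins _ hΓ) le_rfl (hH.mem d.mem))
  | andR _ h₀ d₀ d₁ i₀ i₁ =>
    exact .andR hm (h₀.trans_le hα) (i₀ hH hΓ le_rfl (hH.mem d₀.mem))
      (i₁ hH hΓ le_rfl (hH.mem d₁.mem))
  | orL _ h₀ d₀ d₁ i₀ i₁ =>
    obtain ⟨e, hΓ⟩ := key hΓ
    rw [← e]
    exact .orL hm (h₀.trans_le hα) (i₀ hH (ins _ hΓ) le_rfl (hH.mem d₀.mem))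
      (i₁ hH (ins _ hΓ) le_rfl (hH.mem d₁.mem))
  | orR₁ _ h₀ d i => exact .orR₁ hm (h₀.trans_le hα) (i hH hΓ le_rfl (hH.mem d.mem))
  | orR₂ _ h₀ d i => exact .orR₂ hm (h₀.trans_le hα) (i hH hΓ le_rfl (hH.mem d.mem))
  | negL _ h₀ d i =>
    obtain ⟨e, hΓ⟩ := key hΓ
    rw [← e]
    exact .negL hm (h₀.trans_le hα) (i hH hΓ le_rfl (hH.mem d.mem))
  | negR _ h₀ d i => exact .negR hm (h₀.trans_le hα) (i hH (ins _ hΓ) le_rfl (hH.mem d.mem))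
  | bot _ h₀ d i => exact .bot hm (h₀.trans_le hα) (i hH hΓ le_rfl (hH.mem d.mem))
  | impL _ h₀ d₀ d₁ i₀ i₁ =>
    obtain ⟨e, hΓ⟩ := key hΓ
    rw [← e]
    exact .impL hm (h₀.trans_le hα) (i₀ hH (ins _ hΓ) le_rfl (hH.mem d₀.mem))
      (i₁ hH hΓ le_rfl (hH.mem d₁.mem))
  | impR _ h₀ d i => exact .impR hm (h₀.trans_le hα) (i hH (ins _ hΓ) le_rfl (hH.mem d.mem))

/-! ### Derivations of height `X + n` for a base height `X ≥ Ω` -/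

/-- An operator controlling a base height `X ≥ Ω`, for cut rank `ρ ≥ Ω`. -/
structure Base (ρ X : Ordinal.{0}) (H : Set Ordinal.{0} → Set Ordinal.{0}) : Prop where
  op : IsOperator H
  mem : X ∈ H ∅
  le : Om ≤ X
  rho : Om ≤ ρ

/-- Derivability at height `X + n`. -/
abbrev DerN (ρ X : Ordinal.{0}) (H : Set Ordinal.{0} → Set Ordinal.{0}) (n : ℕ)
    (Γ : Ctx) (Δ : Option (Fml Term true 0)) : Prop := Der ρ H (X + (n : Ordinal.{0})) Γ Δ

theorem OpLe.refl (H : Set Ordinal.{0} → Set Ordinal.{0}) : OpLe H H := fun _ _ => subset_rfl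

theorem add_natCast_lt (X : Ordinal.{0}) {m n : ℕ} (h : m < n) :
    X + (m : Ordinal.{0}) < X + (n : Ordinal.{0}) := by
  gcongr

theorem add_natCast_add_three_lt (X : Ordinal.{0}) {m n : ℕ} (h : m + 3 < n) :
    X + (m : Ordinal.{0}) + 3 < X + (n : Ordinal.{0}) := by
  have := add_natCast_lt X h
  rwa [Nat.cast_add, ← add_assoc] at this

namespace Base

variable {ρ X : Ordinal.{0}} {H : Set Ordinal.{0} → Set Ordinal.{0}} {Γ Γ' : Ctx}
  {Δ : Option (Fml Term true 0)} {m n k l : ℕ}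

theorem ctl (B : Base ρ X H) (β : Idx) : Base ρ X (ctl H {β.1}) where
  op := B.op.ctl β.singleton_subset
  mem := OpLe.mem (B.op.subset_ctl β.singleton_subset) B.mem
  le := B.le
  rho := B.rho

theorem memN (B : Base ρ X H) (n : ℕ) : X + (n : Ordinal.{0}) ∈ H ∅ :=
  B.op.add_mem B.mem (B.op.natCast_mem n)

theorem idx_lt (B : Base ρ X H) (β : Idx) (n : ℕ) : β.1 < X + (n : Ordinal.{0}) :=
  (β.2.2.trans_le B.le).trans_le le_self_add

theorem mono (B : Base ρ X H) (d : DerN ρ X H m Γ Δ) (hΓ : Γ ⊆ Γ') (h : m ≤ n) :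
    DerN ρ X H n Γ' Δ :=
  Der.mono le_rfl d (OpLe.refl H) hΓ (by gcongr) (B.memN n)

theorem ax (B : Base ρ X H) (h : Ax Γ Δ) (n : ℕ) : DerN ρ X H n Γ Δ := .ax (B.memN n) h

theorem hyp_mem (B : Base ρ X H) {s t : Term} (h : .mem (.con s) (.con t) ∈ Γ) (n : ℕ) :
    DerN ρ X H n Γ (some (.mem (.con s) (.con t))) := by
  have := Ax.e1 Γ (.mem (.con s) (.con t))
  simp only [Fml.lift, Finset.insert_eq_of_mem h] at this
  exact B.ax this n

theorem hyp_lift (B : Base ρ X H) {A : Fml Term false 0} (h : A.lift ∈ Γ) (n : ℕ) :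
    DerN ρ X H n Γ (some A.lift) := by
  have := Ax.e1 Γ A
  rw [Finset.insert_eq_of_mem h] at this
  exact B.ax this n

theorem hyp_fn (B : Base ρ X H) {p s t : Term} (h : .fn (.con p) (.con s) (.con t) ∈ Γ) (n : ℕ) :
    DerN ρ X H n Γ (some (.fn (.con p) (.con s) (.con t))) :=
  B.hyp_lift (A := .fn (.con p) (.con s) (.con t)) h n

theorem bot (B : Base ρ X H) {A : Fml Term true 0} (d : DerN ρ X H m Γ none)
    (h : m < n := by omega) : DerN ρ X H n Γ (some A) :=
  .bot (B.memN n) (add_natCast_lt X h) d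

theorem andR (B : Base ρ X H) {A C : Fml Term true 0} (d₀ : DerN ρ X H m Γ (some A))
    (d₁ : DerN ρ X H k Γ (some C)) (h : m < n := by omega) (h' : k < n := by omega) :
    DerN ρ X H n Γ (some (.and A C)) :=
  .andR (B.memN n) (add_natCast_lt X (max_lt h h')) (B.mono d₀ subset_rfl (le_max_left m k))
    (B.mono d₁ subset_rfl (le_max_right m k))

theorem andL₁ (B : Base ρ X H) {A C : Fml Term true 0} (hA : .and A C ∈ Γ)
    (d : DerN ρ X H m (insert A Γ) Δ) (h : m < n := by omega) : DerN ρ X H n Γ Δ := by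
  rw [← Finset.insert_eq_of_mem hA]
  exact .andL₁ (B.memN n) (add_natCast_lt X h) d

theorem andL₂ (B : Base ρ X H) {A C : Fml Term true 0} (hA : .and A C ∈ Γ)
    (d : DerN ρ X H m (insert C Γ) Δ) (h : m < n := by omega) : DerN ρ X H n Γ Δ := by
  rw [← Finset.insert_eq_of_mem hA]
  exact .andL₂ (B.memN n) (add_natCast_lt X h) d

theorem andL (B : Base ρ X H) {A C : Fml Term true 0} (hA : .and A C ∈ Γ)
    (d : DerN ρ X H m (insert C (insert A Γ)) Δ) (h : m + 1 < n := by omega) :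
    DerN ρ X H n Γ Δ :=
  B.andL₁ hA (B.andL₂ (Finset.mem_insert_of_mem hA) d (Nat.lt_succ_self m))

theorem orR₁ (B : Base ρ X H) {A C : Fml Term true 0} (d : DerN ρ X H m Γ (some A))
    (h : m < n := by omega) : DerN ρ X H n Γ (some (.or A C)) :=
  .orR₁ (B.memN n) (add_natCast_lt X h) d

theorem orR₂ (B : Base ρ X H) {A C : Fml Term true 0} (d : DerN ρ X H m Γ (some C))
    (h : m < n := by omega) : DerN ρ X H n Γ (some (.or A C)) :=
  .orR₂ (B.memN n) (add_natCast_lt X h) d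

theorem orL (B : Base ρ X H) {A C : Fml Term true 0} (hA : .or A C ∈ Γ)
    (d₀ : DerN ρ X H m (insert A Γ) Δ) (d₁ : DerN ρ X H k (insert C Γ) Δ)
    (h : m < n := by omega) (h' : k < n := by omega) : DerN ρ X H n Γ Δ := by
  rw [← Finset.insert_eq_of_mem hA]
  exact .orL (B.memN n) (add_natCast_lt X (max_lt h h'))
    (B.mono d₀ subset_rfl (le_max_left m k)) (B.mono d₁ subset_rfl (le_max_right m k))

theorem negR (B : Base ρ X H) {A : Fml Term true 0} (d : DerN ρ X H m (insert A Γ) none)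
    (h : m < n := by omega) : DerN ρ X H n Γ (some (.neg A)) :=
  .negR (B.memN n) (add_natCast_lt X h) d

theorem negL (B : Base ρ X H) {A : Fml Term true 0} (hA : .neg A ∈ Γ)
    (d : DerN ρ X H m Γ (some A)) (h : m < n := by omega) : DerN ρ X H n Γ none := by
  rw [← Finset.insert_eq_of_mem hA]
  exact .negL (B.memN n) (add_natCast_lt X h) d

theorem impR (B : Base ρ X H) {A C : Fml Term true 0}
    (d : DerN ρ X H m (insert A Γ) (some C)) (h : m < n := by omega) :
    DerN ρ X H n Γ (some (.imp A C)) :=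
  .impR (B.memN n) (add_natCast_lt X h) d

theorem impL (B : Base ρ X H) {A C : Fml Term true 0} (hA : .imp A C ∈ Γ)
    (d₀ : DerN ρ X H m (insert C Γ) Δ) (d₁ : DerN ρ X H k Γ (some A))
    (h : m < n := by omega) (h' : k < n := by omega) : DerN ρ X H n Γ Δ := by
  rw [← Finset.insert_eq_of_mem hA]
  exact .impL (B.memN n) (add_natCast_lt X (max_lt h h'))
    (B.mono d₀ subset_rfl (le_max_left m k)) (B.mono d₁ subset_rfl (le_max_right m k))

theorem exists_succ (B : Base ρ X H) {β : Idx} (hβ : β.1 ∈ H ∅) :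
    ∃ γ : Idx, γ.1 ∈ H ∅ ∧ γ.1 = β.1 + 1 :=
  have h : β.1 + 1 ∈ H ∅ := B.op.add_mem hβ B.op.one_mem
  ⟨B.op.idx _ h (Om_isSuccLimit.succ_lt β.2.2), h, rfl⟩

/-- The level of the function space between levels `β` and `γ`. -/
theorem exists_exp (B : Base ρ X H) {β γ : Idx} (hβ : β.1 ∈ H ∅) (hγ : γ.1 ∈ H ∅) :
    ∃ δ : Idx, δ.1 ∈ H ∅ ∧ δ.1 = max β.1 γ.1 + 2 :=
  have h : max β.1 γ.1 ∈ H ∅ := by rcases max_choice β.1 γ.1 with h | h <;> rwa [h]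
  have h' : max β.1 γ.1 + 2 ∈ H ∅ := B.op.add_mem h (B.op.natCast_mem 2)
  ⟨B.op.idx _ h' (add_lt_Om (max_lt β.2.2 γ.2.2) (natCast_lt_Om 2)), h', rfl⟩

/-- Cut with `s ∈ 𝔼_β`. -/
theorem cutE (B : Base ρ X H) {s : Term} {β : Idx} (hβ : β.1 ∈ H ∅)
    (d₀ : DerN ρ X H m Γ (some (inE s β))) (d₁ : DerN ρ X H k (insert (inE s β) Γ) Δ)
    (h : m < n := by omega) (h' : k < n := by omega) : DerN ρ X H n Γ Δ := by
  -- The cut formula has two parameters, `s` and `𝔼_β`. The latter also needs a level, and `β + 1`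
  -- works by an axiom. The rank `max β (β + 1)` is below `Ω ≤ ρ`.
  obtain ⟨γ, hγ, e⟩ := B.exists_succ hβ
  have hlt : β < γ := by
    rw [← Subtype.coe_lt_coe, e]
    exact lt_add_one _
  have hmap : (Fml.mem (.con 0) (.con 1) : Fml (Fin 2) true 0).map ![s, .E β] = inE s β := rfl
  refine Der.cut (B.memN n) (Fml.mem (.con 0) (.con 1) : Fml (Fin 2) true 0) ![s, .E β] ![β, γ]
    (add_natCast_lt X h') (add_natCast_lt X h) (add_natCast_lt X h) ?_ ?_ ?_ ?_ ?_
  · exact (max_lt β.2.2 γ.2.2).trans_le B.rho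
  · intro i
    fin_cases i
    exacts [hβ, hγ]
  · rwa [hmap]
  · rwa [hmap]
  · intro i
    fin_cases i
    exacts [d₀, B.ax (.e4 Γ hlt) m]

/-- For `β < γ` this is transitivity of the stage `𝔼_γ`: `s ∈ 𝔼_β` and `𝔼_β ∈ 𝔼_γ`, the latter being
an axiom that is cut away. -/
theorem raise (B : Base ρ X H) {s : Term} {β γ : Idx} (hγ : γ.1 ∈ H ∅)
    (hs : inE s β ∈ Γ) (h : β ≤ γ) (hn : 0 < n := by omega) : DerN ρ X H n Γ (some (inE s γ)) := by
  rcases h.eq_or_lt with rfl | h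
  · exact B.hyp_mem hs n
  · have := Ax.e6 Γ γ s (.E β)
    change Ax (insert _ (insert (inE s β) Γ)) _ at this
    rw [Finset.insert_eq_of_mem hs] at this
    exact B.cutE hγ (B.ax (.e4 Γ h) 0) (B.ax this 0)

theorem mem_level (B : Base ρ X H) {s t : Term} {β : Idx} (ht : inE t β ∈ Γ)
    (hs : .mem (.con s) (.con t) ∈ Γ) (n : ℕ) : DerN ρ X H n Γ (some (inE s β)) := by
  have := Ax.e6 Γ β s t
  rw [Finset.insert_eq_of_mem hs, Finset.insert_eq_of_mem ht] at this
  exact B.ax this n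

theorem fn_level (B : Base ρ X H) {p s t : Term} {β γ δ : Idx} (hs : inE s β ∈ Γ)
    (ht : inE t γ ∈ Γ) (hp : .fn (.con p) (.con s) (.con t) ∈ Γ) (hδ : δ.1 = max β.1 γ.1 + 2)
    (n : ℕ) : DerN ρ X H n Γ (some (inE p δ)) := by
  have := Ax.e10 Γ hδ.ge p s t
  rw [Finset.insert_eq_of_mem hp, Finset.insert_eq_of_mem ht, Finset.insert_eq_of_mem hs] at this
  exact B.ax this n

/-- The rule wants the level of the witness to be at most that of the bound. If it is not, the bound
is raised to the level of the witness, so the condition disappears. The same device serves `bexR`,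
`eallL` and `eexR`. -/
theorem ballL (B : Base ρ X H) {F : Fml Term true 1} {s t : Term} {β γ : Idx}
    (hF : .ball (.con t) F ∈ Γ) (hβ : β.1 ∈ H ∅) (hγ : γ.1 ∈ H ∅) (ht : inE t β ∈ Γ)
    (hs : inE s γ ∈ Γ)
    (d : DerN ρ X H m (insert (.imp (.mem (.con s) (.con t)) (F.inst ![s])) Γ) Δ)
    (h : m < n := by omega) (h' : 1 < n := by omega) : DerN ρ X H n Γ Δ := by
  rw [← Finset.insert_eq_of_mem hF]
  rcases le_total γ β with hl | hl
  · exact .ballL (B.memN n) (add_natCast_lt X h) (add_natCast_lt X h') (add_natCast_lt X h')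
      hβ hγ (B.idx_lt γ n) hl d (B.hyp_mem ht 1) (B.hyp_mem hs 1)
  · exact .ballL (B.memN n) (add_natCast_lt X h) (add_natCast_lt X h') (add_natCast_lt X h')
      hγ hγ (B.idx_lt γ n) le_rfl d (B.raise hγ ht hl) (B.hyp_mem hs 1)

theorem bexR (B : Base ρ X H) {F : Fml Term true 1} {s t : Term} {β γ : Idx}
    (hβ : β.1 ∈ H ∅) (hγ : γ.1 ∈ H ∅) (ht : inE t β ∈ Γ) (hs : inE s γ ∈ Γ)
    (d : DerN ρ X H m Γ (some (.and (.mem (.con s) (.con t)) (F.inst ![s]))))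
    (h : m < n := by omega) (h' : 1 < n := by omega) :
    DerN ρ X H n Γ (some (.bex (.con t) F)) := by
  rcases le_total γ β with hl | hl
  · exact .bexR (B.memN n) (add_natCast_lt X h) (add_natCast_lt X h') (add_natCast_lt X h')
      hβ hγ (B.idx_lt γ n) hl d (B.hyp_mem ht 1) (B.hyp_mem hs 1)
  · exact .bexR (B.memN n) (add_natCast_lt X h) (add_natCast_lt X h') (add_natCast_lt X h')
      hγ hγ (B.idx_lt γ n) le_rfl d (B.raise hγ ht hl) (B.hyp_mem hs 1)

/-- The rule supplies no level for `s`. Since `t ∈ 𝔼_β` and `s ∈ t` give `s ∈ 𝔼_β` by an axiom, a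
cut makes this level available as a hypothesis. The same device serves `bexL`. -/
theorem ballR (B : Base ρ X H) {F : Fml Term true 1} {t : Term} {β : Idx}
    (hβ : β.1 ∈ H ∅) (ht : inE t β ∈ Γ)
    (d : ∀ s, DerN ρ X H m (insert (inE s β) (insert (.mem (.con s) (.con t)) Γ))
      (some (F.inst ![s])))
    (h : m + 2 < n := by omega) : DerN ρ X H n Γ (some (.ball (.con t) F)) := by
  refine .ballR (B.memN n) (add_natCast_lt X h) (add_natCast_lt X h) hβ (B.idx_lt β n)
    (fun s => B.impR (m := m + 1) (B.cutE hβ (B.mem_level (t := t) ?_ ?_ 0) (d s)))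
    (B.hyp_mem ht _)
  · simp [ht]
  · simp

theorem bexL (B : Base ρ X H) {F : Fml Term true 1} {t : Term} {β : Idx}
    (hF : .bex (.con t) F ∈ Γ) (hβ : β.1 ∈ H ∅) (ht : inE t β ∈ Γ)
    (d : ∀ s, DerN ρ X H m
      (insert (inE s β) (insert (.and (.mem (.con s) (.con t)) (F.inst ![s])) Γ)) Δ)
    (h : m + 2 < n := by omega) : DerN ρ X H n Γ Δ := by
  rw [← Finset.insert_eq_of_mem hF]
  refine .bexL (B.memN n) (add_natCast_lt X h) (add_natCast_lt X h) hβ (B.idx_lt β n)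
    (fun s => B.cutE (m := 1) hβ (B.andL₁ (m := 0) (Finset.mem_insert_self _ _)
      (B.mem_level (t := t) ?_ ?_ 0)) (d s))
    (B.hyp_mem ht _)
  · simp [ht]
  · simp

theorem eallL (B : Base ρ X H) {F : Fml Term true 1} {p s t : Term} {β γ δ : Idx}
    (hF : .eall (.con s) (.con t) F ∈ Γ) (hβ : β.1 ∈ H ∅) (hγ : γ.1 ∈ H ∅) (hδ : δ.1 ∈ H ∅)
    (hs : inE s β ∈ Γ) (ht : inE t γ ∈ Γ) (hp : inE p δ ∈ Γ)
    (d : DerN ρ X H m (insert (.imp (.fn (.con p) (.con s) (.con t)) (F.inst ![p])) Γ) Δ)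
    (h : m < n := by omega) (h' : 1 < n := by omega) : DerN ρ X H n Γ Δ := by
  rw [← Finset.insert_eq_of_mem hF]
  have h₁ := add_natCast_lt X h'
  rcases le_total δ β with hl | hl
  · exact .eallL (B.memN n) (add_natCast_lt X h) h₁ h₁ h₁ hβ hγ hδ (B.idx_lt δ n)
      (le_add_of_le_left (le_max_of_le_left hl)) d (B.hyp_mem hs 1) (B.hyp_mem ht 1)
      (B.hyp_mem hp 1)
  · exact .eallL (B.memN n) (add_natCast_lt X h) h₁ h₁ h₁ hδ hγ hδ (B.idx_lt δ n)
      (le_add_of_le_left (le_max_left _ _)) d (B.raise hδ hs hl) (B.hyp_mem ht 1)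
      (B.hyp_mem hp 1)

theorem eexR (B : Base ρ X H) {F : Fml Term true 1} {p s t : Term} {β γ δ : Idx}
    (hβ : β.1 ∈ H ∅) (hγ : γ.1 ∈ H ∅) (hδ : δ.1 ∈ H ∅)
    (hs : inE s β ∈ Γ) (ht : inE t γ ∈ Γ) (hp : inE p δ ∈ Γ)
    (d : DerN ρ X H m Γ (some (.and (.fn (.con p) (.con s) (.con t)) (F.inst ![p]))))
    (h : m < n := by omega) (h' : 1 < n := by omega) :
    DerN ρ X H n Γ (some (.eex (.con s) (.con t) F)) := by
  have h₁ := add_natCast_lt X h'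
  rcases le_total δ β with hl | hl
  · exact .eexR (B.memN n) (add_natCast_lt X h) h₁ h₁ h₁ hβ hγ hδ (B.idx_lt δ n)
      (le_add_of_le_left (le_max_of_le_left hl)) d (B.hyp_mem hs 1) (B.hyp_mem ht 1)
      (B.hyp_mem hp 1)
  · exact .eexR (B.memN n) (add_natCast_lt X h) h₁ h₁ h₁ hδ hγ hδ (B.idx_lt δ n)
      (le_add_of_le_left (le_max_left _ _)) d (B.raise hδ hs hl) (B.hyp_mem ht 1)
      (B.hyp_mem hp 1)

theorem exp_le (B : Base ρ X H) (β γ : Idx) (n : ℕ) : max β.1 γ.1 + 2 ≤ X + (n : Ordinal.{0}) :=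
  ((add_lt_Om (max_lt β.2.2 γ.2.2) (natCast_lt_Om 2)).le.trans B.le).trans le_self_add

/-- As for bounded quantifiers, with the level of `p` now read off from `fun(p, s, t)` by the axiom
on function spaces. The same argument serves `eexL`. -/
theorem eallR (B : Base ρ X H) {F : Fml Term true 1} {s t : Term} {β γ δ : Idx}
    (hβ : β.1 ∈ H ∅) (hγ : γ.1 ∈ H ∅) (hδ : δ.1 ∈ H ∅) (e : δ.1 = max β.1 γ.1 + 2)
    (hs : inE s β ∈ Γ) (ht : inE t γ ∈ Γ)
    (d : ∀ p, DerN ρ X H m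
      (insert (inE p δ) (insert (.fn (.con p) (.con s) (.con t)) Γ)) (some (F.inst ![p])))
    (h : m + 2 < n := by omega) : DerN ρ X H n Γ (some (.eall (.con s) (.con t) F)) := by
  have h' := add_natCast_lt X h
  refine .eallR (B.memN n) h' h' h' hβ hγ (B.exp_le β γ n)
    (fun p => B.impR (m := m + 1) (B.cutE hδ (B.fn_level (s := s) (t := t) ?_ ?_ ?_ e 0) (d p)))
    (B.hyp_mem hs _) (B.hyp_mem ht _)
  · simp [hs]
  · simp [ht]
  · simp

theorem eexL (B : Base ρ X H) {F : Fml Term true 1} {s t : Term} {β γ δ : Idx}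
    (hF : .eex (.con s) (.con t) F ∈ Γ) (hβ : β.1 ∈ H ∅) (hγ : γ.1 ∈ H ∅) (hδ : δ.1 ∈ H ∅)
    (e : δ.1 = max β.1 γ.1 + 2) (hs : inE s β ∈ Γ) (ht : inE t γ ∈ Γ)
    (d : ∀ p, DerN ρ X H m (insert (inE p δ)
      (insert (.and (.fn (.con p) (.con s) (.con t)) (F.inst ![p])) Γ)) Δ)
    (h : m + 2 < n := by omega) : DerN ρ X H n Γ Δ := by
  rw [← Finset.insert_eq_of_mem hF]
  have h' := add_natCast_lt X h
  refine .eexL (B.memN n) h' h' h' hβ hγ (B.exp_le β γ n)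
    (fun p => B.cutE (m := 1) hδ (B.andL₁ (m := 0) (Finset.mem_insert_self _ _)
      (B.fn_level (s := s) (t := t) ?_ ?_ ?_ e 0)) (d p))
    (B.hyp_mem hs _) (B.hyp_mem ht _)
  · simp [hs]
  · simp [ht]
  · simp

theorem allL (B : Base ρ X H) {F : Fml Term true 1} {s : Term} {β : Idx}
    (hF : .all rfl F ∈ Γ) (hβ : β.1 ∈ H ∅) (hs : inE s β ∈ Γ)
    (d : DerN ρ X H m (insert (F.inst ![s]) Γ) Δ) (h : m + 3 < n := by omega) :
    DerN ρ X H n Γ Δ := by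
  rw [← Finset.insert_eq_of_mem hF]
  exact .allL (B.memN n) (add_natCast_add_three_lt X h) (add_natCast_add_three_lt X h)
    (B.idx_lt β n) hβ d (B.hyp_mem hs _)

theorem exR (B : Base ρ X H) {F : Fml Term true 1} {s : Term} {β : Idx}
    (hβ : β.1 ∈ H ∅) (d₁ : DerN ρ X H k Γ (some (inE s β)))
    (d : DerN ρ X H m Γ (some (F.inst ![s]))) (h : m + 3 < n := by omega)
    (h' : k + 3 < n := by omega) :
    DerN ρ X H n Γ (some (.ex rfl F)) :=
  .exR (B.memN n) (add_natCast_add_three_lt X h) (add_natCast_add_three_lt X h')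
    (B.idx_lt β n) hβ d d₁

theorem lt_add_three (B : Base ρ X H) (β : Idx) (m : ℕ) : β.1 < X + (m : Ordinal.{0}) + 3 :=
  (B.idx_lt β m).trans_le le_self_add

theorem allR (B : Base ρ X H) {F : Fml Term true 1}
    (d : ∀ (β : Idx) (s : Term), DerN ρ X (IKPE.ctl H {β.1}) m (insert (inE s β) Γ)
      (some (F.inst ![s])))
    (h : m + 3 < n := by omega) : DerN ρ X H n Γ (some (.all rfl F)) :=
  .allR (B.memN n) (fun _ => X + (m : Ordinal.{0}))
    (fun β => ⟨B.lt_add_three β m, add_natCast_add_three_lt X h⟩) d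

theorem exL (B : Base ρ X H) {F : Fml Term true 1} (hF : .ex rfl F ∈ Γ)
    (d : ∀ (β : Idx) (s : Term), DerN ρ X (IKPE.ctl H {β.1}) m
      (insert (F.inst ![s]) (insert (inE s β) Γ)) Δ)
    (h : m + 3 < n := by omega) : DerN ρ X H n Γ Δ := by
  rw [← Finset.insert_eq_of_mem hF]
  exact .exL (B.memN n) (fun _ => X + (m : Ordinal.{0}))
    (fun β => ⟨B.lt_add_three β m, add_natCast_add_three_lt X h⟩) d

end Base

/-! ### Identity sequents for arbitrary formulas -/

/-- Every name of `A` is assigned a level by the context. -/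
def Leveled (H : Set Ordinal.{0} → Set Ordinal.{0}) (Γ : Ctx) (N : Set Term) : Prop :=
  ∀ t ∈ N, ∃ β : Idx, β.1 ∈ H ∅ ∧ inE t β ∈ Γ

theorem Leveled.mono {H H' : Set Ordinal.{0} → Set Ordinal.{0}} {Γ Γ' : Ctx} {N N' : Set Term}
    (h : Leveled H Γ N) (hH : OpLe H H') (hΓ : Γ ⊆ Γ') (hN : N' ⊆ N) : Leveled H' Γ' N' :=
  fun t ht => by
    obtain ⟨β, hβ, hm⟩ := h t (hN ht)
    exact ⟨β, hH.mem hβ, hΓ hm⟩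

theorem Leveled.inst {H : Set Ordinal.{0} → Set Ordinal.{0}} {Γ Γ' : Ctx} {F : Fml Term true 1}
    (h : Leveled H Γ F.names) (hΓ : Γ ⊆ Γ') {s : Term} {β : Idx} (hβ : β.1 ∈ H ∅)
    (hs : inE s β ∈ Γ') : Leveled H Γ' (F.inst ![s]).names := fun t ht => by
  rcases F.names_inst s ht with rfl | ht
  · exact ⟨β, hβ, hs⟩
  · exact (h.mono (OpLe.refl H) hΓ subset_rfl) t ht

namespace Base

variable {ρ X : Ordinal.{0}}

/-- Each principal symbol is introduced on both sides, the right and left rules sharing one new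
term. The induction is on size, because `F.inst ![s]` is not a structural subformula of the
quantified formula. Levels of all parameters are assumed since the bounds of quantifiers need them.
The operator has to vary because unbounded quantifiers enlarge it by the level of the new term. The
factor `10` is a generous allowance per symbol. -/
theorem identity_aux : ∀ (n : ℕ) (A : Fml Term true 0), A.size = n →
    ∀ {H : Set Ordinal.{0} → Set Ordinal.{0}} {Γ : Ctx}, Base ρ X H → A ∈ Γ →
    Leveled H Γ A.names → DerN ρ X H (10 * A.size) Γ (some A) := by
  intro n
  induction n using Nat.strong_induction_on with
  | _ n ih =>
    intro A hn H Γ B hA hL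
    have ih' : ∀ (C : Fml Term true 0), C.size < A.size →
        ∀ {H : Set Ordinal.{0} → Set Ordinal.{0}} {Γ : Ctx}, Base ρ X H → C ∈ Γ →
        Leveled H Γ C.names → DerN ρ X H (10 * C.size) Γ (some C) :=
      fun C hC _ _ => ih _ (hn ▸ hC) C rfl
    clear ih hn
    have sub1 : ∀ {C : Fml Term true 0}, Γ ⊆ insert C Γ := by
      intro C; exact Finset.subset_insert _ _
    have sub2 : ∀ {C D : Fml Term true 0}, Γ ⊆ insert C (insert D Γ) := by
      intro C D; exact (Finset.subset_insert _ _).trans (Finset.subset_insert _ _)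
    have sub3 : ∀ {C D E : Fml Term true 0}, Γ ⊆ insert C (insert D (insert E Γ)) := by
      intro C D E; exact sub2.trans (Finset.subset_insert _ _)
    have sub4 : ∀ {C D E F : Fml Term true 0},
        Γ ⊆ insert C (insert D (insert E (insert F Γ))) := by
      intro C D E F; exact sub3.trans (Finset.subset_insert _ _)
    have hr := OpLe.refl H
    cases A with
    | mem s t =>
      cases s; cases t
      exact B.hyp_mem hA _
    | neg A =>
      simp only [Fml.size] at ih' ⊢
      exact B.negR (B.negL (m := 10 * A.size) (n := 10 * A.size + 1) (sub1 hA)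
        (ih' A (by omega) B (by simp) (hL.mono hr sub1 subset_rfl)))
    | and A C =>
      simp only [Fml.size, Fml.names] at ih' hL ⊢
      refine B.andL hA (m := 10 * A.size + 10 * C.size + 1) (B.andR
        (ih' A (by omega) B (by simp) (hL.mono hr sub2 Set.subset_union_left))
        (ih' C (by omega) B (by simp) (hL.mono hr sub2 Set.subset_union_right)))
    | or A C =>
      simp only [Fml.size, Fml.names] at ih' hL ⊢
      exact B.orL hA (m := 10 * A.size + 1) (k := 10 * C.size + 1)
        (B.orR₁ (ih' A (by omega) B (by simp) (hL.mono hr sub1 Set.subset_union_left)))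
        (B.orR₂ (ih' C (by omega) B (by simp) (hL.mono hr sub1 Set.subset_union_right)))
    | imp A C =>
      simp only [Fml.size, Fml.names] at ih' hL ⊢
      exact B.impR (m := 10 * A.size + 10 * C.size + 1) (B.impL (sub1 hA)
        (ih' C (by omega) B (by simp) (hL.mono hr sub2 Set.subset_union_right))
        (ih' A (by omega) B (by simp) (hL.mono hr sub1 Set.subset_union_left)))
    | ball t F =>
      cases t with | con t =>
      simp only [Fml.size, Fml.names, Tm.names] at ih' hL ⊢
      obtain ⟨β, hβ, ht⟩ := hL t (by simp)
      exact B.ballR (m := 10 * F.size + 4) hβ ht fun s =>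
        B.ballL (m := 10 * F.size + 1) (sub2 hA) hβ hβ (sub2 ht) (Finset.mem_insert_self _ _)
          (B.impL (m := 10 * F.size) (k := 0) (Finset.mem_insert_self _ _)
          (by
            simpa using ih' (F.inst ![s]) (by simp) B (by simp)
              ((hL.mono hr subset_rfl Set.subset_union_right).inst sub4 (s := s) hβ (by simp)))
          (B.hyp_mem (by simp) 0))
    | bex t F =>
      cases t with | con t =>
      simp only [Fml.size, Fml.names, Tm.names] at ih' hL ⊢
      obtain ⟨β, hβ, ht⟩ := hL t (by simp)
      exact B.bexL (m := 10 * F.size + 4) hA hβ ht fun s =>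
        B.andL (m := 10 * F.size + 2) (A := .mem (.con s) (.con t)) (C := F.inst ![s])
          (by simp)
          (B.bexR (m := 10 * F.size + 1) (s := s) hβ hβ (sub4 ht) (by simp)
          (B.andR (m := 0) (k := 10 * F.size) (B.hyp_mem (by simp) 0) (by
            simpa using ih' (F.inst ![s]) (by simp) B (by simp)
              ((hL.mono hr subset_rfl Set.subset_union_right).inst sub4 (s := s) hβ (by simp)))))
    | eall s t F =>
      cases s with | con s =>
      cases t with | con t =>
      simp only [Fml.size, Fml.names, Tm.names] at ih' hL ⊢
      obtain ⟨β, hβ, hs⟩ := hL s (by simp)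
      obtain ⟨γ, hγ, ht⟩ := hL t (by simp)
      obtain ⟨δ, hδ, e⟩ := B.exists_exp hβ hγ
      exact B.eallR (m := 10 * F.size + 4) hβ hγ hδ e hs ht fun p =>
        B.eallL (m := 10 * F.size + 1) (sub2 hA) hβ hγ hδ (sub2 hs) (sub2 ht)
          (Finset.mem_insert_self _ _)
          (B.impL (m := 10 * F.size) (k := 0) (Finset.mem_insert_self _ _)
          (by
            simpa using ih' (F.inst ![p]) (by simp) B (by simp)
              ((hL.mono hr subset_rfl Set.subset_union_right).inst sub4 (s := p) hδ (by simp)))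
          (B.hyp_fn (by simp) 0))
    | eex s t F =>
      cases s with | con s =>
      cases t with | con t =>
      simp only [Fml.size, Fml.names, Tm.names] at ih' hL ⊢
      obtain ⟨β, hβ, hs⟩ := hL s (by simp)
      obtain ⟨γ, hγ, ht⟩ := hL t (by simp)
      obtain ⟨δ, hδ, e⟩ := B.exists_exp hβ hγ
      exact B.eexL (m := 10 * F.size + 4) hA hβ hγ hδ e hs ht fun p =>
        B.andL (m := 10 * F.size + 2) (A := .fn (.con p) (.con s) (.con t)) (C := F.inst ![p])
          (by simp)
          (B.eexR (m := 10 * F.size + 1) (p := p) hβ hγ hδ (sub4 hs) (sub4 ht) (by simp)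
          (B.andR (m := 0) (k := 10 * F.size) (B.hyp_fn (by simp) 0) (by
            simpa using ih' (F.inst ![p]) (by simp) B (by simp)
              ((hL.mono hr subset_rfl Set.subset_union_right).inst sub4 (s := p) hδ (by simp)))))
    | all _ F =>
      simp only [Fml.size, Fml.names] at ih' hL ⊢
      refine B.allR (m := 10 * F.size + 4) fun β s => ?_
      have hH := B.op.subset_ctl β.singleton_subset
      have hβ : β.1 ∈ IKPE.ctl H {β.1} ∅ := B.op.mem_ctl β.singleton_subset rfl
      exact (B.ctl β).allL (m := 10 * F.size) (s := s) (sub1 hA) hβ (by simp) (by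
        simpa using ih' (F.inst ![s]) (by simp) (B.ctl β) (by simp)
          ((hL.mono hH subset_rfl subset_rfl).inst sub2 hβ (by simp)))
    | ex _ F =>
      simp only [Fml.size, Fml.names] at ih' hL ⊢
      refine B.exL (m := 10 * F.size + 4) hA fun β s => ?_
      have hH := B.op.subset_ctl β.singleton_subset
      have hβ : β.1 ∈ IKPE.ctl H {β.1} ∅ := B.op.mem_ctl β.singleton_subset rfl
      exact (B.ctl β).exR (m := 10 * F.size) (k := 0) (s := s) hβ ((B.ctl β).hyp_mem (by simp [inE]) 0) (by
        simpa using ih' (F.inst ![s]) (by simp) (B.ctl β) (by simp)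
          ((hL.mono hH subset_rfl subset_rfl).inst sub2 hβ (by simp)))

theorem identity {H : Set Ordinal.{0} → Set Ordinal.{0}} {Γ : Ctx} (B : Base ρ X H)
    {A : Fml Term true 0} (hA : A ∈ Γ) (hL : Leveled H Γ A.names) :
    DerN ρ X H (10 * A.size) Γ (some A) :=
  identity_aux _ A rfl B hA hL

end Base

/-! ### Set induction -/

/-- Progressiveness of `G`. -/
def Prog (G : Fml Term true 1) : Fml Term true 0 :=
  .all rfl (.imp (.ball (.bv 0) (G.ren ![0])) G)

theorem inst_prog (G : Fml Term true 1) (t : Term) :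
    (Fml.imp (.ball (.bv 0) (G.ren ![0])) G).inst ![t] =
      .imp (.ball (.con t) G) (G.inst ![t]) := by
  have h : (fun i : Fin 1 => (Tm.con (![t] i) : Tm Term 0)) = fun _ => Tm.con t := by
    funext i
    simp
  simp only [Fml.inst, Fml.sub, h, Tm.elim_bv]
  exact congrArg (fun C => Fml.imp (.ball (.con t) C) _) (G.ren_zero_sub t)

/-- Transfinite induction on the level `β`: elements of a set in `𝔼_{δ+1}` lie in `𝔼_δ`, so the
claim for `δ` provides the hypothesis of progressiveness at `t`. The operator and the term vary in
the induction, the former because of the `𝔼`-Lim rule. -/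
theorem der_of_prog {ρ : Ordinal.{0}} (hρ : Om ≤ ρ) (G : Fml Term true 1) (β : Idx) :
    ∀ {H : Set Ordinal.{0} → Set Ordinal.{0}} {Γ : Ctx}, IsOperator H → β.1 ∈ H ∅ → Prog G ∈ Γ →
      Leveled H Γ G.names → ∀ t : Term,
      Der ρ H (Om + ω ^ (1 + β.1)) (insert (inE t β) Γ) (some (G.inst ![t])) := by
  induction β using WellFoundedLT.induction with
  | _ β ih =>
    intro H Γ hH hβ hP hL t
    have hmem : ∀ {a : Ordinal.{0}}, a ∈ H ∅ → Om + ω ^ (1 + a) ∈ H ∅ := fun ha =>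
      hH.add_mem hH.Om_mem (hH.opow_mem (hH.add_mem hH.one_mem ha))
    by_cases hlim : Order.IsSuccPrelimit β.1
    -- This includes `β = 0`, where the rule has no premises.
    · refine .eLim (hmem hβ) (fun δ => Om + ω ^ (1 + δ.1)) hlim hβ (fun δ hδ => ?_) fun δ hδ => ?_
      · gcongr
        rw [opow_lt_opow_iff_right one_lt_omega0]
        gcongr
      · exact ih δ hδ (hH.ctl δ.singleton_subset) (hH.mem_ctl δ.singleton_subset rfl) hP
          (hL.mono (hH.subset_ctl δ.singleton_subset) subset_rfl subset_rfl) t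
    · obtain ⟨d, hd⟩ := Order.mem_range_succ_of_not_isSuccPrelimit hlim
      rw [Order.succ_eq_add_one] at hd
      have hdH : d ∈ H ∅ := hH.mem_of_add_one_mem (hd ▸ hβ)
      have hdβ : d < β.1 := hd ▸ lt_add_one d
      obtain ⟨δ, rfl⟩ : ∃ δ : Idx, δ.1 = d := ⟨hH.idx d hdH (hdβ.trans β.2.2), rfl⟩
      -- The height of the induction hypothesis becomes the new base, over which the successor step
      -- takes finitely many inferences.
      have B : Base ρ (Om + ω ^ (1 + δ.1)) H := ⟨hH, hmem hdH, le_self_add, hρ⟩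
      have sub2 : ∀ {C D E : Fml Term true 0}, Γ ⊆ insert C (insert D (insert E Γ)) := by
        intro C D E
        exact ((Finset.subset_insert _ _).trans (Finset.subset_insert _ _)).trans
          (Finset.subset_insert _ _)
      have key : DerN ρ (Om + ω ^ (1 + δ.1)) H (10 * G.size + 9) (insert (inE t β) Γ)
          (some (G.inst ![t])) := by
        refine B.allL (m := 10 * G.size + 5) (s := t) (Finset.mem_insert_of_mem hP) hβ (by simp) ?_
        rw [inst_prog]
        refine B.impL (m := 10 * G.size) (k := 4) (Finset.mem_insert_self _ _) ?_ ?_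
        · simpa using B.identity (A := G.inst ![t]) (by simp)
            (hL.inst sub2 (β := β) (s := t) hβ (by simp))
        · refine B.ballR (m := 1) (β := β) hβ (by simp) fun x => ?_
          have h0 : DerN ρ (Om + ω ^ (1 + δ.1)) H 0 (insert (inE x δ) Γ)
              (some (G.inst ![x])) := by
            have := ih δ hdβ hH hdH hP hL x
            rwa [DerN, Nat.cast_zero, add_zero]
          -- `ballR` offers only `x ∈ 𝔼_β`. The successor axiom improves this to `x ∈ 𝔼_δ`, where
          -- the induction hypothesis applies.
          refine B.cutE (m := 0) (k := 0) hdH (B.ax ((Ax.e7 Γ hd.symm x t).mono ?_) 0)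
            (B.mono h0 ?_ le_rfl)
          · intro C
            simp only [Finset.mem_insert]
            tauto
          · exact Finset.insert_subset_insert _ (sub2.trans (Finset.subset_insert _ _))
      refine Der.mono le_rfl key (OpLe.refl H) subset_rfl ?_ (hmem hβ)
      rw [add_assoc, ← hd]
      gcongr
      exact (opow_add_natCast_lt _ _).le

/-! ### Embedding -/

/-- The context bounds the term assigned to every variable. -/
def Bds (H : Set Ordinal.{0} → Set Ordinal.{0}) (s : ℕ → Term) (β : ℕ → Idx) (Θ : Ctx) : Prop :=
  ∀ v, (β v).1 ∈ H ∅ ∧ inE (s v) (β v) ∈ Θ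

/-- The context contains the instances of all formulas in `Γ`. -/
def Covers (s : ℕ → Term) (Γ : Finset (Fml ℕ true 0)) (Θ : Ctx) : Prop :=
  ∀ A ∈ Γ, A.map s ∈ Θ

section embedding

variable {H H' : Set Ordinal.{0} → Set Ordinal.{0}} {s : ℕ → Term} {β : ℕ → Idx} {Θ Θ' : Ctx}
  {Γ : Finset (Fml ℕ true 0)} {Δ : Option (Fml ℕ true 0)} {A : Fml ℕ true 0}

theorem Bds.mono (h : Bds H s β Θ) (hH : OpLe H H') (hΘ : Θ ⊆ Θ') : Bds H' s β Θ' :=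
  fun v => ⟨hH.mem (h v).1, hΘ (h v).2⟩

theorem Bds.insert (h : Bds H s β Θ) (C : Fml Term true 0) : Bds H s β (insert C Θ) :=
  h.mono (OpLe.refl H) (Finset.subset_insert _ _)

theorem Bds.update (h : Bds H s β Θ) (a : ℕ) {t : Term} {γ : Idx} (hγ : γ.1 ∈ H ∅)
    (ht : inE t γ ∈ Θ) : Bds H (Function.update s a t) (Function.update β a γ) Θ := fun v => by
  by_cases hv : v = a
  · subst hv
    simpa using ⟨hγ, ht⟩
  · simpa [hv] using h v

theorem Bds.leveled (h : Bds H s β Θ) {b : Bool} {n : ℕ} (F : Fml ℕ b n) :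
    Leveled H Θ (F.map s).names := fun t ht => by
  obtain ⟨v, -, rfl⟩ := F.names_map s ht
  exact ⟨β v, h v⟩

theorem Covers.mono (h : Covers s Γ Θ) (hΘ : Θ ⊆ Θ') : Covers s Γ Θ' := fun A hA => hΘ (h A hA)

theorem Covers.tail (h : Covers s (insert A Γ) Θ) : Covers s Γ Θ :=
  fun C hC => h C (Finset.mem_insert_of_mem hC)

theorem Covers.head (h : Covers s (insert A Γ) Θ) : A.map s ∈ Θ := h A (Finset.mem_insert_self _ _)

theorem Covers.cons (h : Covers s Γ Θ) (hA : A.map s ∈ Θ) : Covers s (insert A Γ) Θ := by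
  intro C hC
  rcases Finset.mem_insert.1 hC with rfl | hC
  exacts [hA, h C hC]

theorem Covers.insert (h : Covers s Γ Θ) (C : Fml Term true 0) : Covers s Γ (insert C Θ) :=
  h.mono (Finset.subset_insert _ _)

theorem Covers.push (h : Covers s Γ Θ) (A : Fml ℕ true 0) :
    Covers s (Insert.insert A Γ) (Insert.insert (A.map s) Θ) :=
  (h.insert _).cons (Finset.mem_insert_self _ _)

theorem map_update {b : Bool} {n : ℕ} {F : Fml ℕ b n} {a : ℕ} (h : a ∉ F.names) (t : Term) :
    F.map (Function.update s a t) = F.map s :=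
  F.map_congr fun _ hv => Function.update_of_ne (ne_of_mem_of_not_mem hv h) _ _

theorem map_inst_update {b : Bool} {F : Fml ℕ b 1} {a : ℕ} (h : a ∉ F.names) (t : Term) :
    (F.inst ![a]).map (Function.update s a t) = (F.map s).inst ![t] := by
  rw [Fml.map_inst_one, map_update h, Function.update_self]

theorem Covers.update (h : Covers s Γ Θ) {a : ℕ} (ha : ∀ A ∈ Γ, a ∉ A.names) (t : Term) :
    Covers (Function.update s a t) Γ Θ := fun A hA => by
  rw [map_update (ha A hA)]
  exact h A hA

theorem option_map_update {a : ℕ} (ha : ∀ A ∈ Δ, a ∉ A.names) (t : Term) :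
    Δ.map (Fml.map (Function.update s a t)) = Δ.map (Fml.map s) := by
  cases Δ with
  | none => rfl
  | some A => simp [map_update (ha A rfl)]

/-- The sequent `Γ ⇒ Δ` can be embedded with the bound `k`. -/
def Good (k : ℕ) (Γ : Finset (Fml ℕ true 0)) (Δ : Option (Fml ℕ true 0)) : Prop :=
  ∀ {H : Set Ordinal.{0} → Set Ordinal.{0}} {s : ℕ → Term} {β : ℕ → Idx} {Θ : Ctx},
    IsOperator H → Bds H s β Θ → Covers s Γ Θ →
    Der (Om + (k : Ordinal.{0})) H (Om * ω ^ (k : Ordinal.{0})) Θ (Δ.map (Fml.map s))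

/-- The number `n` may depend on everything, since all `Ω·ω^k + n` are below `Ω·ω^(k+1)`. The cut
rank is already raised to `Ω + (k + 1)` in the hypothesis. -/
theorem Good.step (k : ℕ)
    (h : ∀ {H : Set Ordinal.{0} → Set Ordinal.{0}} {s : ℕ → Term} {β : ℕ → Idx} {Θ : Ctx},
      Base (Om + ((k + 1 : ℕ) : Ordinal.{0})) (Om * ω ^ (k : Ordinal.{0})) H → Bds H s β Θ →
      Covers s Γ Θ → ∃ n, DerN (Om + ((k + 1 : ℕ) : Ordinal.{0})) (Om * ω ^ (k : Ordinal.{0})) H n Θ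
        (Δ.map (Fml.map s))) :
    ∃ k, Good k Γ Δ := by
  refine ⟨k + 1, fun {H s β Θ} hH hb hc => ?_⟩
  obtain ⟨n, d⟩ := h ⟨hH, hH.Om_mul_opow_mem k, Om_le_Om_mul_opow k, le_self_add⟩ hb hc
  exact Der.mono le_rfl d (OpLe.refl H) subset_rfl (Om_mul_opow_add_lt k n).le
    (hH.Om_mul_opow_mem (k + 1))

theorem Good.use {k k' : ℕ} (g : Good k Γ Δ) (hk : k ≤ k')
    (B : Base (Om + ((k' + 1 : ℕ) : Ordinal.{0})) (Om * ω ^ (k' : Ordinal.{0})) H)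
    (hb : Bds H s β Θ) (hc : Covers s Γ Θ) :
    DerN (Om + ((k' + 1 : ℕ) : Ordinal.{0})) (Om * ω ^ (k' : Ordinal.{0})) H 0 Θ
      (Δ.map (Fml.map s)) := by
  refine Der.mono ?_ (g B.op hb hc) (OpLe.refl H) subset_rfl ?_ (B.memN 0)
  · gcongr
    omega
  · rw [Nat.cast_zero, add_zero, Om_mul_opow, Om_mul_opow]
    refine opow_le_opow_right omega0_pos ?_
    gcongr

/-- The rank is computed from the finitary formula and the levels of its variables, which the
context provides. Its size alone then decides whether the cut is allowed. -/
theorem Base.cutF {ρ X : Ordinal.{0}} (B : Base ρ X H) (hb : Bds H s β Θ) (A : Fml ℕ true 0)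
    (hρ : Om + ((2 * A.size : ℕ) : Ordinal.{0}) ≤ ρ) {m k n : ℕ} {Δ : Option (Fml Term true 0)}
    (d₀ : DerN ρ X H m Θ (some (A.map s))) (d₁ : DerN ρ X H k (Insert.insert (A.map s) Θ) Δ)
    (h : m < n := by omega) (h' : k < n := by omega) : DerN ρ X H n Θ Δ := by
  obtain ⟨N, A', v, rfl, hs⟩ := A.exists_fin
  rw [Fml.map_map] at d₀ d₁
  refine .cut (B.memN n) A' (s ∘ v) (β ∘ v) (add_natCast_lt X h') (add_natCast_lt X h)
    (add_natCast_lt X h) ?_ (fun i => (hb _).1) d₁ d₀ fun i => B.hyp_mem (hb _).2 m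
  rw [← hs] at hρ
  exact (A'.rank_lt fun i => (β (v i)).2.2).trans_le hρ

end embedding

/-! ### Derivations of the axioms of `IKP(𝓔)` -/

section axioms

variable {ρ X : Ordinal.{0}} {H : Set Ordinal.{0} → Set Ordinal.{0}} {s : ℕ → Term} {β : ℕ → Idx}
  {Θ : Ctx}

theorem Base.der_extensionality (B : Base ρ X H) (Θ : Ctx) (F : Fml Term false 1) (a b : Term) :
    DerN ρ X H 3 Θ (some (.imp (.and (.eq (.con a) (.con b)) (F.lift.inst ![a]))
      (F.lift.inst ![b]))) := by
  refine B.impR (m := 2) (B.andL (m := 0) (Finset.mem_insert_self _ _)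
    (B.ax ((Ax.e3 Θ F ![a] ![b]).mono ?_) 0))
  intro C
  simp only [Finset.mem_insert, Finset.mem_union, Finset.mem_image, Finset.mem_univ, true_and,
    Fin.exists_fin_one, Matrix.cons_val_fin_one]
  rintro (h | h | h)
  · exact Or.inl h
  · exact Or.inr (Or.inl h.symm)
  · exact Or.inr (Or.inr (Or.inr h))

theorem Base.der_pair (B : Base ρ X H) {a b : Term} {α β : Idx} (hα : α.1 ∈ H ∅)
    (hβ : β.1 ∈ H ∅) (ha : inE a α ∈ Θ) (hb : inE b β ∈ Θ) :
    DerN ρ X H 6 Θ (some (.ex rfl (.and (.mem (.con a) (.bv 0)) (.mem (.con b) (.bv 0))))) := by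
  -- The witness is `𝔼_γ` for the larger `γ` of the two levels, itself an element of `𝔼_{γ+1}`.
  obtain ⟨γ, hγ, h₁, h₂⟩ : ∃ γ : Idx, γ.1 ∈ H ∅ ∧ α ≤ γ ∧ β ≤ γ := by
    rcases le_total α β with h | h
    exacts [⟨β, hβ, h, le_rfl⟩, ⟨α, hα, le_rfl, h⟩]
  obtain ⟨δ, hδ, e⟩ := B.exists_succ hγ
  have hlt : γ < δ := by
    rw [← Subtype.coe_lt_coe, e]
    exact lt_add_one _
  exact B.exR (m := 2) (k := 0) (s := .E γ) hδ (B.ax (.e4 _ hlt) 0)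
    (B.andR (m := 1) (k := 1) (B.raise hγ ha h₁) (B.raise hγ hb h₂))

theorem Base.der_union (B : Base ρ X H) {a : Term} {α : Idx} (hα : α.1 ∈ H ∅)
    (ha : inE a α ∈ Θ) :
    DerN ρ X H 10 Θ
      (some (.ex rfl (.ball (.con a) (.ball (.bv 0) (.mem (.bv 0) (.bv 2)))))) := by
  obtain ⟨δ, hδ, e⟩ := B.exists_succ hα
  have hlt : α < δ := by
    rw [← Subtype.coe_lt_coe, e]
    exact lt_add_one _
  refine B.exR (m := 6) (k := 0) (s := .E α) hδ (B.ax (.e4 _ hlt) 0) ?_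
  change DerN ρ X H 6 Θ (some (.ball (.con a) (.ball (.bv 0) (.mem (.bv 0) (.con (.E α))))))
  refine B.ballR (m := 3) hα ha fun y => ?_
  change DerN ρ X H 3 _ (some (.ball (.con y) (.mem (.bv 0) (.con (.E α)))))
  exact B.ballR (m := 0) hα (Finset.mem_insert_self _ _) fun z =>
    B.hyp_mem (s := z) (t := .E α) (Finset.mem_insert_self _ _) 0

/-- The witness is `𝔼_ω`: it contains `𝔼_0`, and as `ω` is a limit each of its elements lies in some
`𝔼_d` with `d < ω`. -/
theorem Base.der_infinity (B : Base ρ X H) (Θ : Ctx) :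
    DerN ρ X H 20 Θ (some (.ex rfl (.and
        (.bex (.bv 0) (.mem (.bv 0) (.bv 1)))
        (.ball (.bv 0) (.bex (.bv 1) (.mem (.bv 1) (.bv 0))))))) := by
  obtain ⟨o, ho, eo⟩ : ∃ o : Idx, o.1 ∈ H ∅ ∧ o.1 = ω :=
    ⟨B.op.idx ω B.op.omega0_mem omega0_lt_Om, B.op.omega0_mem, rfl⟩
  obtain ⟨z, hz, ez⟩ : ∃ z : Idx, z.1 ∈ H ∅ ∧ z.1 = 0 :=
    ⟨B.op.idx 0 B.op.zero_mem' Om_pos, B.op.zero_mem', rfl⟩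
  obtain ⟨δ, hδ, e⟩ := B.exists_succ ho
  have hlt : o < δ := by
    rw [← Subtype.coe_lt_coe, e]
    exact lt_add_one _
  have hzo : z < o := by
    rw [← Subtype.coe_lt_coe, ez, eo]
    exact omega0_pos
  refine B.exR (m := 16) (k := 0) (s := .E o) hδ (B.ax (.e4 _ hlt) 0) ?_
  -- The level of the witness is put into the context, where the bounded quantifier lemmas look for
  -- it.
  refine B.cutE (s := .E o) (m := 0) (k := 15) hδ (B.ax (.e4 _ hlt) 0) ?_
  change DerN ρ X H 15 _ (some (.and
        (.bex (.con (.E o)) (.mem (.bv 0) (.con (.E o))))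
        (.ball (.con (.E o)) (.bex (.con (.E o)) (.mem (.bv 1) (.bv 0))))))
  refine B.andR (m := 14) (k := 14) ?_ ?_
  · refine B.cutE (s := .E z) (m := 0) (k := 13) ho (B.ax (.e4 _ hzo) 0) ?_
    refine B.bexR (m := 12) (s := .E z) hδ ho (by simp) (by simp) ?_
    exact B.andR (m := 0) (k := 0) (B.ax (.e4 _ hzo) 0) (B.ax (.e4 _ hzo) 0)
  · refine B.ballR (m := 5) (β := δ) hδ (by simp) fun y => ?_
    change DerN ρ X H 5 _ (some (.bex (.con (.E o)) (.mem (.con y) (.bv 0))))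
    set Ξ := insert (inE y δ) (insert (inE y o) (insert (inE (.E o) δ) Θ)) with hΞ
    have hy : inE y o ∈ Ξ := by simp [hΞ]
    have ho' : inE (.E o) δ ∈ Ξ := by simp [hΞ]
    have : Der ρ H (X + ((5 : ℕ) : Ordinal.{0})) (insert (inE y o) Ξ)
        (some (.bex (.con (.E o)) (.mem (.con y) (.bv 0)))) := by
      -- By `𝔼`-Lim, `y ∈ 𝔼_ω` splits into the cases `y ∈ 𝔼_d`, and in each of them `𝔼_d` is the
      -- required element.
      refine .eLim (B.memN 5) (fun _ => X + ((4 : ℕ) : Ordinal.{0})) ?_ ho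
        (fun _ _ => add_natCast_lt X (by omega)) fun d hd => ?_
      · rw [eo]
        exact isSuccLimit_omega0.isSuccPrelimit
      · have B' := B.ctl d
        have hH := B.op.subset_ctl d.singleton_subset
        refine B'.cutE (m := 0) (k := 3) (s := .E d) (OpLe.mem hH ho) (B'.ax (.e4 _ hd) 0) ?_
        refine B'.bexR (m := 2) (s := .E d) (OpLe.mem hH hδ) (OpLe.mem hH ho)
          (Finset.mem_insert_of_mem (Finset.mem_insert_of_mem ho')) (by simp) ?_
        exact B'.andR (m := 0) (k := 0) (B'.ax (.e4 _ hd) 0)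
          (B'.hyp_mem (s := y) (t := .E d) (Finset.mem_insert_of_mem
            (Finset.mem_insert_self _ _)) 0)
    rwa [Finset.insert_eq_of_mem hy] at this

theorem Base.der_exponentiation (B : Base ρ X H) {a b : Term} {α β : Idx} (hα : α.1 ∈ H ∅)
    (hβ : β.1 ∈ H ∅) (ha : inE a α ∈ Θ) (hb : inE b β ∈ Θ) :
    DerN ρ X H 7 Θ (some (.ex rfl (.eall (.con a) (.con b) (.mem (.bv 0) (.bv 1))))) := by
  obtain ⟨γ, hγ, eγ⟩ := B.exists_exp hα hβ
  obtain ⟨δ, hδ, e⟩ := B.exists_succ hγ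
  have hlt : γ < δ := by
    rw [← Subtype.coe_lt_coe, e]
    exact lt_add_one _
  refine B.exR (m := 3) (k := 0) (s := .E γ) hδ (B.ax (.e4 _ hlt) 0) ?_
  change DerN ρ X H 3 Θ (some (.eall (.con a) (.con b) (.mem (.bv 0) (.con (.E γ)))))
  exact B.eallR (m := 0) hα hβ hγ eγ ha hb fun p =>
    B.hyp_mem (s := p) (t := .E γ) (Finset.mem_insert_self _ _) 0

theorem Bds.exists_bound (hH : IsOperator H) (hb : Bds H s β Θ) (S : Finset ℕ) :
    ∃ γ : Idx, γ.1 ∈ H ∅ ∧ ∀ v ∈ S, β v ≤ γ := by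
  induction S using Finset.induction_on with
  | empty => exact ⟨hH.idx 0 hH.zero_mem' Om_pos, hH.zero_mem', by simp⟩
  | insert a S _ ih =>
    obtain ⟨γ, hγ, h⟩ := ih
    rcases le_total (β a) γ with hl | hl
    · refine ⟨γ, hγ, fun v hv => ?_⟩
      rcases Finset.mem_insert.1 hv with rfl | hv
      exacts [hl, h v hv]
    · refine ⟨β a, (hb a).1, fun v hv => ?_⟩
      rcases Finset.mem_insert.1 hv with rfl | hv
      exacts [le_rfl, (h v hv).trans hl]

theorem inst_separation (G : Fml Term true 1) (a t : Term) :
    (Fml.and (.ball (.bv 0) (.and (.mem (.bv 0) (.con a)) (G.ren ![0])))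
      (.ball (.con a) (.imp (G.ren ![0]) (.mem (.bv 0) (.bv 1)))) : Fml Term true 1).inst ![t] =
    .and (.ball (.con t) (.and (.mem (.bv 0) (.con a)) G))
      (.ball (.con a) (.imp G (.mem (.bv 0) (.con t)))) := by
  have h : (fun i : Fin 1 => (Tm.con (![t] i) : Tm Term 0)) = fun _ => Tm.con t := by
    funext i
    simp
  simp only [Fml.inst, Fml.sub, h, Tm.elim_bv]
  exact congrArg (fun C : Fml Term true 1 => Fml.and
    (.ball (.con t) (.and (.mem (.bv 0) (.con a)) C))
    (.ball (.con a) (.imp C (.mem (.bv 0) (.con t))))) (G.ren_zero_sub t)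

theorem Base.der_separation (B : Base ρ X H) (hb : Bds H s β Θ) (a : ℕ) (A : Fml ℕ false 1) :
    DerN ρ X H 10 Θ (some (.ex rfl (.and
        (.ball (.bv 0) (.and (.mem (.bv 0) (.con (s a))) ((A.map s).lift.ren ![0])))
        (.ball (.con (s a)) (.imp ((A.map s).lift.ren ![0]) (.mem (.bv 0) (.bv 1))))))) := by
  -- The separation term inherits any common bound `γ` for the levels of `s a` and of the parameters
  -- of `A`.
  obtain ⟨N, A', v, hA, -⟩ := A.exists_fin
  obtain ⟨γ, hγ, hle⟩ := hb.exists_bound B.op (insert a (Finset.univ.image v))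
  have hlev : ∀ n, DerN ρ X H n Θ (some (inE (.sep (s a) (A.map s)) γ)) := fun n => by
    rw [hA, Fml.map_map]
    refine B.ax ((Ax.e11 Θ A' (s a) (s ∘ v) (β := β a) (γ := γ) (α := β ∘ v)
      (hle a (by simp)) fun i => hle _ (by simp)).mono ?_) n
    intro C
    simp only [Finset.mem_insert, Finset.mem_union, Finset.mem_image, Finset.mem_univ, true_and]
    rintro (rfl | ⟨i, rfl⟩ | h)
    exacts [(hb a).2, (hb _).2, h]
  generalize A.map s = F at hlev
  refine B.exR (m := 6) (k := 0) (s := .sep (s a) F) hγ (hlev 0) ?_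
  refine B.cutE (m := 0) (k := 5) hγ (hlev 0) ?_
  rw [inst_separation]
  refine B.andR (m := 3) (k := 4) ?_ ?_
  · refine B.ballR (m := 0) hγ (Finset.mem_insert_self _ _) fun x => ?_
    refine B.ax ((Ax.e9 Θ x (s a) F).mono ?_) 0
    exact (Finset.insert_subset_insert _ (Finset.subset_insert _ _)).trans
      (Finset.subset_insert _ _)
  · refine B.ballR (m := 1) (hb a).1 (Finset.mem_insert_of_mem (hb a).2) fun x => ?_
    change DerN ρ X H 1 _ (some (.imp (F.lift.inst ![x]) (.mem (.con x) (.con (.sep (s a) F)))))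
    refine B.impR (m := 0) (B.ax ((Ax.e8 Θ x (s a) F).mono ?_) 0)
    intro C
    simp only [Finset.mem_insert]
    tauto

/-- The only unbounded quantifier of the hypothesis of Collection is `∃ y`. Restricting it to `z`
yields the conclusion literally, since the `Δ₀^𝓔`-matrix is unaffected by relativization. -/
theorem rel_collection (a : Term) (G : Fml Term false 2) :
    (Fml.ex rfl (((Fml.ball (.con a) (.ex rfl (G.lift.ren ![1, 0])) : Fml Term true 0).ren
      (Fin.succ : Fin 0 → Fin 1)).rel (.bv 0)) : Fml Term true 0) =
    .ex rfl (.ball (.con a) (.bex (.bv 1) (G.lift.ren ![1, 0]))) := by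
  change Fml.ex rfl (.ball (.con a) (.bex (.bv 1) (((G.lift.ren ![1, 0] : Fml Term true 2).sub
    (Tm.up (Tm.up (Tm.elim Tm.con fun i : Fin 0 => Tm.var i.succ)))).rel (.bv 2)))) = _
  rw [Fml.ren_lift, ← Fml.lift_sub, Fml.rel_lift, Fml.ren_lift]
  congr 4
  rw [Fml.ren, Fml.ren, Fml.sub_sub]
  refine G.sub_eq_sub (fun t => by simp) fun i => ?_
  fin_cases i <;> rfl

/-- The hypothesis `P` is a `Σ^𝓔`-formula, so reflection applies to `P ⇒ P`. -/
theorem Base.der_collection (B : Base ρ X H) (hb : Bds H s β Θ) (a : ℕ) (F : Fml ℕ false 2) :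
    ∃ n, DerN ρ X H n Θ (some (.imp
        (.ball (.con (s a)) (.ex rfl ((F.map s).lift.ren ![1, 0])))
        (.ex rfl (.ball (.con (s a)) (.bex (.bv 1) ((F.map s).lift.ren ![1, 0])))))) := by
  set P : Fml Term true 0 := .ball (.con (s a)) (.ex rfl ((F.map s).lift.ren ![1, 0])) with hP
  have hL : Leveled H Θ P.names := by
    have := hb.leveled (Fml.ball (.con a) (.ex rfl (F.lift.ren ![1, 0])) : Fml ℕ true 0)
    rwa [Fml.map_ball, Fml.map_ex, Fml.map_ren, Fml.map_lift] at this
  have hS : SigmaPi true P := by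
    rw [hP, Fml.ren_lift]
    exact .ball (.ex (.delta _))
  have d := B.identity (Γ := insert P Θ) (Finset.mem_insert_self _ _)
    (hL.mono (OpLe.refl H) (Finset.subset_insert _ _) subset_rfl)
  refine ⟨10 * P.size + 3, B.impR (m := 10 * P.size + 2) ?_⟩
  have := Der.sigmaRef (B.memN (10 * P.size + 2)) hS ?_ ?_ d
  · rwa [hP, rel_collection, ← hP] at this
  · rw [Nat.cast_add, ← add_assoc]
    have h := add_natCast_lt (X + ((10 * P.size : ℕ) : Ordinal.{0})) (show 1 < 2 by omega)
    rwa [Nat.cast_one] at h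
  · exact B.le.trans_lt (by simpa using add_natCast_lt X (show 0 < 10 * P.size + 2 by omega))

theorem der_setInduction {ρ : Ordinal.{0}} (hρ : Om ≤ ρ) (hH : IsOperator H) (G : Fml Term true 1)
    (hL : Leveled H Θ G.names) :
    Der ρ H (Om * ω ^ ((1 : ℕ) : Ordinal.{0})) Θ (some (.imp (Prog G) (.all rfl G))) := by
  have hm : Om + Om ∈ H ∅ := hH.add_mem hH.Om_mem hH.Om_mem
  refine .impR (hH.Om_mul_opow_mem 1) (α₀ := Om + Om) (by simpa using Om_add_Om_add_lt 0) ?_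
  -- The heights depend on `β`, but they stay below `Ω + Ω` even with three added; the implication
  -- then fits below `Ω·ω`.
  refine .allR hm (fun β => Om + ω ^ (1 + β.1)) (fun β => ⟨?_, ?_⟩) fun β t => ?_
  · exact (lt_Om_add_opow β.2.2).trans_le le_self_add
  · exact_mod_cast Om_add_opow_lt β.2.2 3
  · exact der_of_prog hρ G β (hH.ctl β.singleton_subset)
      (hH.mem_ctl β.singleton_subset rfl) (Finset.mem_insert_self _ _)
      (hL.mono (hH.subset_ctl β.singleton_subset) (Finset.subset_insert _ _) subset_rfl) t

end axioms

/-! ### Induction on finitary derivations -/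

theorem Bds.ctl {H : Set Ordinal.{0} → Set Ordinal.{0}} {s : ℕ → Term} {β : ℕ → Idx} {Θ : Ctx}
    (h : Bds H s β Θ) (hH : IsOperator H) (a : ℕ) (t : Term) (γ : Idx) :
    Bds (ctl H {γ.1}) (Function.update s a t) (Function.update β a γ) (Insert.insert (inE t γ) Θ) :=
  ((h.mono (hH.subset_ctl γ.singleton_subset) (Finset.subset_insert _ _)).update a
    (hH.mem_ctl γ.singleton_subset rfl) (Finset.mem_insert_self _ _))

theorem Bds.leveled_inst {H : Set Ordinal.{0} → Set Ordinal.{0}} {s : ℕ → Term} {β : ℕ → Idx}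
    {Θ : Ctx} (h : Bds H s β Θ) (F : Fml ℕ true 1) {t : Term} {γ : Idx} (hγ : γ.1 ∈ H ∅)
    (ht : inE t γ ∈ Θ) : Leveled H Θ ((F.map s).inst ![t]).names :=
  (h.leveled F).inst subset_rfl hγ ht

theorem natCast_rank_le {ρ : Ordinal.{0}} {m k : ℕ} (h : m ≤ k)
    (hρ : Om + ((k + 1 : ℕ) : Ordinal.{0}) ≤ ρ) : Om + (m : Ordinal.{0}) ≤ ρ :=
  le_trans (by gcongr; omega) hρ

theorem Prov.good {Γ : Finset (Fml ℕ true 0)} {Δ : Option (Fml ℕ true 0)} (h : Prov Γ Δ) :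
    ∃ k, Good k Γ Δ := by
  induction h with
  | logical Γ A =>
    refine Good.step 0 fun {H s β Θ} B hb hc => ⟨0, ?_⟩
    have h := hc.head
    simp only [Option.map_some, Fml.map_lift] at h ⊢
    exact B.hyp_lift h 0
  | extensionality Γ a b F =>
    refine Good.step 0 fun {H s β Θ} B hb hc => ⟨3, ?_⟩
    simpa only [Option.map_some, Fml.map_imp, Fml.map_and, Fml.map_eq_con, Fml.map_inst_one,
      Fml.map_lift] using B.der_extensionality Θ (F.map s) (s a) (s b)
  | pair Γ a b =>
    refine Good.step 0 fun {H s β Θ} B hb hc => ⟨6, ?_⟩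
    exact B.der_pair (hb a).1 (hb b).1 (hb a).2 (hb b).2
  | union Γ a =>
    refine Good.step 0 fun {H s β Θ} B hb hc => ⟨10, ?_⟩
    exact B.der_union (hb a).1 (hb a).2
  | infinity Γ =>
    exact Good.step 0 fun {H s β Θ} B hb hc => ⟨20, B.der_infinity Θ⟩
  | separation Γ a A =>
    refine Good.step 0 fun {H s β Θ} B hb hc => ⟨10, ?_⟩
    have := B.der_separation hb a A
    simp only [Option.map_some, Fml.map_ex, Fml.map_and, Fml.map_ball, Fml.map_ball_bv,
      Fml.map_imp, Fml.map_ren, Fml.map_lift]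
    exact this
  | collection Γ a F =>
    refine Good.step 0 fun {H s β Θ} B hb hc => ?_
    obtain ⟨n, d⟩ := B.der_collection hb a F
    refine ⟨n, ?_⟩
    simpa only [Option.map_some, Fml.map_ex, Fml.map_and, Fml.map_ball, Fml.map_bex_bv,
      Fml.map_imp, Fml.map_ren, Fml.map_lift] using d
  | setInduction Γ G =>
    refine ⟨1, fun {H s β Θ} hH hb hc => ?_⟩
    have := der_setInduction (ρ := Om + ((1 : ℕ) : Ordinal.{0})) le_self_add hH (G.map s)
      (hb.leveled G)
    simpa only [Option.map_some, Fml.map_imp, Fml.map_all, Fml.map_ball_bv, Fml.map_ren, Prog]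
      using this
  | exponentiation Γ a b =>
    refine Good.step 0 fun {H s β Θ} B hb hc => ⟨7, ?_⟩
    exact B.der_exponentiation (hb a).1 (hb b).1 (hb a).2 (hb b).2
  | andL₁ _ ih =>
    obtain ⟨k, g⟩ := ih
    exact Good.step k fun {H s β Θ} B hb hc => ⟨1, B.andL₁ hc.head
      (g.use le_rfl B (hb.insert _) (hc.tail.push _))⟩
  | andL₂ _ ih =>
    obtain ⟨k, g⟩ := ih
    exact Good.step k fun {H s β Θ} B hb hc => ⟨1, B.andL₂ hc.head
      (g.use le_rfl B (hb.insert _) (hc.tail.push _))⟩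
  | andR _ _ ih₀ ih₁ =>
    obtain ⟨k₀, g₀⟩ := ih₀
    obtain ⟨k₁, g₁⟩ := ih₁
    exact Good.step (max k₀ k₁) fun {H s β Θ} B hb hc => ⟨1, B.andR
      (g₀.use (le_max_left _ _) B hb hc) (g₁.use (le_max_right _ _) B hb hc)⟩
  | orL _ _ ih₀ ih₁ =>
    obtain ⟨k₀, g₀⟩ := ih₀
    obtain ⟨k₁, g₁⟩ := ih₁
    exact Good.step (max k₀ k₁) fun {H s β Θ} B hb hc => ⟨1, B.orL hc.head
      (g₀.use (le_max_left _ _) B (hb.insert _) (hc.tail.push _))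
      (g₁.use (le_max_right _ _) B (hb.insert _) (hc.tail.push _))⟩
  | orR₁ _ ih =>
    obtain ⟨k, g⟩ := ih
    exact Good.step k fun {H s β Θ} B hb hc => ⟨1, B.orR₁ (g.use le_rfl B hb hc)⟩
  | orR₂ _ ih =>
    obtain ⟨k, g⟩ := ih
    exact Good.step k fun {H s β Θ} B hb hc => ⟨1, B.orR₂ (g.use le_rfl B hb hc)⟩
  | negL _ ih =>
    obtain ⟨k, g⟩ := ih
    exact Good.step k fun {H s β Θ} B hb hc => ⟨1, B.negL hc.head (g.use le_rfl B hb hc.tail)⟩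
  | negR _ ih =>
    obtain ⟨k, g⟩ := ih
    exact Good.step k fun {H s β Θ} B hb hc => ⟨1, B.negR
      (g.use le_rfl B (hb.insert _) (hc.push _))⟩
  | bot _ ih =>
    obtain ⟨k, g⟩ := ih
    exact Good.step k fun {H s β Θ} B hb hc => ⟨1, B.bot (g.use le_rfl B hb hc)⟩
  | impL _ _ ih₀ ih₁ =>
    obtain ⟨k₀, g₀⟩ := ih₀
    obtain ⟨k₁, g₁⟩ := ih₁
    exact Good.step (max k₀ k₁) fun {H s β Θ} B hb hc => ⟨1, B.impL hc.head
      (g₀.use (le_max_left _ _) B (hb.insert _) (hc.tail.push _))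
      (g₁.use (le_max_right _ _) B hb hc.tail)⟩
  | impR _ ih =>
    obtain ⟨k, g⟩ := ih
    exact Good.step k fun {H s β Θ} B hb hc => ⟨1, B.impR
      (g.use le_rfl B (hb.insert _) (hc.push _))⟩
  | @bexL Γ Δ F a b hf _ ih =>
    obtain ⟨k, g⟩ := ih
    refine Good.step k fun {H s β Θ} B hb hc => ⟨3, ?_⟩
    have hF := hf.1 _ (Finset.mem_insert_self _ _)
    simp only [Fml.names, Tm.names, Set.mem_union, Set.mem_singleton_iff, not_or] at hF
    have hh := hc.head
    rw [Fml.map_bex] at hh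
    refine B.bexL (m := 0) hh (hb b).1 (hb b).2 fun t => ?_
    -- The eigenvariable `a` is reassigned to `t`. By freshness the side formulas and `b` keep their
    -- instances, while the minor formula becomes the one for `t`.
    have hc' := (((hc.tail.insert (.and (.mem (.con t) (.con (s b))) ((F.map s).inst ![t]))).insert
      (inE t (β b))).update (fun A hA => hf.1 A (Finset.mem_insert_of_mem hA)) t).cons
      (A := .and (.mem (.con a) (.con b)) (F.inst ![a])) (by
        simp [map_inst_update hF.2, Function.update_of_ne (Ne.symm hF.1), -Fml.map_inst])
    have := g.use le_rfl B (((hb.insert _).insert _).update a (hb b).1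
      (Finset.mem_insert_self _ _)) hc'
    rwa [option_map_update hf.2] at this
  | @bexR Γ F a b _ ih =>
    obtain ⟨k, g⟩ := ih
    refine Good.step k fun {H s β Θ} B hb hc => ⟨2, ?_⟩
    have := g.use le_rfl B hb hc
    simp only [Option.map_some, Fml.map_and, Fml.map_mem_con, Fml.map_inst_one, Fml.map_bex]
      at this ⊢
    exact B.bexR (hb b).1 (hb a).1 (hb b).2 (hb a).2 this
  | @ballL Γ Δ F a b _ ih =>
    obtain ⟨k, g⟩ := ih
    refine Good.step k fun {H s β Θ} B hb hc => ⟨2, ?_⟩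
    have := g.use le_rfl B (hb.insert _) (hc.tail.push _)
    have hh := hc.head
    simp only [Fml.map_imp, Fml.map_mem_con, Fml.map_inst_one, Fml.map_ball] at this hh
    exact B.ballL hh (hb b).1 (hb a).1 (hb b).2 (hb a).2 this
  | @ballR Γ F a b hf _ ih =>
    obtain ⟨k, g⟩ := ih
    -- The induction hypothesis needs a level for `t`, which is available only once `t ∈ s b` is in
    -- the context. It yields the whole implication there, which is then cut against `t ∈ s b` to
    -- obtain `F(t)`. The maximum makes room for the rank of this cut.
    refine Good.step (max k (2 * (Fml.imp (.mem (.con a) (.con b)) (F.inst ![a])).size))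
      fun {H s β Θ} B hb hc => ⟨10 * F.size + 5, ?_⟩
    have hF := hf.2 _ rfl
    simp only [Fml.names, Tm.names, Set.mem_union, Set.mem_singleton_iff, not_or] at hF
    rw [Option.map_some, Fml.map_ball]
    refine B.ballR (m := 10 * F.size + 2) (hb b).1 (hb b).2 fun t => ?_
    have hb' := ((hb.insert (.mem (.con t) (.con (s b)))).insert (inE t (β b))).update a (hb b).1
      (Finset.mem_insert_self _ _)
    have d := g.use (le_max_left _ _) B hb' (((hc.insert _).insert _).update hf.1 t)
    refine B.cutF hb' _ (natCast_rank_le (le_max_right _ _) le_rfl) d (k := 10 * F.size + 1) ?_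
    simp only [Fml.map_imp, Fml.map_mem_con, map_inst_update hF.2, Function.update_self,
      Function.update_of_ne (Ne.symm hF.1)]
    refine B.impL (m := 10 * F.size) (k := 0) (Finset.mem_insert_self _ _) ?_
      (B.hyp_mem (by simp) 0)
    simpa using B.identity (A := (F.map s).inst ![t]) (by simp)
      (((((hb.insert _).insert _).insert _).insert _).leveled_inst F (hb b).1 (by simp))
  | @exL Γ Δ F a hf _ ih =>
    obtain ⟨k, g⟩ := ih
    refine Good.step k fun {H s β Θ} B hb hc => ⟨4, ?_⟩
    have hF : a ∉ F.names := hf.1 _ (Finset.mem_insert_self _ _)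
    have hh := hc.head
    rw [Fml.map_ex] at hh
    refine B.exL (m := 0) hh fun γ t => ?_
    have hc' := ((hc.tail.insert (inE t γ)).update
      (fun A hA => hf.1 A (Finset.mem_insert_of_mem hA)) t).push (F.inst ![a])
    rw [map_inst_update hF] at hc'
    have := g.use le_rfl (B.ctl γ) ((hb.ctl B.op a t γ).insert _) hc'
    rwa [option_map_update hf.2] at this
  | @exR Γ F a _ ih =>
    obtain ⟨k, g⟩ := ih
    refine Good.step k fun {H s β Θ} B hb hc => ⟨4, ?_⟩
    have := g.use le_rfl B hb hc
    simp only [Option.map_some, Fml.map_inst_one, Fml.map_ex] at this ⊢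
    exact B.exR (k := 0) (hb a).1 (B.hyp_mem (hb a).2 0) this
  | @allL Γ Δ F a _ ih =>
    obtain ⟨k, g⟩ := ih
    refine Good.step k fun {H s β Θ} B hb hc => ⟨4, ?_⟩
    have := g.use le_rfl B (hb.insert _) (hc.tail.push _)
    have hh := hc.head
    simp only [Fml.map_inst_one, Fml.map_all] at this hh
    exact B.allL hh (hb a).1 (hb a).2 this
  | @allR Γ F a hf _ ih =>
    obtain ⟨k, g⟩ := ih
    refine Good.step k fun {H s β Θ} B hb hc => ⟨4, ?_⟩
    have hF : a ∉ F.names := hf.2 _ rfl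
    rw [Option.map_some, Fml.map_all]
    refine B.allR (m := 0) fun γ t => ?_
    have := g.use le_rfl (B.ctl γ) (hb.ctl B.op a t γ) ((hc.insert (inE t γ)).update hf.1 t)
    rwa [Option.map_some, map_inst_update hF] at this
  | @eexL Γ Δ F c a b hf _ ih =>
    obtain ⟨k, g⟩ := ih
    refine Good.step k fun {H s β Θ} B hb hc => ⟨3, ?_⟩
    have hF := hf.1 _ (Finset.mem_insert_self _ _)
    simp only [Fml.names, Tm.names, Set.mem_union, Set.mem_singleton_iff, not_or] at hF
    have hh := hc.head
    rw [Fml.map_eex] at hh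
    obtain ⟨δ, hδ, e⟩ := B.exists_exp (hb a).1 (hb b).1
    refine B.eexL (m := 0) hh (hb a).1 (hb b).1 hδ e (hb a).2 (hb b).2 fun t => ?_
    have hc' := (((hc.tail.insert
      (.and (.fn (.con t) (.con (s a)) (.con (s b))) ((F.map s).inst ![t]))).insert
      (inE t δ)).update (fun A hA => hf.1 A (Finset.mem_insert_of_mem hA)) t).cons
      (A := .and (.fn (.con c) (.con a) (.con b)) (F.inst ![c])) (by
        simp [map_inst_update hF.2, Function.update_of_ne (Ne.symm hF.1.1),
          Function.update_of_ne (Ne.symm hF.1.2), Fml.map_fn_con, -Fml.map_inst])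
    have := g.use le_rfl B (((hb.insert _).insert _).update c hδ
      (Finset.mem_insert_self _ _)) hc'
    rwa [option_map_update hf.2] at this
  | @eexR Γ F c a b _ ih =>
    obtain ⟨k, g⟩ := ih
    refine Good.step k fun {H s β Θ} B hb hc => ⟨2, ?_⟩
    have := g.use le_rfl B hb hc
    simp only [Option.map_some, Fml.map_and, Fml.map_fn_con, Fml.map_inst_one, Fml.map_eex]
      at this ⊢
    exact B.eexR (hb a).1 (hb b).1 (hb c).1 (hb a).2 (hb b).2 (hb c).2 this
  | @eallL Γ Δ F c a b _ ih =>
    obtain ⟨k, g⟩ := ih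
    refine Good.step k fun {H s β Θ} B hb hc => ⟨2, ?_⟩
    have := g.use le_rfl B (hb.insert _) (hc.tail.push _)
    have hh := hc.head
    simp only [Fml.map_imp, Fml.map_fn_con, Fml.map_inst_one, Fml.map_eall] at this hh
    exact B.eallL hh (hb a).1 (hb b).1 (hb c).1 (hb a).2 (hb b).2 (hb c).2 this
  | @eallR Γ F c a b hf _ ih =>
    obtain ⟨k, g⟩ := ih
    -- Again the implication is cut away, because the level `δ` of `t` becomes available only from
    -- `fun(t, s a, s b)`.
    refine Good.step (max k (2 * (Fml.imp (.fn (.con c) (.con a) (.con b)) (F.inst ![c])).size))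
      fun {H s β Θ} B hb hc => ⟨10 * F.size + 5, ?_⟩
    have hF := hf.2 _ rfl
    simp only [Fml.names, Tm.names, Set.mem_union, Set.mem_singleton_iff, not_or] at hF
    obtain ⟨δ, hδ, e⟩ := B.exists_exp (hb a).1 (hb b).1
    rw [Option.map_some, Fml.map_eall]
    refine B.eallR (m := 10 * F.size + 2) (hb a).1 (hb b).1 hδ e (hb a).2 (hb b).2 fun t => ?_
    have hb' := ((hb.insert (.fn (.con t) (.con (s a)) (.con (s b)))).insert (inE t δ)).update c hδ
      (Finset.mem_insert_self _ _)
    have d := g.use (le_max_left _ _) B hb' (((hc.insert _).insert _).update hf.1 t)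
    refine B.cutF hb' _ (natCast_rank_le (le_max_right _ _) le_rfl) d (k := 10 * F.size + 1) ?_
    simp only [Fml.map_imp, Fml.map_fn_con, map_inst_update hF.2, Function.update_self,
      Function.update_of_ne (Ne.symm hF.1.1), Function.update_of_ne (Ne.symm hF.1.2)]
    refine B.impL (m := 10 * F.size) (k := 0) (Finset.mem_insert_self _ _) ?_
      (B.hyp_fn (by simp) 0)
    simpa using B.identity (A := (F.map s).inst ![t]) (by simp)
      (((((hb.insert _).insert _).insert _).insert _).leveled_inst F hδ (by simp))
  | @cut Γ Δ A _ _ ih₀ ih₁ =>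
    obtain ⟨k₀, g₀⟩ := ih₀
    obtain ⟨k₁, g₁⟩ := ih₁
    exact Good.step (max (max k₀ k₁) (2 * A.size)) fun {H s β Θ} B hb hc => ⟨1,
      B.cutF hb A (natCast_rank_le (le_max_right _ _) le_rfl)
        (g₀.use (le_max_of_le_left (le_max_left _ _)) B hb hc)
        (g₁.use (le_max_of_le_left (le_max_right _ _)) B (hb.insert _) (hc.push _))⟩

end IKPE

theorem mainTheorem9 (Γ : Finset (IKPE.Fml ℕ true 0)) (Δ : Option (IKPE.Fml ℕ true 0))
    (h : IKPE.Prov Γ Δ) :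
    ∃ k : ℕ, ∀ V : Finset ℕ,
      (∀ A ∈ Γ, A.names ⊆ V) → (∀ A ∈ Δ, A.names ⊆ V) →
      ∀ (s : ℕ → IKPE.Term) (β : ℕ → IKPE.Idx)
        (H : Set Ordinal.{0} → Set Ordinal.{0}), IKPE.IsOperator H →
        IKPE.Der (IKPE.Om + k) (IKPE.ctl H ((fun v => (β v).1) '' V))
          (IKPE.Om * Ordinal.omega0 ^ (k : Ordinal.{0}))
          (V.image (fun v => IKPE.inE (s v) (β v)) ∪ Γ.image (IKPE.Fml.map s))
          (Δ.map (IKPE.Fml.map s)) := by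
  obtain ⟨k, g⟩ := h.good
  -- The extra unit pays for the cut that removes the auxiliary hypothesis `𝔼_0 ∈ 𝔼_1`.
  refine ⟨k + 1, fun V hΓ hΔ s β H hH => ?_⟩
  have hY : (fun v => (β v).1) '' (V : Set ℕ) ⊆ IKPE.ON := by
    rintro _ ⟨v, -, rfl⟩
    exact (β v).2.1
  have hV := hH.mem_ctl hY
  replace hH := hH.ctl hY
  generalize IKPE.ctl H ((fun v => (β v).1) '' V) = H at hV hH
  have B : IKPE.Base (IKPE.Om + ((k + 1 : ℕ) : Ordinal.{0}))
      (IKPE.Om * Ordinal.omega0 ^ (k : Ordinal.{0})) H :=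
    ⟨hH, hH.Om_mul_opow_mem k, IKPE.Om_le_Om_mul_opow k, le_self_add⟩
  obtain ⟨z, hz, ez⟩ : ∃ z : IKPE.Idx, z.1 ∈ H ∅ ∧ z.1 = 0 :=
    ⟨hH.idx 0 hH.zero_mem' IKPE.Om_pos, hH.zero_mem', rfl⟩
  obtain ⟨o, ho, eo⟩ := B.exists_succ hz
  have hzo : z < o := by
    rw [← Subtype.coe_lt_coe, eo]
    exact lt_add_one _
  classical
  set Θ := V.image (fun v => IKPE.inE (s v) (β v)) ∪ Γ.image (IKPE.Fml.map s) with hΘ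
  -- Variables outside `V` receive the default value `𝔼_0` at level `1`. The assignment is then
  -- total with a finite context and controlled levels, and the instances of `Γ` and `Δ` do not
  -- change.
  set s' : ℕ → IKPE.Term := fun v => if v ∈ V then s v else .E z with hs'
  set β' : ℕ → IKPE.Idx := fun v => if v ∈ V then β v else o with hβ'
  have hmap : ∀ A : IKPE.Fml ℕ true 0, A.names ⊆ V → A.map s' = A.map s := fun A hA =>
    A.map_congr fun v hv => if_pos (hA hv)
  have hb : IKPE.Bds H s' β' (insert (IKPE.inE (.E z) o) Θ) := fun v => by
    by_cases hv : v ∈ V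
    · simp only [hs', hβ', if_pos hv]
      refine ⟨hV ⟨v, hv, rfl⟩, Finset.mem_insert_of_mem (Finset.mem_union_left _ ?_)⟩
      exact Finset.mem_image_of_mem (fun v => IKPE.inE (s v) (β v)) hv
    · simp only [hs', hβ', if_neg hv]
      exact ⟨ho, Finset.mem_insert_self _ _⟩
  have hc : IKPE.Covers s' Γ (insert (IKPE.inE (.E z) o) Θ) := fun A hA => by
    rw [hmap A (hΓ A hA)]
    exact Finset.mem_insert_of_mem (Finset.mem_union_right _ (Finset.mem_image_of_mem _ hA))
  have d := g.use le_rfl B hb hc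
  have hD : Δ.map (IKPE.Fml.map s') = Δ.map (IKPE.Fml.map s) := by
    cases Δ with
    | none => rfl
    | some A => simp [hmap A (hΔ A rfl)]
  rw [hD] at d
  refine IKPE.Der.mono le_rfl (B.cutE (n := 1) ho (B.ax (.e4 Θ hzo) 0) d) (IKPE.OpLe.refl H)
    subset_rfl (IKPE.Om_mul_opow_add_lt k 1).le (hH.Om_mul_opow_mem (k + 1))
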